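/- Let $\nabla\zeta=(\zeta_s,\zeta_t)$ denote the gradient of the outer phase $\zeta$ at a boundary point, split into its tangential and inward normal components, and put $$\rho_r=(1-\zeta_s^2)^{1/2},\qquad j=-(1-|\nabla\zeta|^2)\,\zeta_t .$$ If $|\nabla\zeta|<1/\sqrt3$, then $\rho_r>0$, $j^2<\frac{4}{27}\rho_r^6$, the number $\rho_j=(1-|\nabla\zeta|^2)^{1/2}$ is the largest positive solution of $$\rho_r^2-\frac{j^2}{\rho_j^4}-\rho_j^2=0, \qquad (1)$$ and $\zeta_t=-j/\rho_j^2$. More generally, let $K$ be a compact set of pairs $(\rho_r,j)\in\mathbb R^2$ such that $\rho_r>0$ and $j^2<\frac{4}{27}\rho_r^6$ for all $(\rho_r,j)\in K$. (For instance a single pair, or all pairs arising from the points of a compact boundary on which $\nabla\zeta$ is continuous with $|\nabla\zeta|<1/\sqrt3$.) Then there are constants $\sigma^*,\gamma,C>0$ such that for every $(\rho_r,j)\in K$ equation (1) has a largest positive solution $\rho_j$, and for every $\sigma_0>\sigma^*$ the problem $$ \begin{cases} -\rho''-\Big(\rho_r^2-\dfrac{(\sigma_0\varphi'-j)^2}{\rho^4}-\rho^2\Big)\rho=0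 & \text{in }\mathbb R_+,\\ -\sigma_0\varphi''+\rho^2\varphi=0 & \text{in }\mathbb R_+,\\ \rho'(0)=0,\qquad \varphi'(0)=j/\sigma_0 \end{cases} $$ has exactly one solution $(\rho,\varphi)$ of class $C^2$ on $[0,\infty)$ such that $\rho\ge\rho_j$ on $[0,\infty)$ and $(\rho-\rho_j,\varphi)\in H^1(\mathbb R_+,\mathbb R^2)$. Moreover, with $$\upsilon'=\frac{\sigma_0\varphi'-j}{\rho^2}-\zeta_t,\qquad \zeta_t=-\frac{j}{\rho_j^2},$$ this solution satisfies, for all $\tau\ge0$, $$|\varphi(\tau)|+|\varphi'(\tau)|+\big|\rho(\tau)^2-\rho_j^2\big|^{1/2}+|\rho'(\tau)|+|\upsilon'(\tau)|<C\,e^{-\gamma\sigma_0^{-1/2}\tau}.$$ -/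

import Mathlib

open Set MeasureTheory
open scoped ContDiff

noncomputable section

/-- The derivative of `f` on the closed half-line `[0, ∞)`: the ordinary derivative at interior
points and the right derivative at `0`. -/
def halfDeriv (f : ℝ → ℝ) : ℝ → ℝ := derivWithin f (Ici 0)

/-- `f ∈ H¹(ℝ₊)`: on `ℝ₊ = (0, ∞)` the function `f` is square integrable and has a square
integrable weak derivative `g`. -/
def MemH1HalfLine (f : ℝ → ℝ) : Prop :=
  MemLp f 2 (volume.restrict (Ioi 0)) ∧
    ∃ g : ℝ → ℝ, MemLp g 2 (volume.restrict (Ioi 0)) ∧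
      ∀ ψ : ℝ → ℝ, ContDiff ℝ ∞ ψ → HasCompactSupport ψ → tsupport ψ ⊆ Ioi 0 →
        ∫ x in Ioi (0 : ℝ), f x * deriv ψ x = -∫ x in Ioi (0 : ℝ), g x * ψ x

/-- The positive roots `r` of `ρr² - j² / r⁴ - r² = 0`, the equation for the limit at infinity of
the density `ρ` in the boundary layer. -/
def limitDensities (ρr j : ℝ) : Set ℝ :=
  {r | 0 < r ∧ ρr ^ 2 - j ^ 2 / r ^ 4 - r ^ 2 = 0}

/-- `(ρ, φ)` is a classical solution, of class `C²` on `[0, ∞)`, of the boundary-layer problem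
`-ρ'' - (ρr² - (σ₀ φ' - j)² / ρ⁴ - ρ²) ρ = 0` and `-σ₀ φ'' + ρ² φ = 0` in `ℝ₊`,
with `ρ'(0) = 0` and `φ'(0) = j / σ₀`. -/
structure IsBoundaryLayerSolution (ρr j σ₀ : ℝ) (ρ φ : ℝ → ℝ) : Prop where
  contDiffOn_ρ : ContDiffOn ℝ 2 ρ (Ici 0)
  contDiffOn_φ : ContDiffOn ℝ 2 φ (Ici 0)
  eq_ρ : ∀ τ : ℝ, 0 < τ →
    -halfDeriv (halfDeriv ρ) τ
      - (ρr ^ 2 - (σ₀ * halfDeriv φ τ - j) ^ 2 / ρ τ ^ 4 - ρ τ ^ 2) * ρ τ = 0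
  eq_φ : ∀ τ : ℝ, 0 < τ → -σ₀ * halfDeriv (halfDeriv φ) τ + ρ τ ^ 2 * φ τ = 0
  deriv_ρ_zero : halfDeriv ρ 0 = 0
  deriv_φ_zero : halfDeriv φ 0 = j / σ₀

/-- The solutions among which existence and uniqueness are claimed: those with `ρ ≥ ρj` on
`[0, ∞)` and `(ρ - ρj, φ) ∈ H¹(ℝ₊, ℝ²)`. -/
structure IsAdmissibleSolution (ρr j ρj σ₀ : ℝ) (ρ φ : ℝ → ℝ) : Prop where
  sol : IsBoundaryLayerSolution ρr j σ₀ ρ φ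
  le_ρ : ∀ τ : ℝ, 0 ≤ τ → ρj ≤ ρ τ
  memH1_ρ : MemH1HalfLine (fun τ => ρ τ - ρj)
  memH1_φ : MemH1HalfLine φ

/-- The derivative `υ' = (σ₀ φ' - j) / ρ² - ζt` of the phase correction `υ`, where `ζt` is the
derivative of the outer phase `ζ` at the boundary point along the inward normal. -/
def phaseDeriv (j ζt σ₀ : ℝ) (ρ φ : ℝ → ℝ) (τ : ℝ) : ℝ :=
  (σ₀ * halfDeriv φ τ - j) / ρ τ ^ 2 - ζt

end

/-!
The proof rests on a change of the independent variable which uncouples the two equations. Put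
`e = σ₀ ^ (-1/2)` and let `t` be the variable defined by `σ₀ φ' = j e^{-e t}`. Then `z = (e φ / φ')²`
satisfies the *linear* equation `dz/dt = 2 e (z - ρ⁻²)`, hence is an exponential average of `ρ⁻²`
over `[t, ∞)`, one has `dt/dτ = ρ² √z`, and `m = ρ³` satisfies the semilinear equation
`m'' + β m' + H / z = 0`, `m'(0) = 0`, with drift `β = e (1 - ρ⁻² / z)` and force
`H = 3 (ρr² / ρ - W² / ρ⁵ - ρ)`, where the flux `W = j (e^{-e t} - 1)` is an explicit function of `t`
with `W² ≤ j²`. The cube is what removes the term quadratic in the derivative. The problem is now a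
single scalar nonlocal equation.

The condition `j² < (4/27) ρr⁶` says that `3 ρj² > 2 ρr²`, and this makes `H` strongly decreasing in
`m` on `[ρj³, ρr³]` (`LayerParams.force_sub_mem`). For small `e` everything else is a perturbation:
the drift is `O(e)`, and `z` enters through `H / z`, where `H` is small because the flux varies at
the slow rate `e`. A fixed-point map built on the Neumann Green function, with `H` and `m` truncated,
is therefore a contraction (`exists_truncated_solution`), and the maximum principle
`exists_penalized_max` shows that the truncations are inactive (`exists_layerProfile`). The same
principle compares `m - ρj³` with a barrier `C e^{-e t}` (`LayerProfile.cube_sub_le`), from which the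
decay of all quantities follows, since `t` and `τ` are comparable.

For uniqueness an arbitrary admissible solution is first located. Convexity of `φ²` and of a power of
`max (ρ - ρr) 0`, together with square integrability, gives `ρ ≤ ρr`, `φ φ' < 0` (for `j ≠ 0`) and
`e ρj |φ| ≤ |φ'| ≤ e ρr |φ|`. So `σ₀ φ' / j` decreases strictly from `1`, and the change of variable
is available (`FirstOrderSolution.layerTrajectory`). Comparing with the constructed solution, the
maximum principle turns a bound `S` for the difference of the cubes into `3 S / 4`
(`LayerTrajectory.abs_cube_sub_le`), so the two solutions agree. For `j = 0` the only admissible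
solution is constant.

All constants depend only on bounds `a ≤ ρj ≤ ρr ≤ b` and `g ≤ 3 ρj² - 2 ρr²`, which are uniform on a
compact set of pairs `(ρr, j)`.
-/

open Filter Topology
open scoped BoundedContinuousFunction

/-! ### A maximum principle at infinity on the half-line -/

/-- At a maximum over a right neighbourhood the right derivative is nonpositive. -/
theorem HasDerivWithinAt.nonpos_of_right_max {f : ℝ → ℝ} {d x : ℝ}
    (hf : HasDerivWithinAt f d (Ici x) x) (hmax : ∀ y, x ≤ y → f y ≤ f x) : d ≤ 0 := by
  have : Ici x \ {x} = Ioi x := Ici_sdiff_left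
  rw [hasDerivWithinAt_iff_tendsto_slope, this] at hf
  refine le_of_tendsto hf ?_
  filter_upwards [self_mem_nhdsWithin] with y hy
  rw [slope_def_field]
  exact div_nonpos_of_nonpos_of_nonneg (by linarith [hmax y (le_of_lt hy)])
    (by linarith [mem_Ioi.1 hy])

theorem HasDerivWithinAt.eventually_pos_right {q : ℝ → ℝ} {d x : ℝ}
    (hq : HasDerivWithinAt q d (Ici x) x) (hx : q x = 0) (hd : 0 < d) :
    ∀ᶠ y in 𝓝[>] x, 0 < q y := by
  have : Ici x \ {x} = Ioi x := Ici_sdiff_left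
  rw [hasDerivWithinAt_iff_tendsto_slope, this] at hq
  filter_upwards [hq.eventually_const_lt hd, self_mem_nhdsWithin] with y hy hxy
  rw [slope_def_field, hx, sub_zero] at hy
  exact (div_pos_iff_of_pos_right (by linarith [mem_Ioi.1 hxy])).1 hy

theorem monotoneOn_Ici_of_hasDerivWithinAt {f f' : ℝ → ℝ} {x₀ : ℝ}
    (hf : ∀ x, x₀ ≤ x → HasDerivWithinAt f (f' x) (Ici x₀) x)
    (h0 : ∀ x, x₀ ≤ x → 0 ≤ f' x) : MonotoneOn f (Ici x₀) := by
  refine monotoneOn_of_hasDerivWithinAt_nonneg (convex_Ici _)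
    (fun x hx => (hf x hx).continuousWithinAt) (f' := f') (fun x hx => ?_) (fun x hx => ?_)
  · exact (hf x (interior_subset hx)).mono interior_subset
  · exact h0 x (interior_subset hx)

/-- Maximum principle at infinity on the half-line, in a variable `T` with speed `κ`: a function
bounded above whose derivative at `0` is nonnegative is, after subtraction of a quadratic
penalty centred at `τ₀`, maximal at some `τ₁`, and there its first two `T`-derivatives `p`, `g` are
controlled by those of the penalty. -/
theorem exists_penalized_max {f p g T κ : ℝ → ℝ} {κ₀ B η τ₀ : ℝ}
    (hf : ∀ τ, 0 ≤ τ → HasDerivWithinAt f (κ τ * p τ) (Ici 0) τ)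
    (hp : ∀ τ, 0 ≤ τ → HasDerivWithinAt p (κ τ * g τ) (Ici 0) τ)
    (hT : ∀ τ, 0 ≤ τ → HasDerivWithinAt T (κ τ) (Ici 0) τ)
    (hκ₀ : 0 < κ₀) (hκ : ∀ τ, 0 ≤ τ → κ₀ ≤ κ τ) (hp0 : 0 ≤ p 0)
    (hB : ∀ τ, 0 ≤ τ → f τ ≤ B) (hη : 0 < η) (hτ₀ : 0 ≤ τ₀) :
    ∃ τ₁, 0 ≤ τ₁ ∧ f τ₀ + η * (T τ₁ - T τ₀) ^ 2 ≤ f τ₁ ∧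
      p τ₁ = 2 * η * (T τ₁ - T τ₀) ∧ g τ₁ ≤ 2 * η := by
  have hTmono : ∀ τ, 0 ≤ τ → ∀ τ', τ ≤ τ' → κ₀ * (τ' - τ) ≤ T τ' - T τ := by
    have := monotoneOn_Ici_of_hasDerivWithinAt (f := fun τ => T τ - κ₀ * τ)
      (f' := fun τ => κ τ - κ₀) (x₀ := 0)
      (fun x hx => ((hT x hx).sub ((hasDerivWithinAt_id x _).const_mul κ₀)).congr_deriv (by simp))
      (fun x hx => by linarith [hκ x hx])
    intro τ h0 τ' h
    have := this h0 (le_trans h0 h) h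
    simp only at this
    linarith
  set G : ℝ → ℝ := fun τ => f τ - η * (T τ - T τ₀) ^ 2 with hG
  set q : ℝ → ℝ := fun τ => p τ - 2 * η * (T τ - T τ₀) with hq
  have hGd : ∀ τ, 0 ≤ τ → HasDerivWithinAt G (κ τ * q τ) (Ici 0) τ := by
    intro τ h
    have := (hf τ h).sub ((((hT τ h).sub_const (T τ₀)).pow 2).const_mul η)
    refine this.congr_deriv ?_
    simp only [hq]; push_cast; ring
  have hqd : ∀ τ, 0 ≤ τ → HasDerivWithinAt q (κ τ * (g τ - 2 * η)) (Ici 0) τ := by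
    intro τ h
    have := (hp τ h).sub (((hT τ h).sub_const (T τ₀)).const_mul (2 * η))
    refine this.congr_deriv ?_
    ring
  -- outside `[0, R]` the penalty exceeds the oscillation of `f`
  obtain ⟨R, hR, hRB⟩ : ∃ R, τ₀ ≤ R ∧ ∀ τ, R ≤ τ → G τ ≤ G τ₀ := by
    refine ⟨τ₀ + (1 + (B - f τ₀) / η) / κ₀, ?_, ?_⟩
    · have := hB τ₀ hτ₀
      have : 0 ≤ (B - f τ₀) / η := div_nonneg (by linarith) hη.le
      have : 0 ≤ (1 + (B - f τ₀) / η) / κ₀ := by positivity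
      linarith
    · intro τ h
      have hb := hB τ₀ hτ₀
      have h1 : 0 ≤ (B - f τ₀) / η := div_nonneg (by linarith) hη.le
      have h3 : 0 ≤ (1 + (B - f τ₀) / η) / κ₀ := by positivity
      have h2 := hTmono τ₀ hτ₀ τ (by linarith)
      have h4 : 1 + (B - f τ₀) / η ≤ T τ - T τ₀ := by
        refine le_trans ?_ h2
        have : (1 + (B - f τ₀) / η) / κ₀ ≤ τ - τ₀ := by linarith
        rw [div_le_iff₀ hκ₀] at this; linarith
      have h5 : (B - f τ₀) / η ≤ (T τ - T τ₀) ^ 2 := by nlinarith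
      rw [div_le_iff₀ hη] at h5
      have := hB τ (by linarith)
      simp only [hG]; simp; nlinarith
  obtain ⟨τ₁, hτ₁, hmax⟩ := isCompact_Icc.exists_isMaxOn (s := Icc 0 R) ⟨τ₀, hτ₀, hR⟩
    (f := G) (fun x hx => ((hGd x hx.1).continuousWithinAt).mono Icc_subset_Ici_self)
  have hmax' : ∀ τ, 0 ≤ τ → G τ ≤ G τ₁ := by
    intro τ h
    rcases le_total τ R with h' | h'
    · exact hmax ⟨h, h'⟩
    · exact (hRB τ h').trans (hmax ⟨hτ₀, hR⟩)
  have h0 : 0 ≤ τ₁ := hτ₁.1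
  have hk1 : 0 < κ τ₁ := lt_of_lt_of_le hκ₀ (hκ _ h0)
  have hsub : Ici τ₁ ⊆ Ici (0 : ℝ) := Ici_subset_Ici.2 h0
  have hq1 : q τ₁ ≤ 0 := by
    have := ((hGd τ₁ h0).mono hsub).nonpos_of_right_max
      (fun y hy => hmax' y (h0.trans hy))
    exact nonpos_of_mul_nonpos_right this hk1
  have hq2 : 0 ≤ q τ₁ := by
    rcases h0.eq_or_lt with h | h
    · have : T 0 ≤ T τ₀ := by nlinarith [hTmono 0 le_rfl τ₀ hτ₀]
      simp only [hq, ← h]; nlinarith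
    · have hd := (hGd τ₁ h0).hasDerivAt (Ici_mem_nhds h)
      have hl : IsLocalMax G τ₁ := by
        filter_upwards [Ici_mem_nhds h] with y hy using hmax' y hy
      have := hl.hasDerivAt_eq_zero hd
      rcases mul_eq_zero.1 this with h | h
      · exact absurd h hk1.ne'
      · exact h.ge
  have hq0 : q τ₁ = 0 := le_antisymm hq1 hq2
  refine ⟨τ₁, h0, ?_, ?_, ?_⟩
  · have := hmax' τ₀ hτ₀
    simp only [hG] at this
    simp at this; linarith
  · have := hq0; simp only [hq] at this; linarith
  · by_contra! hlt
    have hev := ((hqd τ₁ h0).mono hsub).eventually_pos_right hq0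
      (mul_pos hk1 (by linarith))
    obtain ⟨u, hu, hu'⟩ := mem_nhdsGT_iff_exists_Ioo_subset.1 hev
    have hu : τ₁ < u := hu
    have hsm : StrictMonoOn G (Ico τ₁ u) := by
      refine strictMonoOn_of_deriv_pos (convex_Ico _ _)
        (fun x hx => ((hGd x (h0.trans hx.1)).continuousWithinAt).mono
          (fun y hy => h0.trans hy.1)) (fun x hx => ?_)
      rw [interior_Ico] at hx
      have hx0 : 0 < x := lt_of_le_of_lt h0 hx.1
      rw [((hGd x hx0.le).hasDerivAt (Ici_mem_nhds hx0)).deriv]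
      exact mul_pos (lt_of_lt_of_le hκ₀ (hκ _ hx0.le)) (hu' hx)
    have hm : (τ₁ + u) / 2 ∈ Ico τ₁ u := ⟨by linarith, by linarith⟩
    have := hsm ⟨le_rfl, hu⟩ hm (by linarith)
    exact absurd (hmax' _ (h0.trans hm.1)) (not_le.2 this)

/-- Omori–Yau form of the maximum principle: almost critical points with value above `f τ₀`. -/
theorem exists_almost_max {f p g T κ : ℝ → ℝ} {κ₀ B δ τ₀ : ℝ}
    (hf : ∀ τ, 0 ≤ τ → HasDerivWithinAt f (κ τ * p τ) (Ici 0) τ)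
    (hp : ∀ τ, 0 ≤ τ → HasDerivWithinAt p (κ τ * g τ) (Ici 0) τ)
    (hT : ∀ τ, 0 ≤ τ → HasDerivWithinAt T (κ τ) (Ici 0) τ)
    (hκ₀ : 0 < κ₀) (hκ : ∀ τ, 0 ≤ τ → κ₀ ≤ κ τ) (hp0 : 0 ≤ p 0)
    (hB : ∀ τ, 0 ≤ τ → f τ ≤ B) (hδ : 0 < δ) (hτ₀ : 0 ≤ τ₀) :
    ∃ τ₁, 0 ≤ τ₁ ∧ f τ₀ ≤ f τ₁ ∧ |p τ₁| ≤ δ ∧ g τ₁ ≤ δ := by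
  have hb : 0 ≤ B - f τ₀ := by linarith [hB τ₀ hτ₀]
  set η := min (δ / 2) (δ ^ 2 / (4 * (B - f τ₀ + 1))) with hη
  have hη0 : 0 < η := lt_min (by positivity) (by positivity)
  obtain ⟨τ₁, h0, h1, h2, h3⟩ := exists_penalized_max hf hp hT hκ₀ hκ hp0 hB hη0 hτ₀
  have hη1 : 2 * η ≤ δ := by have := min_le_left (δ / 2) (δ ^ 2 / (4 * (B - f τ₀ + 1))); linarith
  have hη2 : 4 * (B - f τ₀ + 1) * η ≤ δ ^ 2 := by
    have : η ≤ δ ^ 2 / (4 * (B - f τ₀ + 1)) := min_le_right _ _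
    rw [le_div_iff₀ (by positivity)] at this; linarith
  refine ⟨τ₁, h0, by nlinarith [sq_nonneg (T τ₁ - T τ₀)], ?_, h3.trans hη1⟩
  refine abs_le_of_sq_le_sq ?_ hδ.le
  rw [h2]
  have h4 : η * (T τ₁ - T τ₀) ^ 2 ≤ B - f τ₀ := by linarith [hB τ₁ h0]
  calc (2 * η * (T τ₁ - T τ₀)) ^ 2 = 4 * η * (η * (T τ₁ - T τ₀) ^ 2) := by ring
    _ ≤ 4 * η * (B - f τ₀) := by gcongr
    _ ≤ δ ^ 2 := by nlinarith

/-- Bound of a first derivative by the function and the second derivative on a unit interval. -/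
theorem abs_deriv_le_of_unit_interval {f p g : ℝ → ℝ} {t D G : ℝ} (ht : 0 ≤ t)
    (hf : ∀ s, 0 ≤ s → HasDerivWithinAt f (p s) (Ici 0) s)
    (hp : ∀ s, 0 ≤ s → HasDerivWithinAt p (g s) (Ici 0) s)
    (hD : |f (t + 1) - f t| ≤ D) (hg : ∀ s, t ≤ s → |g s| ≤ |p s| / 2 + G) :
    |p t| ≤ 2 * (D + G) := by
  have hsub : Icc t (t + 1) ⊆ Ici 0 := fun x hx => ht.trans hx.1
  obtain ⟨s, hs, hs'⟩ := exists_hasDerivAt_eq_slope f p (by linarith : t < t + 1)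
    (fun x hx => ((hf x (hsub hx)).continuousWithinAt).mono hsub)
    (fun x hx => (hf x (ht.trans hx.1.le)).hasDerivAt (Ici_mem_nhds (lt_of_le_of_lt ht hx.1)))
  have hs1 : |p s| ≤ D := by rw [hs']; simpa using hD
  obtain ⟨x, hx, hmax⟩ := isCompact_Icc.exists_isMaxOn (s := Icc t (t + 1))
    ⟨t, by simp⟩ (f := fun y => |p y|)
    (fun y hy => (((hp y (hsub hy)).continuousWithinAt).mono hsub).abs)
  have hG : ∀ y ∈ Icc t (t + 1), ‖g y‖ ≤ |p x| / 2 + G := by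
    intro y hy
    have h1 : |p y| ≤ |p x| := hmax hy
    have := hg y hy.1
    rw [Real.norm_eq_abs]; linarith
  have hG0 : 0 ≤ |p x| / 2 + G := (norm_nonneg _).trans (hG x hx)
  have := Convex.norm_image_sub_le_of_norm_hasDerivWithin_le (f := p) (f' := g)
    (fun y hy => (hp y (hsub hy)).mono hsub) hG (convex_Icc _ _) (Ioo_subset_Icc_self hs) hx
  have hxs : ‖x - s‖ ≤ 1 := by
    rw [Real.norm_eq_abs, abs_le]; constructor <;> linarith [hx.1, hx.2, hs.1, hs.2]
  have h3 : |p x - p s| ≤ |p x| / 2 + G := by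
    rw [Real.norm_eq_abs] at this; nlinarith
  have h4 := abs_sub_abs_le_abs_sub (p x) (p s)
  have h5 : |p t| ≤ |p x| := hmax (by simp : t ∈ Icc t (t + 1))
  linarith

/-! ### Exponential averages, the Neumann Green function, and time changes -/

/-- The bounded solution `t ↦ ∫_t^∞ e^{k (t - s)} h s ds` of `v' = k v - h`. -/
noncomputable def expTail (k : ℝ) (h : ℝ → ℝ) (t : ℝ) : ℝ :=
  Real.exp (k * t) * ∫ s in Ioi t, Real.exp (-k * s) * h s

theorem integrableOn_exp_mul {k C : ℝ} (hk : 0 < k) {h : ℝ → ℝ} (hc : Continuous h)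
    (hC : ∀ s, |h s| ≤ C) (t : ℝ) :
    IntegrableOn (fun s => Real.exp (-k * s) * h s) (Ioi t) := by
  have := integrableOn_exp_mul_Ioi (a := -k) (by linarith) t
  exact this.mul_bdd (c := C) hc.aestronglyMeasurable (ae_of_all _ hC)

theorem integral_exp_neg_mul_Ioi {k : ℝ} (hk : 0 < k) (t : ℝ) :
    ∫ s in Ioi t, Real.exp (-k * s) = Real.exp (-k * t) / k := by
  rw [integral_exp_mul_Ioi (by linarith)]; field_simp

theorem expTail_hasDerivAt {k C : ℝ} (hk : 0 < k) {h : ℝ → ℝ} (hc : Continuous h)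
    (hC : ∀ s, |h s| ≤ C) (t : ℝ) :
    HasDerivAt (expTail k h) (k * expTail k h t - h t) t := by
  set F : ℝ → ℝ := fun s => Real.exp (-k * s) * h s with hF
  have hFc : Continuous F := by fun_prop
  have hsplit : ∀ x, ∫ s in Ioi x, F s = (∫ s in Ioi 0, F s) - ∫ s in (0 : ℝ)..x, F s := by
    intro x
    have := intervalIntegral.integral_Ioi_sub_Ioi' (integrableOn_exp_mul hk hc hC 0)
      (integrableOn_exp_mul hk hc hC x)
    simp only [hF] at *
    linarith
  have h1 : HasDerivAt (fun x => ∫ s in Ioi x, F s) (-F t) t := by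
    rw [funext hsplit]
    have := (intervalIntegral.integral_hasDerivAt_right (hFc.intervalIntegrable 0 t)
      (hFc.stronglyMeasurableAtFilter _ _) hFc.continuousAt).const_sub (∫ s in Ioi 0, F s)
    exact this
  have h2 : HasDerivAt (fun x => Real.exp (k * x)) (Real.exp (k * t) * k) t := by
    simpa using ((hasDerivAt_id t).const_mul k).exp
  refine (h2.mul h1).congr_deriv ?_
  have : Real.exp (k * t) * Real.exp (-k * t) = 1 := by rw [← Real.exp_add]; simp
  simp only [expTail, hF]
  linear_combination (-h t) * this

theorem expTail_sub {k C₁ C₂ : ℝ} (hk : 0 < k) {h₁ h₂ : ℝ → ℝ} (hc₁ : Continuous h₁)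
    (hC₁ : ∀ s, |h₁ s| ≤ C₁) (hc₂ : Continuous h₂) (hC₂ : ∀ s, |h₂ s| ≤ C₂) (t : ℝ) :
    expTail k (fun s => h₁ s - h₂ s) t = expTail k h₁ t - expTail k h₂ t := by
  simp only [expTail, mul_sub]
  rw [integral_sub (integrableOn_exp_mul hk hc₁ hC₁ t) (integrableOn_exp_mul hk hc₂ hC₂ t)]
  ring

theorem expTail_le {k C hi : ℝ} (hk : 0 < k) {h : ℝ → ℝ} (hc : Continuous h)
    (hC : ∀ s, |h s| ≤ C) (hhi : ∀ s, h s ≤ hi) (t : ℝ) : expTail k h t ≤ hi / k := by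
  have h1 : ∫ s in Ioi t, Real.exp (-k * s) * h s ≤ ∫ s in Ioi t, Real.exp (-k * s) * hi := by
    refine setIntegral_mono (integrableOn_exp_mul hk hc hC t)
      (integrableOn_exp_mul hk continuous_const (C := |hi|) (fun _ => le_rfl) t) (fun s => ?_)
    exact mul_le_mul_of_nonneg_left (hhi s) (Real.exp_pos _).le
  rw [integral_mul_const, integral_exp_neg_mul_Ioi hk] at h1
  have : Real.exp (k * t) * Real.exp (-k * t) = 1 := by rw [← Real.exp_add]; simp
  calc expTail k h t ≤ Real.exp (k * t) * (Real.exp (-k * t) / k * hi) := by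
        unfold expTail; gcongr
    _ = hi / k := by linear_combination (hi / k) * this

theorem le_expTail {k C lo : ℝ} (hk : 0 < k) {h : ℝ → ℝ} (hc : Continuous h)
    (hC : ∀ s, |h s| ≤ C) (hlo : ∀ s, lo ≤ h s) (t : ℝ) : lo / k ≤ expTail k h t := by
  have := expTail_le (h := fun s => -h s) hk hc.neg (C := C) (fun s => by simpa using hC s) (hi := -lo)
    (fun s => by simpa using hlo s) t
  have h2 : expTail k (fun s => - h s) t = - expTail k h t := by
    simp [expTail, integral_neg]
  rw [h2, neg_div] at this
  linarith

theorem abs_expTail_le {k C : ℝ} (hk : 0 < k) {h : ℝ → ℝ} (hc : Continuous h)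
    (hC : ∀ s, |h s| ≤ C) (t : ℝ) : |expTail k h t| ≤ C / k := by
  rw [abs_le, ← neg_div]
  exact ⟨le_expTail hk hc hC (fun s => (abs_le.1 (hC s)).1) t,
    expTail_le hk hc hC (fun s => (abs_le.1 (hC s)).2) t⟩

theorem expTail_continuous {k C : ℝ} (hk : 0 < k) {h : ℝ → ℝ} (hc : Continuous h)
    (hC : ∀ s, |h s| ≤ C) : Continuous (expTail k h) :=
  continuous_iff_continuousAt.2 fun t => (expTail_hasDerivAt hk hc hC t).continuousAt

/-- The solution of `N'' = k² N - h`, `N'(0) = 0` which is bounded on `[0, ∞)`, obtained from the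
factorisation `(∂ - k)(∂ + k)`. -/
noncomputable def neumannGreen (k : ℝ) (h : ℝ → ℝ) (t : ℝ) : ℝ :=
  Real.exp (-k * t) * (expTail k h 0 / k + ∫ s in (0 : ℝ)..t, Real.exp (k * s) * expTail k h s)

/-- The derivative of `neumannGreen k h`. -/
noncomputable def neumannGreenDeriv (k : ℝ) (h : ℝ → ℝ) (t : ℝ) : ℝ :=
  expTail k h t - k * neumannGreen k h t

section Green
variable {k C : ℝ} {h : ℝ → ℝ}

theorem neumannGreen_hasDerivAt (hk : 0 < k) (hc : Continuous h) (hC : ∀ s, |h s| ≤ C) (t : ℝ) :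
    HasDerivAt (neumannGreen k h) (neumannGreenDeriv k h t) t := by
  have hv := expTail_continuous hk hc hC
  have hFc : Continuous fun s => Real.exp (k * s) * expTail k h s := by fun_prop
  have h1 := (intervalIntegral.integral_hasDerivAt_right (hFc.intervalIntegrable 0 t)
      (hFc.stronglyMeasurableAtFilter _ _) hFc.continuousAt).const_add (expTail k h 0 / k)
  have h2 : HasDerivAt (fun x => Real.exp (-k * x)) (Real.exp (-k * t) * (-k)) t := by
    simpa using ((hasDerivAt_id t).const_mul (-k)).exp
  refine (h2.mul h1).congr_deriv ?_
  have : Real.exp (-k * t) * Real.exp (k * t) = 1 := by rw [← Real.exp_add]; simp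
  simp only [neumannGreenDeriv, neumannGreen]
  linear_combination (expTail k h t) * this

theorem neumannGreenDeriv_hasDerivAt (hk : 0 < k) (hc : Continuous h) (hC : ∀ s, |h s| ≤ C)
    (t : ℝ) : HasDerivAt (neumannGreenDeriv k h) (k ^ 2 * neumannGreen k h t - h t) t := by
  refine ((expTail_hasDerivAt hk hc hC t).sub
    ((neumannGreen_hasDerivAt hk hc hC t).const_mul k)).congr_deriv ?_
  simp only [neumannGreenDeriv]; ring

theorem neumannGreenDeriv_zero (hk : 0 < k) : neumannGreenDeriv k h 0 = 0 := by
  simp [neumannGreenDeriv, neumannGreen]; field_simp; simp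

theorem abs_neumannGreen_le (hk : 0 < k) (hc : Continuous h) (hC : ∀ s, |h s| ≤ C) {t : ℝ}
    (ht : 0 ≤ t) : |neumannGreen k h t| ≤ C / k ^ 2 := by
  have hv := expTail_continuous hk hc hC
  have hC0 : 0 ≤ C := (abs_nonneg _).trans (hC 0)
  have h1 : |∫ s in (0 : ℝ)..t, Real.exp (k * s) * expTail k h s| ≤
      ∫ s in (0 : ℝ)..t, Real.exp (k * s) * (C / k) := by
    rw [← Real.norm_eq_abs]
    refine intervalIntegral.norm_integral_le_of_norm_le ht (ae_of_all _ fun s _ => ?_)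
      (Continuous.intervalIntegrable (by fun_prop) _ _)
    rw [norm_mul, Real.norm_of_nonneg (Real.exp_pos _).le]
    exact mul_le_mul_of_nonneg_left (abs_expTail_le hk hc hC s) (Real.exp_pos _).le
  have h2 : ∫ s in (0 : ℝ)..t, Real.exp (k * s) = (Real.exp (k * t) - 1) / k := by
    rw [intervalIntegral.integral_comp_mul_left (fun x => Real.exp x) hk.ne']
    simp [integral_exp]; field_simp
  rw [intervalIntegral.integral_mul_const, h2] at h1
  have h3 : |expTail k h 0 / k| ≤ C / k / k := by
    rw [abs_div, abs_of_pos hk]; gcongr; exact abs_expTail_le hk hc hC 0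
  have : Real.exp (-k * t) * Real.exp (k * t) = 1 := by rw [← Real.exp_add]; simp
  unfold neumannGreen
  rw [abs_mul, abs_of_pos (Real.exp_pos _)]
  calc _ ≤ Real.exp (-k * t) * (C / k / k + (Real.exp (k * t) - 1) / k * (C / k)) := by
        gcongr
        exact (abs_add_le _ _).trans (add_le_add h3 h1)
    _ = C / k ^ 2 := by
        rw [neg_mul] at this ⊢
        field_simp
        linear_combination C * this

theorem abs_neumannGreenDeriv_le (hk : 0 < k) (hc : Continuous h) (hC : ∀ s, |h s| ≤ C) {t : ℝ}
    (ht : 0 ≤ t) : |neumannGreenDeriv k h t| ≤ 2 * C / k := by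
  have h1 := abs_neumannGreen_le hk hc hC ht
  have h2 := abs_expTail_le hk hc hC t
  unfold neumannGreenDeriv
  calc _ ≤ |expTail k h t| + |k * neumannGreen k h t| := abs_sub _ _
    _ ≤ C / k + k * (C / k ^ 2) := by
        rw [abs_mul, abs_of_pos hk]; gcongr
    _ = 2 * C / k := by field_simp; ring

end Green

theorem neumannGreen_sub {k C₁ C₂ : ℝ} (hk : 0 < k) {h₁ h₂ : ℝ → ℝ} (hc₁ : Continuous h₁)
    (hC₁ : ∀ s, |h₁ s| ≤ C₁) (hc₂ : Continuous h₂) (hC₂ : ∀ s, |h₂ s| ≤ C₂) (t : ℝ) :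
    neumannGreen k (fun s => h₁ s - h₂ s) t = neumannGreen k h₁ t - neumannGreen k h₂ t := by
  have hv₁ := expTail_continuous hk hc₁ hC₁
  have hv₂ := expTail_continuous hk hc₂ hC₂
  simp only [neumannGreen, expTail_sub hk hc₁ hC₁ hc₂ hC₂, mul_sub]
  rw [intervalIntegral.integral_sub (Continuous.intervalIntegrable (by fun_prop) _ _)
    (Continuous.intervalIntegrable (by fun_prop) _ _)]
  ring

theorem neumannGreenDeriv_sub {k C₁ C₂ : ℝ} (hk : 0 < k) {h₁ h₂ : ℝ → ℝ} (hc₁ : Continuous h₁)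
    (hC₁ : ∀ s, |h₁ s| ≤ C₁) (hc₂ : Continuous h₂) (hC₂ : ∀ s, |h₂ s| ≤ C₂) (t : ℝ) :
    neumannGreenDeriv k (fun s => h₁ s - h₂ s) t =
      neumannGreenDeriv k h₁ t - neumannGreenDeriv k h₂ t := by
  simp only [neumannGreenDeriv, neumannGreen_sub hk hc₁ hC₁ hc₂ hC₂,
    expTail_sub hk hc₁ hC₁ hc₂ hC₂]
  ring

/-- Inversion of a time change: the autonomous equation `T' = κ(T)` with `κ` continuous and bounded
above and below by positive constants has a global solution. -/
theorem exists_timeChange {κ : ℝ → ℝ} {κ₀ κ₁ : ℝ} (hc : Continuous κ) (h0 : 0 < κ₀)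
    (hlo : ∀ t, κ₀ ≤ κ t) (hhi : ∀ t, κ t ≤ κ₁) :
    ∃ T : ℝ → ℝ, T 0 = 0 ∧ ∀ τ, HasDerivAt T (κ (T τ)) τ := by
  have hpos : ∀ t, 0 < κ t := fun t => h0.trans_le (hlo t)
  have h1 : 0 < κ₁ := (hpos 0).trans_le (hhi 0)
  have hic : Continuous fun t => (κ t)⁻¹ := hc.inv₀ fun t => (hpos t).ne'
  set S : ℝ → ℝ := fun t => ∫ s in (0 : ℝ)..t, (κ s)⁻¹ with hS
  have hSd : ∀ t, HasDerivAt S (κ t)⁻¹ t := fun t =>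
    intervalIntegral.integral_hasDerivAt_right (hic.intervalIntegrable 0 t)
      (hic.stronglyMeasurableAtFilter _ _) hic.continuousAt
  have hSc : Continuous S := continuous_iff_continuousAt.2 fun t => (hSd t).continuousAt
  have hmono : StrictMono S := strictMono_of_deriv_pos fun t => by
    rw [(hSd t).deriv]; exact inv_pos.2 (hpos t)
  have hgrow : Monotone fun t => S t - κ₁⁻¹ * t := by
    refine monotone_of_hasDerivAt_nonneg
      (fun t => ((hSd t).sub ((hasDerivAt_id t).const_mul κ₁⁻¹))) (fun t => ?_)
    have := inv_anti₀ (hpos t) (hhi t)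
    simpa using this
  have hS0 : S 0 = 0 := by simp [hS]
  have htop : Tendsto S atTop atTop := by
    refine tendsto_atTop_mono' _ ?_ (tendsto_id.const_mul_atTop (inv_pos.2 h1))
    filter_upwards [eventually_ge_atTop 0] with t ht
    have := hgrow ht
    simp [hS0] at this
    simpa using this
  have hbot : Tendsto S atBot atBot := by
    refine tendsto_atBot_mono' _ ?_ (tendsto_id.const_mul_atBot (inv_pos.2 h1))
    filter_upwards [eventually_le_atBot 0] with t ht
    have := hgrow ht
    simp [hS0] at this
    simpa using this
  have hsurj : Function.Surjective S := hSc.surjective htop hbot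
  set E := hmono.orderIsoOfSurjective S hsurj with hE
  have hES : ∀ t, E t = S t := fun t => rfl
  refine ⟨E.symm, ?_, fun τ => ?_⟩
  · rw [E.symm_apply_eq, hES, hS0]
  · have := HasDerivAt.of_local_left_inverse (f := S) (g := E.symm) (a := τ)
      E.symm.continuous.continuousAt (hSd (E.symm τ)) (inv_pos.2 (hpos _)).ne'
      (Eventually.of_forall fun y => by rw [← hES]; exact E.apply_symm_apply y)
    simpa using this

/-! ### Regularity and integrability on the half-line -/

theorem halfDeriv_eq {f : ℝ → ℝ} {d τ : ℝ} (hτ : 0 ≤ τ) (h : HasDerivWithinAt f d (Ici 0) τ) :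
    halfDeriv f τ = d :=
  h.derivWithin (uniqueDiffOn_Ici 0 τ hτ)

theorem hasDerivWithinAt_halfDeriv {f f' f'' : ℝ → ℝ}
    (h1 : ∀ τ, 0 ≤ τ → HasDerivWithinAt f (f' τ) (Ici 0) τ)
    (h2 : ∀ τ, 0 ≤ τ → HasDerivWithinAt f' (f'' τ) (Ici 0) τ) {τ : ℝ} (hτ : 0 ≤ τ) :
    HasDerivWithinAt (halfDeriv f) (f'' τ) (Ici 0) τ :=
  (h2 τ hτ).congr (fun x hx => halfDeriv_eq hx (h1 x hx)) (halfDeriv_eq hτ (h1 τ hτ))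

theorem contDiffOn_two_of_hasDerivWithinAt {f f' f'' : ℝ → ℝ}
    (h1 : ∀ τ, 0 ≤ τ → HasDerivWithinAt f (f' τ) (Ici 0) τ)
    (h2 : ∀ τ, 0 ≤ τ → HasDerivWithinAt f' (f'' τ) (Ici 0) τ)
    (h3 : ContinuousOn f'' (Ici 0)) : ContDiffOn ℝ 2 f (Ici 0) := by
  have hu := uniqueDiffOn_Ici (0 : ℝ)
  have e2 : (2 : WithTop ℕ∞) = 1 + 1 := by norm_num
  have e1 : (1 : WithTop ℕ∞) = 0 + 1 := by norm_num
  rw [e2, contDiffOn_succ_iff_derivWithin hu]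
  refine ⟨fun x hx => (h1 x hx).differentiableWithinAt, by simp, ?_⟩
  rw [e1, contDiffOn_succ_iff_derivWithin hu]
  have hd : ∀ x ∈ Ici (0 : ℝ), HasDerivWithinAt (derivWithin f (Ici 0)) (f'' x) (Ici 0) x :=
    fun x hx => hasDerivWithinAt_halfDeriv h1 h2 hx
  refine ⟨fun x hx => (hd x hx).differentiableWithinAt, by simp, ?_⟩
  rw [contDiffOn_zero]
  exact h3.congr fun x hx => (hd x hx).derivWithin (hu x hx)

theorem hasDerivWithinAt_of_contDiffOn_two {f : ℝ → ℝ} (h : ContDiffOn ℝ 2 f (Ici 0)) :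
    (∀ τ, 0 ≤ τ → HasDerivWithinAt f (halfDeriv f τ) (Ici 0) τ) ∧
    (∀ τ, 0 ≤ τ → HasDerivWithinAt (halfDeriv f) (halfDeriv (halfDeriv f) τ) (Ici 0) τ) ∧
    ContinuousOn (halfDeriv (halfDeriv f)) (Ici 0) := by
  have hu := uniqueDiffOn_Ici (0 : ℝ)
  have e2 : (2 : WithTop ℕ∞) = 1 + 1 := by norm_num
  have e1 : (1 : WithTop ℕ∞) = 0 + 1 := by norm_num
  rw [e2, contDiffOn_succ_iff_derivWithin hu] at h
  obtain ⟨ha, -, h⟩ := h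
  rw [e1, contDiffOn_succ_iff_derivWithin hu, contDiffOn_zero] at h
  exact ⟨fun τ hτ => (ha τ hτ).hasDerivWithinAt, fun τ hτ => (h.1 τ hτ).hasDerivWithinAt, h.2.2⟩

/-- An identity between functions continuous on `[0, ∞)` extends from `(0, ∞)` to `0`. -/
theorem eq_on_Ici_of_eq_on_Ioi {f g : ℝ → ℝ} (hf : ContinuousOn f (Ici 0))
    (hg : ContinuousOn g (Ici 0)) (h : ∀ τ, 0 < τ → f τ = g τ) {τ : ℝ} (hτ : 0 ≤ τ) :
    f τ = g τ := by
  have : EqOn f g (Ici 0) :=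
    EqOn.of_subset_closure (s := Ioi 0) (fun x hx => h x hx) hf hg Ioi_subset_Ici_self
      (by rw [closure_Ioi])
  exact this hτ

theorem memLp_two_of_exp_bound {f : ℝ → ℝ} {C γ : ℝ} (hγ : 0 < γ)
    (hf : ContinuousOn f (Ici 0)) (hb : ∀ τ, 0 ≤ τ → |f τ| ≤ C * Real.exp (-γ * τ)) :
    MemLp f 2 (volume.restrict (Ioi 0)) := by
  have hm : AEStronglyMeasurable f (volume.restrict (Ioi 0)) :=
    (hf.mono Ioi_subset_Ici_self).aestronglyMeasurable measurableSet_Ioi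
  rw [memLp_two_iff_integrable_sq hm]
  refine Integrable.mono' (g := fun τ => C ^ 2 * Real.exp (-(2 * γ) * τ)) ?_ (hm.pow 2) ?_
  · exact (integrableOn_exp_mul_Ioi (by linarith) 0).const_mul _
  · refine (ae_restrict_iff' measurableSet_Ioi).2 (ae_of_all _ fun τ hτ => ?_)
    have := hb τ (le_of_lt hτ)
    rw [Real.norm_eq_abs, abs_pow]
    calc |f τ| ^ 2 ≤ (C * Real.exp (-γ * τ)) ^ 2 := by gcongr
      _ = C ^ 2 * Real.exp (-(2 * γ) * τ) := by
        rw [mul_pow, ← Real.exp_nat_mul]; congr 2; push_cast; ring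

/-- A function with continuous derivative which decays exponentially together with its derivative
is in `H¹`. -/
theorem memH1HalfLine_of_exp_bound {f f' : ℝ → ℝ} {C γ : ℝ} (hγ : 0 < γ)
    (hf : ∀ τ, 0 ≤ τ → HasDerivWithinAt f (f' τ) (Ici 0) τ) (hf' : ContinuousOn f' (Ici 0))
    (hb : ∀ τ, 0 ≤ τ → |f τ| ≤ C * Real.exp (-γ * τ))
    (hb' : ∀ τ, 0 ≤ τ → |f' τ| ≤ C * Real.exp (-γ * τ)) : MemH1HalfLine f := by
  have hfc : ContinuousOn f (Ici 0) := fun x hx => (hf x hx).continuousWithinAt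
  refine ⟨memLp_two_of_exp_bound hγ hfc hb, f', memLp_two_of_exp_bound hγ hf' hb', ?_⟩
  intro ψ hψ hψc hψs
  have hψ1 : ∀ x, HasDerivAt ψ (deriv ψ x) x := fun x =>
    ((hψ.differentiable (by simp)) x).hasDerivAt
  have hdc : Continuous (deriv ψ) := hψ.continuous_deriv (by simp)
  have hint : ∀ {F G : ℝ → ℝ}, ContinuousOn F (Ici 0) → Continuous G → HasCompactSupport G →
      IntegrableOn (F * G) (Ioi 0) := by
    intro F G hF hG hGc
    have h1 : ContinuousOn (F * G) (Ici 0) := hF.mul hG.continuousOn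
    obtain ⟨R, hR⟩ := hGc.isCompact.bddAbove
    have h2 : IntegrableOn (F * G) (Icc 0 (max R 0)) :=
      (h1.mono Icc_subset_Ici_self).integrableOn_compact isCompact_Icc
    refine h2.of_forall_sdiff_eq_zero measurableSet_Ioi fun x hx => ?_
    have : x ∉ tsupport G := fun hxG => hx.2 ⟨le_of_lt hx.1, (hR hxG).trans (le_max_left _ _)⟩
    simp [image_eq_zero_of_notMem_tsupport this]
  have hz : Tendsto (f * ψ) (𝓝[>] 0) (𝓝 0) := by
    refine tendsto_const_nhds.congr' ?_
    have : (tsupport ψ)ᶜ ∈ 𝓝 (0 : ℝ) :=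
      (isClosed_tsupport ψ).isOpen_compl.mem_nhds fun h => lt_irrefl (0 : ℝ) (hψs h)
    filter_upwards [nhdsWithin_le_nhds this] with x hx
    simp [image_eq_zero_of_notMem_tsupport hx]
  have hi : Tendsto (f * ψ) atTop (𝓝 0) := by
    refine tendsto_const_nhds.congr' ?_
    obtain ⟨R, hR⟩ := hψc.isCompact.bddAbove
    filter_upwards [eventually_gt_atTop R] with x hx
    have : x ∉ tsupport ψ := fun h => absurd (hR h) (not_le.2 hx)
    simp [image_eq_zero_of_notMem_tsupport this]
  have := integral_Ioi_mul_deriv_eq_deriv_mul (a := 0) (u := f) (v := ψ) (u' := f')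
    (v' := deriv ψ) (a' := 0) (b' := 0)
    (fun x hx => (hf x (le_of_lt hx)).hasDerivAt (Ici_mem_nhds hx)) (fun x _ => hψ1 x)
    (hint hfc hdc hψc.deriv) (hint hf' hψ.continuous hψc) hz hi
  simpa using this

/-- A function bounded away from zero near infinity is not square integrable. -/
theorem not_memLp_two_of_le {f : ℝ → ℝ} {c τ₁ : ℝ} (hc : 0 < c) (h0 : 0 ≤ τ₁)
    (h : ∀ τ, τ₁ ≤ τ → c ≤ f τ ^ 2) : ¬ MemLp f 2 (volume.restrict (Ioi 0)) := by
  intro hf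
  have h1 : IntegrableOn (fun τ => f τ ^ 2) (Ioi τ₁) :=
    ((memLp_two_iff_integrable_sq hf.1).1 hf).mono_measure
      (Measure.restrict_mono (Ioi_subset_Ioi h0) le_rfl)
  have h2 : IntegrableOn (fun _ => c) (Ioi τ₁) := by
    refine Integrable.mono' h1 aestronglyMeasurable_const
      ((ae_restrict_iff' measurableSet_Ioi).2 (ae_of_all _ fun τ hτ => ?_))
    rw [Real.norm_of_nonneg hc.le]; exact h τ (le_of_lt hτ)
  rw [integrableOn_const_iff] at h2
  simp [hc.ne'] at h2

/-! ### The parameters and the force -/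

/-- The right-hand side of the density equation, in the unknown `r³`:
`3 (ρr² - W² / r⁴ - r²) / r`, where `W` is the flux `σ₀ φ' - j`. -/
noncomputable def layerForce (ρr W r : ℝ) : ℝ := 3 * (ρr ^ 2 / r - W ^ 2 / r ^ 5 - r)

/-- The flux `σ₀ φ' - j` as a function of the time `t` in which `σ₀ φ' = j e^{-e t}`. -/
noncomputable def layerFlux (j e t : ℝ) : ℝ := j * (Real.exp (-(e * t)) - 1)

/-- Quantitative form of the assumption `j² < (4/27) ρr⁶`: the limit density `ρj` solves the limit
equation, and the gap `3 ρj² - 2 ρr²`, which vanishes at a double root, is at least `g`. -/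
structure LayerParams (a b g ρr j ρj : ℝ) : Prop where
  a_pos : 0 < a
  g_pos : 0 < g
  a_le : a ≤ ρj
  le : ρj ≤ ρr
  le_b : ρr ≤ b
  gap : g ≤ 3 * ρj ^ 2 - 2 * ρr ^ 2
  flux : j ^ 2 = ρj ^ 4 * (ρr ^ 2 - ρj ^ 2)

namespace LayerParams
variable {a b g ρr j ρj : ℝ}

theorem ρj_pos (h : LayerParams a b g ρr j ρj) : 0 < ρj := h.a_pos.trans_le h.a_le
theorem ρr_pos (h : LayerParams a b g ρr j ρj) : 0 < ρr := h.ρj_pos.trans_le h.le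
theorem b_pos (h : LayerParams a b g ρr j ρj) : 0 < b := h.ρr_pos.trans_le h.le_b

theorem flux_sq_le (h : LayerParams a b g ρr j ρj) : j ^ 2 ≤ b ^ 6 := by
  have h1 := h.ρj_pos
  have h2 := h.ρr_pos
  rw [h.flux]
  calc ρj ^ 4 * (ρr ^ 2 - ρj ^ 2) ≤ ρj ^ 4 * ρr ^ 2 := by gcongr; nlinarith
    _ ≤ b ^ 4 * b ^ 2 := by
      have := h.le.trans h.le_b
      have := h.le_b
      gcongr
    _ = b ^ 6 := by ring

theorem abs_flux_le (h : LayerParams a b g ρr j ρj) : |j| ≤ b ^ 3 := by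
  refine abs_le_of_sq_le_sq ?_ (by have := h.b_pos; positivity)
  calc j ^ 2 ≤ b ^ 6 := h.flux_sq_le
    _ = (b ^ 3) ^ 2 := by ring

/-- The force is strongly decreasing in `r³` on `[ρj, ρr]`: after division by `r₁ - r₂` the slope is
`3 (ρr² + r₁ r₂ - W² S / (r₁ r₂)⁴) / (r₁ r₂)`, where `W² ≤ j²` bounds the last term in the numerator
by `5 (ρr² - ρj²)`, which leaves `6 ρj² - 4 ρr² ≥ 2 g`. -/
theorem force_sub_mem (h : LayerParams a b g ρr j ρj) {W r₁ r₂ : ℝ} (hW : W ^ 2 ≤ j ^ 2)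
    (h2 : ρj ≤ r₂) (h12 : r₂ ≤ r₁) (h1 : r₁ ≤ ρr) :
    2 * g / b ^ 4 * (r₁ ^ 3 - r₂ ^ 3) ≤ layerForce ρr W r₂ - layerForce ρr W r₁ ∧
    layerForce ρr W r₂ - layerForce ρr W r₁ ≤ (b ^ 2 / a ^ 2 + 1) / a ^ 2 * (r₁ ^ 3 - r₂ ^ 3) := by
  have ha := h.a_pos
  have hρj := h.ρj_pos
  have hr2 : 0 < r₂ := hρj.trans_le h2
  have hr1 : 0 < r₁ := hr2.trans_le h12
  have hb := h.b_pos
  have hg := h.g_pos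
  have h1b : r₁ ≤ b := h1.trans h.le_b
  have h2b : r₂ ≤ b := h12.trans h1b
  have ha2 : a ≤ r₂ := h.a_le.trans h2
  have ha1 : a ≤ r₁ := ha2.trans h12
  have hρrb := h.le_b
  have hρr := h.ρr_pos
  set P := r₁ * r₂ with hP
  have hP0 : 0 < P := by positivity
  set S := r₁ ^ 4 + r₁ ^ 3 * r₂ + r₁ ^ 2 * r₂ ^ 2 + r₁ * r₂ ^ 3 + r₂ ^ 4 with hS
  set Br := (ρr ^ 2 + P - W ^ 2 * S / P ^ 4) / P with hBr
  have hid : layerForce ρr W r₂ - layerForce ρr W r₁ = 3 * (r₁ - r₂) * Br := by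
    simp only [layerForce, hBr, hP, hS]; field_simp; ring
  have hS5 : ρj ^ 4 * S ≤ 5 * P ^ 4 := by
    have e4 : ρj ^ 4 * r₁ ^ 4 ≤ r₂ ^ 4 * r₁ ^ 4 := by gcongr
    have e3 : (ρj ^ 3 * ρj) * (r₁ ^ 3 * r₂) ≤ (r₂ ^ 3 * r₁) * (r₁ ^ 3 * r₂) := by
      gcongr; exact h2.trans h12
    have e2 : (ρj ^ 2 * ρj ^ 2) * (r₁ ^ 2 * r₂ ^ 2) ≤ (r₂ ^ 2 * r₁ ^ 2) * (r₁ ^ 2 * r₂ ^ 2) := by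
      gcongr; exact h2.trans h12
    have e1 : (ρj * ρj ^ 3) * (r₁ * r₂ ^ 3) ≤ (r₂ * r₁ ^ 3) * (r₁ * r₂ ^ 3) := by
      gcongr; exact h2.trans h12
    have e0 : ρj ^ 4 * r₂ ^ 4 ≤ r₁ ^ 4 * r₂ ^ 4 := by gcongr; exact h2.trans h12
    simp only [hS, hP]; nlinarith
  have hWS : W ^ 2 * S / P ^ 4 ≤ 5 * (ρr ^ 2 - ρj ^ 2) := by
    rw [div_le_iff₀ (by positivity)]
    have hs0 : 0 ≤ S := by positivity
    have hd : 0 ≤ ρr ^ 2 - ρj ^ 2 := by nlinarith [h.le]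
    calc W ^ 2 * S ≤ j ^ 2 * S := by gcongr
      _ = (ρr ^ 2 - ρj ^ 2) * (ρj ^ 4 * S) := by rw [h.flux]; ring
      _ ≤ (ρr ^ 2 - ρj ^ 2) * (5 * P ^ 4) := by gcongr
      _ = _ := by ring
  have hPj : ρj ^ 2 ≤ P := by simp only [hP]; nlinarith
  have hPb : P ≤ b ^ 2 := by simp only [hP]; nlinarith
  have hPa : a ^ 2 ≤ P := by simp only [hP]; nlinarith
  have hlo : 2 * g / b ^ 2 ≤ Br := by
    have : 2 * g ≤ ρr ^ 2 + P - W ^ 2 * S / P ^ 4 := by linarith [h.gap]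
    simp only [hBr]
    gcongr
    linarith
  have hhi : Br ≤ b ^ 2 / a ^ 2 + 1 := by
    have e1 : ρr ^ 2 ≤ b ^ 2 := by gcongr
    have e2 : 0 ≤ W ^ 2 * S / P ^ 4 := by positivity
    calc Br ≤ (b ^ 2 + P) / P := by simp only [hBr]; gcongr; linarith
      _ = b ^ 2 / P + 1 := by field_simp
      _ ≤ b ^ 2 / a ^ 2 + 1 := by gcongr
  have hcub : r₁ ^ 3 - r₂ ^ 3 = (r₁ - r₂) * (r₁ ^ 2 + r₁ * r₂ + r₂ ^ 2) := by ring
  have hd : 0 ≤ r₁ - r₂ := by linarith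
  have q1 : r₁ ^ 2 + r₁ * r₂ + r₂ ^ 2 ≤ 3 * b ^ 2 := by nlinarith
  have q2 : 3 * a ^ 2 ≤ r₁ ^ 2 + r₁ * r₂ + r₂ ^ 2 := by nlinarith
  rw [hid, hcub]
  constructor
  · calc 2 * g / b ^ 4 * ((r₁ - r₂) * (r₁ ^ 2 + r₁ * r₂ + r₂ ^ 2))
        ≤ 2 * g / b ^ 4 * ((r₁ - r₂) * (3 * b ^ 2)) := by gcongr
      _ = 3 * (r₁ - r₂) * (2 * g / b ^ 2) := by field_simp
      _ ≤ _ := by gcongr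
  · calc 3 * (r₁ - r₂) * Br ≤ 3 * (r₁ - r₂) * (b ^ 2 / a ^ 2 + 1) := by gcongr
      _ = (b ^ 2 / a ^ 2 + 1) / a ^ 2 * ((r₁ - r₂) * (3 * a ^ 2)) := by field_simp
      _ ≤ _ := by gcongr

theorem force_ρj (h : LayerParams a b g ρr j ρj) (W : ℝ) :
    layerForce ρr W ρj = 3 * (j ^ 2 - W ^ 2) / ρj ^ 5 := by
  have := h.ρj_pos
  rw [h.flux]; simp only [layerForce]; field_simp; ring

theorem force_ρj_nonneg (h : LayerParams a b g ρr j ρj) {W : ℝ} (hW : W ^ 2 ≤ j ^ 2) :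
    0 ≤ layerForce ρr W ρj := by
  rw [h.force_ρj]
  have := h.ρj_pos
  have : 0 ≤ j ^ 2 - W ^ 2 := by linarith
  positivity

theorem force_ρr_nonpos (h : LayerParams a b g ρr j ρj) (W : ℝ) : layerForce ρr W ρr ≤ 0 := by
  have := h.ρr_pos
  have e : layerForce ρr W ρr = -(3 * (W ^ 2 / ρr ^ 5)) := by
    simp only [layerForce]; field_simp; ring
  rw [e]
  have : 0 ≤ 3 * (W ^ 2 / ρr ^ 5) := by positivity
  linarith

theorem abs_force_le (h : LayerParams a b g ρr j ρj) {W r : ℝ} (hW : W ^ 2 ≤ j ^ 2)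
    (h1 : ρj ≤ r) (h2 : r ≤ ρr) :
    |layerForce ρr W r| ≤ 3 * (b ^ 2 / a + b ^ 6 / a ^ 5 + b) := by
  have ha := h.a_pos
  have hr : a ≤ r := h.a_le.trans h1
  have hr0 : 0 < r := ha.trans_le hr
  have hb := h.b_pos
  have hρr := h.ρr_pos
  have e1 : ρr ^ 2 / r ≤ b ^ 2 / a := by have := h.le_b; gcongr
  have e2 : W ^ 2 / r ^ 5 ≤ b ^ 6 / a ^ 5 := by
    have := hW.trans h.flux_sq_le; gcongr
  have e3 : 0 ≤ ρr ^ 2 / r := by positivity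
  have e4 : 0 ≤ W ^ 2 / r ^ 5 := by positivity
  have e5 := h2.trans h.le_b
  rw [layerForce, abs_le]
  constructor <;> linarith

end LayerParams

theorem abs_force_sub_flux_le {a ρr W W' r : ℝ} (ha : 0 < a) (hr : a ≤ r) :
    |layerForce ρr W r - layerForce ρr W' r| ≤ 3 * |W ^ 2 - W' ^ 2| / a ^ 5 := by
  have hr0 : 0 < r := ha.trans_le hr
  have : layerForce ρr W r - layerForce ρr W' r = -(3 * (W ^ 2 - W' ^ 2) / r ^ 5) := by
    simp only [layerForce]; field_simp; ring
  rw [this, abs_neg, abs_div, abs_mul, abs_of_pos (by positivity : 0 < r ^ 5),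
    abs_of_pos (by norm_num : (0 : ℝ) < 3)]
  gcongr

theorem layerFlux_sq_le {j e t : ℝ} (he : 0 ≤ e) (ht : 0 ≤ t) : layerFlux j e t ^ 2 ≤ j ^ 2 := by
  have h1 : Real.exp (-(e * t)) ≤ 1 := Real.exp_le_one_iff.2 (by nlinarith [mul_nonneg he ht])
  have h2 := Real.exp_pos (-(e * t))
  rw [layerFlux, mul_pow]
  have : (Real.exp (-(e * t)) - 1) ^ 2 ≤ 1 := by nlinarith
  nlinarith [sq_nonneg j]

theorem sq_sub_layerFlux_sq_le (j e t : ℝ) :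
    j ^ 2 - layerFlux j e t ^ 2 ≤ 2 * j ^ 2 * Real.exp (-(e * t)) := by
  rw [layerFlux]
  nlinarith [mul_nonneg (sq_nonneg j) (sq_nonneg (Real.exp (-(e * t))))]

theorem abs_exp_neg_sub_le {x y : ℝ} (hx : 0 ≤ x) (hy : 0 ≤ y) :
    |Real.exp (-x) - Real.exp (-y)| ≤ |x - y| := by
  wlog h : x ≤ y generalizing x y
  · rw [abs_sub_comm, abs_sub_comm x]; exact this hy hx (le_of_not_ge h)
  have h1 : Real.exp (-y) ≤ Real.exp (-x) := Real.exp_le_exp.2 (by linarith)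
  rw [abs_of_nonneg (by linarith), abs_of_nonpos (by linarith)]
  have h2 := Real.add_one_le_exp (-(y - x))
  have h3 : Real.exp (-y) = Real.exp (-x) * Real.exp (-(y - x)) := by
    rw [← Real.exp_add]; congr 1; ring
  have h4 : Real.exp (-x) ≤ 1 := Real.exp_le_one_iff.2 (by linarith)
  have h5 := Real.exp_pos (-x)
  rw [h3]
  nlinarith

theorem abs_layerFlux_sq_sub_le {j e t s : ℝ} (he : 0 ≤ e) (ht : 0 ≤ t) (hs : 0 ≤ s) :
    |layerFlux j e t ^ 2 - layerFlux j e s ^ 2| ≤ 2 * j ^ 2 * (e * |t - s|) := by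
  have h1 := abs_exp_neg_sub_le (mul_nonneg he ht) (mul_nonneg he hs)
  have h2 : Real.exp (-(e * t)) ≤ 1 := Real.exp_le_one_iff.2 (by nlinarith [mul_nonneg he ht])
  have h3 : Real.exp (-(e * s)) ≤ 1 := Real.exp_le_one_iff.2 (by nlinarith [mul_nonneg he hs])
  have h4 := Real.exp_pos (-(e * t))
  have h5 := Real.exp_pos (-(e * s))
  have e1 : layerFlux j e t ^ 2 - layerFlux j e s ^ 2 =
      j ^ 2 * ((Real.exp (-(e * t)) - Real.exp (-(e * s))) *
        (Real.exp (-(e * t)) + Real.exp (-(e * s)) - 2)) := by simp only [layerFlux]; ring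
  have e2 : |e * t - e * s| = e * |t - s| := by rw [← mul_sub, abs_mul, abs_of_nonneg he]
  rw [e1, abs_mul, abs_mul, abs_of_nonneg (sq_nonneg j)]
  rw [e2] at h1
  have e3 : |Real.exp (-(e * t)) + Real.exp (-(e * s)) - 2| ≤ 2 := by
    rw [abs_le]; constructor <;> linarith
  calc _ ≤ j ^ 2 * ((e * |t - s|) * 2) := by gcongr
    _ = _ := by ring

theorem continuous_layerFlux (j e : ℝ) : Continuous (layerFlux j e) := by
  unfold layerFlux; fun_prop

theorem abs_inv_sq_sub_le {a r₁ r₂ : ℝ} (ha : 0 < a) (h1 : a ≤ r₁) (h2 : a ≤ r₂) :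
    |1 / r₁ ^ 2 - 1 / r₂ ^ 2| ≤ 2 / (3 * a ^ 5) * |r₁ ^ 3 - r₂ ^ 3| := by
  have hr1 : 0 < r₁ := ha.trans_le h1
  have hr2 : 0 < r₂ := ha.trans_le h2
  set Q := r₁ ^ 2 + r₁ * r₂ + r₂ ^ 2 with hQ
  have hQ0 : 0 < Q := by positivity
  have e1 : 1 / r₁ ^ 2 - 1 / r₂ ^ 2 =
      -((r₁ ^ 3 - r₂ ^ 3) * ((1 / (r₁ * r₂ ^ 2) + 1 / (r₁ ^ 2 * r₂)) * (1 / Q))) := by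
    simp only [hQ]; field_simp; ring
  rw [e1, abs_neg, abs_mul, mul_comm]
  gcongr
  rw [abs_of_nonneg (by positivity)]
  have q2 : 3 * a ^ 2 ≤ Q := by simp only [hQ]; nlinarith
  calc _ ≤ (1 / (a * a ^ 2) + 1 / (a ^ 2 * a)) * (1 / (3 * a ^ 2)) := by gcongr
    _ = _ := by field_simp; ring

theorem mem_Icc_inv_sq {r lo hi : ℝ} (hlo : 0 < lo) (h1 : lo ≤ r) (h2 : r ≤ hi) :
    1 / hi ^ 2 ≤ 1 / r ^ 2 ∧ 1 / r ^ 2 ≤ 1 / lo ^ 2 := by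
  have hr : 0 < r := hlo.trans_le h1
  constructor <;> gcongr

/-- The coefficient of the first-order term in the time `t`. -/
noncomputable def layerDrift (e r z : ℝ) : ℝ := e * (1 - 1 / r ^ 2 / z)

theorem inv_mem_of_mem {a b z : ℝ} (ha : 0 < a) (hb : 0 < b) (h1 : 1 / b ^ 2 ≤ z)
    (h2 : z ≤ 1 / a ^ 2) : 0 < z ∧ a ^ 2 ≤ 1 / z ∧ 1 / z ≤ b ^ 2 := by
  have hz : 0 < z := lt_of_lt_of_le (by positivity) h1
  refine ⟨hz, ?_, ?_⟩
  · rw [le_div_iff₀ hz]; rw [le_div_iff₀ (by positivity)] at h2; linarith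
  · rw [div_le_iff₀ hz]; rw [div_le_iff₀ (by positivity)] at h1; linarith

theorem abs_layerDrift_le {a b e r z : ℝ} (ha : 0 < a) (hb : 0 < b) (he : 0 ≤ e) (hr : a ≤ r)
    (hr2 : r ≤ b) (h1 : 1 / b ^ 2 ≤ z) (h2 : z ≤ 1 / a ^ 2) :
    |layerDrift e r z| ≤ e * (b ^ 2 / a ^ 2) := by
  obtain ⟨hz, h3, h4⟩ := inv_mem_of_mem ha hb h1 h2
  have hr0 : 0 < r := ha.trans_le hr
  rw [layerDrift, abs_mul, abs_of_nonneg he]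
  gcongr
  have e1 : 1 / r ^ 2 / z = 1 / r ^ 2 * (1 / z) := by ring
  have e2 : 1 / r ^ 2 * (1 / z) ≤ 1 / a ^ 2 * b ^ 2 := by gcongr
  have e3 : 0 ≤ 1 / r ^ 2 * (1 / z) := by positivity
  have e4 : 1 ≤ b ^ 2 / a ^ 2 := by
    have := hr.trans hr2
    rw [le_div_iff₀ (by positivity)]; nlinarith
  have e5 : 1 / a ^ 2 * b ^ 2 = b ^ 2 / a ^ 2 := by ring
  rw [e1, abs_le]; constructor <;> linarith

theorem abs_inv_sub_inv_le {a b z₁ z₂ D : ℝ} (ha : 0 < a) (hb : 0 < b)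
    (h1 : 1 / b ^ 2 ≤ z₁) (h1' : z₁ ≤ 1 / a ^ 2) (h2 : 1 / b ^ 2 ≤ z₂) (h2' : z₂ ≤ 1 / a ^ 2)
    (hD : |z₁ - z₂| ≤ D) : |1 / z₁ - 1 / z₂| ≤ b ^ 4 * D := by
  obtain ⟨hz1, -, i1⟩ := inv_mem_of_mem ha hb h1 h1'
  obtain ⟨hz2, -, i2⟩ := inv_mem_of_mem ha hb h2 h2'
  have : 1 / z₁ - 1 / z₂ = -((1 / z₁) * (1 / z₂) * (z₁ - z₂)) := by field_simp; ring
  rw [this, abs_neg, abs_mul, abs_of_nonneg (by positivity)]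
  calc _ ≤ b ^ 2 * b ^ 2 * D := by gcongr
    _ = b ^ 4 * D := by ring

theorem abs_layerDrift_sub_le {a b e r₁ r₂ z₁ z₂ D : ℝ} (ha : 0 < a) (hb : 0 < b) (he : 0 ≤ e)
    (hr2 : a ≤ r₂)
    (h1 : 1 / b ^ 2 ≤ z₁) (h1' : z₁ ≤ 1 / a ^ 2) (h2 : 1 / b ^ 2 ≤ z₂) (h2' : z₂ ≤ 1 / a ^ 2)
    (hν : |1 / r₁ ^ 2 - 1 / r₂ ^ 2| ≤ D) (hD : |z₁ - z₂| ≤ D) :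
    |layerDrift e r₁ z₁ - layerDrift e r₂ z₂| ≤ e * ((b ^ 2 + b ^ 4 / a ^ 2) * D) := by
  obtain ⟨hz1, -, i1⟩ := inv_mem_of_mem ha hb h1 h1'
  have h3 := abs_inv_sub_inv_le ha hb h1 h1' h2 h2' hD
  have hD0 : 0 ≤ D := (abs_nonneg _).trans hD
  have e1 : layerDrift e r₁ z₁ - layerDrift e r₂ z₂ =
      -(e * ((1 / r₁ ^ 2 - 1 / r₂ ^ 2) * (1 / z₁) + 1 / r₂ ^ 2 * (1 / z₁ - 1 / z₂))) := by
    simp only [layerDrift]; ring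
  rw [e1, abs_neg, abs_mul, abs_of_nonneg he]
  gcongr
  refine (abs_add_le _ _).trans ?_
  rw [abs_mul, abs_mul, abs_of_pos (by positivity : 0 < 1 / z₁),
    abs_of_nonneg (by positivity : 0 ≤ 1 / r₂ ^ 2)]
  have hi : 1 / r₂ ^ 2 ≤ 1 / a ^ 2 := by gcongr
  calc _ ≤ D * b ^ 2 + 1 / a ^ 2 * (b ^ 4 * D) := by gcongr
    _ = _ := by ring

/-! ### Truncation and Lipschitz estimates of the source -/

/-- Truncation of a real number to `[-δ, δ]`. -/
noncomputable def sat (δ x : ℝ) : ℝ := max (-δ) (min δ x)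

theorem abs_sat_le {δ x : ℝ} (hδ : 0 ≤ δ) : |sat δ x| ≤ δ :=
  abs_le.2 ⟨le_max_left _ _, max_le (by linarith) (min_le_left _ _)⟩

theorem sat_of_abs_le {δ x : ℝ} (hx : |x| ≤ δ) : sat δ x = x := by
  rw [abs_le] at hx
  rw [sat, min_eq_right hx.2, max_eq_right hx.1]

theorem sat_mono {δ x y : ℝ} (h : x ≤ y) : sat δ x ≤ sat δ y :=
  max_le_max le_rfl (min_le_min le_rfl h)

theorem sat_sub_le {δ x y : ℝ} (h : x ≤ y) : sat δ y - sat δ x ≤ y - x := by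
  unfold sat
  rcases le_total δ x with h1 | h1 <;> rcases le_total δ y with h2 | h2 <;>
    simp only [min_eq_left, min_eq_right, h1, h2] <;>
    rcases max_cases (-δ) δ with ⟨e, _⟩ | ⟨e, _⟩ <;>
    rcases max_cases (-δ) x with ⟨e', _⟩ | ⟨e', _⟩ <;>
    rcases max_cases (-δ) y with ⟨e'', _⟩ | ⟨e'', _⟩ <;> linarith

theorem abs_sat_sub_le {δ x y : ℝ} : |sat δ x - sat δ y| ≤ |x - y| := by
  rcases le_total x y with h | h
  · rw [abs_sub_comm, abs_sub_comm x, abs_of_nonneg (sub_nonneg.2 (sat_mono h)),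
      abs_of_nonneg (sub_nonneg.2 h)]; exact sat_sub_le h
  · rw [abs_of_nonneg (sub_nonneg.2 (sat_mono h)), abs_of_nonneg (sub_nonneg.2 h)]
    exact sat_sub_le h

theorem abs_sat_le_abs {δ x : ℝ} (hδ : 0 ≤ δ) : |sat δ x| ≤ |x| := by
  have h0 : sat δ 0 = 0 := sat_of_abs_le (by simpa)
  simpa [h0] using abs_sat_sub_le (δ := δ) (x := x) (y := 0)

theorem continuous_sat (δ : ℝ) : Continuous (sat δ) := by unfold sat; fun_prop

/-- The force `H / z`, with `H` truncated in the part which multiplies the variation of `1 / z`.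
It equals `H / z` for `|H| ≤ δ`, and it stays strongly monotone in `H`. -/
noncomputable def truncForce (a δ H z : ℝ) : ℝ := a ^ 2 * H + sat δ H * (1 / z - a ^ 2)

/-- The source of the linear equation `N'' - k² N = -h` whose fixed points solve the truncated
density equation. -/
noncomputable def truncSource (ρr e a δ P k W r z p : ℝ) : ℝ :=
  k ^ 2 * r ^ 3 + layerDrift e r z * sat P p + truncForce a δ (layerForce ρr W r) z

theorem truncForce_of_abs_le {a δ H z : ℝ} (h : |H| ≤ δ) : truncForce a δ H z = H / z := by
  rw [truncForce, sat_of_abs_le h]; ring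

theorem abs_truncForce_le {a b δ H z : ℝ} (hδ : 0 ≤ δ) (h1 : a ^ 2 ≤ 1 / z) (h2 : 1 / z ≤ b ^ 2) :
    |truncForce a δ H z| ≤ b ^ 2 * |H| := by
  have h3 := abs_sat_le_abs (x := H) hδ
  have h4 : 0 ≤ 1 / z - a ^ 2 := by linarith
  calc |truncForce a δ H z| ≤ |a ^ 2 * H| + |sat δ H * (1 / z - a ^ 2)| := abs_add_le _ _
    _ = a ^ 2 * |H| + |sat δ H| * (1 / z - a ^ 2) := by
      rw [abs_mul, abs_mul, abs_of_nonneg h4, abs_of_nonneg (sq_nonneg a)]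
    _ ≤ a ^ 2 * |H| + |H| * (1 / z - a ^ 2) := by gcongr
    _ = 1 / z * |H| := by ring
    _ ≤ b ^ 2 * |H| := by gcongr

/-- Lower bound `2 g / b⁴` for the slope of the force in `r³`. -/
noncomputable def slopeLo (b g : ℝ) : ℝ := 2 * g / b ^ 4
/-- Upper bound for the slope of the force in `r³`. -/
noncomputable def slopeHi (a b : ℝ) : ℝ := (b ^ 2 / a ^ 2 + 1) / a ^ 2
/-- Lipschitz constant of `r⁻²` in `r³`, for `r ≥ a`. -/
noncomputable def invSqLip (a : ℝ) : ℝ := 2 / (3 * a ^ 5)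
/-- Upper bound for the force. -/
noncomputable def forceBound (a b : ℝ) : ℝ := 3 * (b ^ 2 / a + b ^ 6 / a ^ 5 + b)

/-- The constants of the contraction: `k²` dominates the slope of the force, `P` bounds the first
derivative, `δ` bounds the force near the slow manifold, and `e` is small. The conditions
`drift_small` and `δ_small` make the perturbation of the monotone part at most three quarters of its
slope, `le_P`, `drift_P` and `force_small` make the truncations inactive, and `decay_small` makes
`ρj³ + C e^{-e t}` a supersolution. -/
structure LayerConsts (a b g k P δ e : ℝ) : Prop where
  k_pos : 0 < k
  P_pos : 0 < P
  δ_pos : 0 < δ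
  e_pos : 0 < e
  e_le : e ≤ 1
  slope_le : b ^ 2 * slopeHi a b ≤ k ^ 2
  slopeLo_le : a ^ 2 * slopeLo b g ≤ k ^ 2
  drift_small : e * (4 * k * (b ^ 2 / a ^ 2) + P * ((b ^ 2 + b ^ 4 / a ^ 2) * invSqLip a)) ≤
    a ^ 2 * slopeLo b g / 4
  δ_small : δ * (b ^ 4 * invSqLip a) ≤ a ^ 2 * slopeLo b g / 2
  le_P : 2 * (k ^ 2 * b ^ 3 + 1 + b ^ 2 * forceBound a b) / k ≤ P
  drift_P : e * (b ^ 2 / a ^ 2) * P ≤ 1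
  drift_le : e * (b ^ 2 / a ^ 2) ≤ 1 / 2
  force_small : √e * ((2 + 2 * √(b ^ 3)) / a ^ 2 + 6 * b ^ 6 * √(b ^ 3) / a ^ 5) ≤ δ
  decay_small : e * (1 + b ^ 2 / a ^ 2) ≤ a ^ 2 * slopeLo b g / 2

section pointwise
variable {a b g ρr j ρj k P δ e : ℝ}

theorem abs_truncSource_le (h : LayerParams a b g ρr j ρj) (hc : LayerConsts a b g k P δ e)
    {W r z p : ℝ} (hW : W ^ 2 ≤ j ^ 2) (hr : r ∈ Icc ρj ρr) (hz : z ∈ Icc (1 / b ^ 2) (1 / a ^ 2)) :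
    |truncSource ρr e a δ P k W r z p| ≤ k ^ 2 * b ^ 3 + 1 + b ^ 2 * forceBound a b := by
  have ha := h.a_pos
  have hb := h.b_pos
  have har := h.a_le.trans hr.1
  have hrb := hr.2.trans h.le_b
  have hr0 : 0 < r := ha.trans_le har
  obtain ⟨hz0, i1, i2⟩ := inv_mem_of_mem ha hb hz.1 hz.2
  have e1 : |k ^ 2 * r ^ 3| ≤ k ^ 2 * b ^ 3 := by
    rw [abs_of_nonneg (by positivity)]; gcongr
  have e2 : |layerDrift e r z * sat P p| ≤ 1 := by
    rw [abs_mul]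
    calc _ ≤ e * (b ^ 2 / a ^ 2) * P := by
          have := hc.e_pos
          gcongr
          · exact abs_layerDrift_le ha hb hc.e_pos.le har hrb hz.1 hz.2
          · exact abs_sat_le hc.P_pos.le
      _ ≤ 1 := hc.drift_P
  have e3 : |truncForce a δ (layerForce ρr W r) z| ≤ b ^ 2 * forceBound a b :=
    (abs_truncForce_le hc.δ_pos.le i1 i2).trans
      (mul_le_mul_of_nonneg_left (h.abs_force_le hW hr.1 hr.2) (by positivity))
  exact (abs_add_le _ _).trans (add_le_add ((abs_add_le _ _).trans (add_le_add e1 e2)) e3)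

theorem abs_monotone_part_le (h : LayerParams a b g ρr j ρj) (hc : LayerConsts a b g k P δ e)
    {W r₁ r₂ y : ℝ} (hW : W ^ 2 ≤ j ^ 2) (hr₁ : r₁ ∈ Icc ρj ρr) (hr₂ : r₂ ∈ Icc ρj ρr)
    (h1 : a ^ 2 ≤ y) (h2 : y ≤ b ^ 2) :
    |k ^ 2 * (r₁ ^ 3 - r₂ ^ 3) + (a ^ 2 * (layerForce ρr W r₁ - layerForce ρr W r₂) +
      (sat δ (layerForce ρr W r₁) - sat δ (layerForce ρr W r₂)) * (y - a ^ 2))| ≤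
      (k ^ 2 - a ^ 2 * slopeLo b g) * |r₁ ^ 3 - r₂ ^ 3| := by
  wlog h12 : r₂ ≤ r₁ generalizing r₁ r₂
  · have := this hr₂ hr₁ (le_of_not_ge h12)
    rw [abs_sub_comm (r₁ ^ 3), ← abs_neg]
    convert this using 2; ring
  obtain ⟨s1, s2⟩ := h.force_sub_mem hW hr₂.1 h12 hr₁.2
  have hr0 := h.ρj_pos.trans_le hr₂.1
  have hd : 0 ≤ r₁ ^ 3 - r₂ ^ 3 := sub_nonneg.2 (by gcongr)
  change slopeLo b g * (r₁ ^ 3 - r₂ ^ 3) ≤ _ at s1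
  change _ ≤ slopeHi a b * (r₁ ^ 3 - r₂ ^ 3) at s2
  have hg := h.g_pos
  have hb := h.b_pos
  have hc0 : 0 ≤ slopeLo b g := by unfold slopeLo; positivity
  have hD : 0 ≤ layerForce ρr W r₂ - layerForce ρr W r₁ := le_trans (by positivity) s1
  have t1 := sat_mono (δ := δ) (sub_nonneg.1 hD)
  have t2 := sat_sub_le (δ := δ) (sub_nonneg.1 hD)
  set D := layerForce ρr W r₂ - layerForce ρr W r₁ with hDdef
  set d := r₁ ^ 3 - r₂ ^ 3 with hddef
  set s := sat δ (layerForce ρr W r₂) - sat δ (layerForce ρr W r₁) with hs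
  have hs0 : 0 ≤ s := by linarith
  have u1 : a ^ 2 * (slopeLo b g * d) ≤ a ^ 2 * D := by gcongr
  have u2 : s * (y - a ^ 2) ≤ D * (y - a ^ 2) := mul_le_mul_of_nonneg_right t2 (by linarith)
  have u3 : 0 ≤ s * (y - a ^ 2) := mul_nonneg hs0 (by linarith)
  have u4 : D * y ≤ (slopeHi a b * d) * b ^ 2 := by
    have : 0 ≤ y := (sq_nonneg a).trans h1
    have := hD.trans s2
    gcongr
  have u5 : b ^ 2 * slopeHi a b * d ≤ k ^ 2 * d := by gcongr; exact hc.slope_le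
  have e1 : k ^ 2 * d + (a ^ 2 * (layerForce ρr W r₁ - layerForce ρr W r₂) +
      (sat δ (layerForce ρr W r₁) - sat δ (layerForce ρr W r₂)) * (y - a ^ 2)) =
      k ^ 2 * d - (a ^ 2 * D + s * (y - a ^ 2)) := by rw [hDdef, hs]; ring
  rw [e1, abs_of_nonneg hd, abs_of_nonneg (by nlinarith)]
  nlinarith

theorem abs_truncSource_sub_le (h : LayerParams a b g ρr j ρj) (hc : LayerConsts a b g k P δ e)
    {W r₁ r₂ z₁ z₂ p₁ p₂ D : ℝ} (hW : W ^ 2 ≤ j ^ 2) (hr₁ : r₁ ∈ Icc ρj ρr)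
    (hr₂ : r₂ ∈ Icc ρj ρr) (hz₁ : z₁ ∈ Icc (1 / b ^ 2) (1 / a ^ 2))
    (hz₂ : z₂ ∈ Icc (1 / b ^ 2) (1 / a ^ 2)) (hm : |r₁ ^ 3 - r₂ ^ 3| ≤ D)
    (hz : |z₁ - z₂| ≤ invSqLip a * D) (hp : |p₁ - p₂| ≤ 4 * k * D) :
    |truncSource ρr e a δ P k W r₁ z₁ p₁ - truncSource ρr e a δ P k W r₂ z₂ p₂| ≤
      (k ^ 2 - a ^ 2 * slopeLo b g / 4) * D := by
  have ha := h.a_pos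
  have hb := h.b_pos
  have he := hc.e_pos
  have hD : 0 ≤ D := (abs_nonneg _).trans hm
  obtain ⟨hz0, i1, i2⟩ := inv_mem_of_mem ha hb hz₁.1 hz₁.2
  have har1 := h.a_le.trans hr₁.1
  have har2 := h.a_le.trans hr₂.1
  have hν : |1 / r₁ ^ 2 - 1 / r₂ ^ 2| ≤ invSqLip a * D := by
    refine (abs_inv_sq_sub_le ha har1 har2).trans ?_
    unfold invSqLip; gcongr
  set H₁ := layerForce ρr W r₁
  set H₂ := layerForce ρr W r₂
  have e1 : truncSource ρr e a δ P k W r₁ z₁ p₁ - truncSource ρr e a δ P k W r₂ z₂ p₂ =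
      (k ^ 2 * (r₁ ^ 3 - r₂ ^ 3) + (a ^ 2 * (H₁ - H₂) +
      (sat δ H₁ - sat δ H₂) * (1 / z₁ - a ^ 2))) + sat δ H₂ * (1 / z₁ - 1 / z₂) +
      layerDrift e r₁ z₁ * (sat P p₁ - sat P p₂) +
      (layerDrift e r₁ z₁ - layerDrift e r₂ z₂) * sat P p₂ := by
    simp only [truncSource, truncForce, H₁, H₂]; ring
  have b1 := abs_monotone_part_le h hc hW hr₁ hr₂ i1 i2
  have b2 : |sat δ H₂ * (1 / z₁ - 1 / z₂)| ≤ δ * (b ^ 4 * (invSqLip a * D)) := by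
    rw [abs_mul]
    gcongr
    · exact hc.δ_pos.le
    · exact abs_sat_le hc.δ_pos.le
    · exact abs_inv_sub_inv_le ha hb hz₁.1 hz₁.2 hz₂.1 hz₂.2 hz
  have b3 : |layerDrift e r₁ z₁ * (sat P p₁ - sat P p₂)| ≤ e * (b ^ 2 / a ^ 2) * (4 * k * D) := by
    rw [abs_mul]
    gcongr
    · exact abs_layerDrift_le ha hb he.le har1 (hr₁.2.trans h.le_b) hz₁.1 hz₁.2
    · exact abs_sat_sub_le.trans hp
  have b4 : |(layerDrift e r₁ z₁ - layerDrift e r₂ z₂) * sat P p₂| ≤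
      e * ((b ^ 2 + b ^ 4 / a ^ 2) * (invSqLip a * D)) * P := by
    have hl : 0 ≤ invSqLip a := by unfold invSqLip; positivity
    rw [abs_mul]
    gcongr
    · exact abs_layerDrift_sub_le ha hb he.le har2 hz₁.1 hz₁.2 hz₂.1 hz₂.2 hν hz
    · exact abs_sat_le hc.P_pos.le
  have b1' : (k ^ 2 - a ^ 2 * slopeLo b g) * |r₁ ^ 3 - r₂ ^ 3| ≤
      (k ^ 2 - a ^ 2 * slopeLo b g) * D :=
    mul_le_mul_of_nonneg_left hm (by linarith [hc.slopeLo_le])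
  have c1 := mul_le_mul_of_nonneg_right hc.drift_small hD
  have c2 := mul_le_mul_of_nonneg_right hc.δ_small hD
  rw [e1]
  refine (abs_add_le _ _).trans ?_
  have t1 := (abs_add_le (k ^ 2 * (r₁ ^ 3 - r₂ ^ 3) + (a ^ 2 * (H₁ - H₂) +
      (sat δ H₁ - sat δ H₂) * (1 / z₁ - a ^ 2)) + sat δ H₂ * (1 / z₁ - 1 / z₂))
      (layerDrift e r₁ z₁ * (sat P p₁ - sat P p₂)))
  have t2 := (abs_add_le (k ^ 2 * (r₁ ^ 3 - r₂ ^ 3) + (a ^ 2 * (H₁ - H₂) +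
      (sat δ H₁ - sat δ H₂) * (1 / z₁ - a ^ 2))) (sat δ H₂ * (1 / z₁ - 1 / z₂)))
  nlinarith

end pointwise

/-- The density attached to a candidate `m` for `ρ³`: the cube root of `m` truncated to
`[ρj³, ρr³]`. -/
noncomputable def clampRoot (ρj ρr m : ℝ) : ℝ := (max (ρj ^ 3) (min (ρr ^ 3) m)) ^ (1 / 3 : ℝ)

section clampRoot
variable {ρj ρr : ℝ}

theorem clampRoot_pow (h0 : 0 < ρj) (m : ℝ) :
    clampRoot ρj ρr m ^ 3 = max (ρj ^ 3) (min (ρr ^ 3) m) := by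
  have : 0 ≤ max (ρj ^ 3) (min (ρr ^ 3) m) := le_max_of_le_left (by positivity)
  rw [clampRoot, ← Real.rpow_natCast, ← Real.rpow_mul this]; norm_num

theorem clampRoot_mem (h0 : 0 < ρj) (h : ρj ≤ ρr) (m : ℝ) :
    clampRoot ρj ρr m ∈ Icc ρj ρr := by
  have hp := clampRoot_pow (ρr := ρr) h0 m
  have hn : 0 ≤ clampRoot ρj ρr m :=
    Real.rpow_nonneg (le_max_of_le_left (by positivity)) _
  constructor
  · refine le_of_pow_le_pow_left₀ (n := 3) (by norm_num) hn ?_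
    rw [hp]; exact le_max_left _ _
  · refine le_of_pow_le_pow_left₀ (n := 3) (by norm_num) (by linarith) ?_
    rw [hp]; exact max_le (by gcongr) (min_le_left _ _)

theorem abs_clampRoot_pow_sub_le (h0 : 0 < ρj) (m₁ m₂ : ℝ) :
    |clampRoot ρj ρr m₁ ^ 3 - clampRoot ρj ρr m₂ ^ 3| ≤ |m₁ - m₂| := by
  rw [clampRoot_pow h0, clampRoot_pow h0]
  refine (abs_max_sub_max_le_max _ _ _ _).trans (max_le (by simp) ?_)
  exact (abs_min_sub_min_le_max _ _ _ _).trans (max_le (by simp) le_rfl)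

theorem continuous_clampRoot : Continuous (clampRoot ρj ρr) := by
  unfold clampRoot
  refine Continuous.rpow_const (by fun_prop) fun x => Or.inr (by norm_num)

end clampRoot

/-- The function `z = (e φ / φ')²` in terms of the density: the exponential average of `r⁻²` which
is the bounded solution of `z' = 2 e z - 2 e r⁻²`. -/
noncomputable def zAvg (e : ℝ) (r : ℝ → ℝ) : ℝ → ℝ := expTail (2 * e) fun s => 2 * e * (1 / r s ^ 2)

section zAvg
variable {e lo hi : ℝ} {r : ℝ → ℝ}

theorem zAvg_aux (he : 0 < e) (h0 : 0 < lo) (hc : Continuous r) (hr : ∀ t, r t ∈ Icc lo hi) :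
    Continuous (fun s => 2 * e * (1 / r s ^ 2)) ∧ ∀ s, |2 * e * (1 / r s ^ 2)| ≤
      2 * e * (1 / lo ^ 2) := by
  have hp : ∀ t, 0 < r t := fun t => h0.trans_le (hr t).1
  refine ⟨?_, fun s => ?_⟩
  · have : ∀ t, r t ^ 2 ≠ 0 := fun t => (pow_pos (hp t) 2).ne'
    fun_prop (disch := exact this _)
  · have := hp s
    rw [abs_of_nonneg (by positivity)]
    gcongr
    exact (hr s).1

theorem zAvg_hasDerivAt (he : 0 < e) (h0 : 0 < lo) (hc : Continuous r)
    (hr : ∀ t, r t ∈ Icc lo hi) (t : ℝ) :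
    HasDerivAt (zAvg e r) (2 * e * (zAvg e r t - 1 / r t ^ 2)) t := by
  obtain ⟨h1, h2⟩ := zAvg_aux he h0 hc hr
  refine (expTail_hasDerivAt (by linarith) h1 h2 t).congr_deriv ?_
  simp only [zAvg]; ring

theorem zAvg_mem (he : 0 < e) (h0 : 0 < lo) (hc : Continuous r)
    (hr : ∀ t, r t ∈ Icc lo hi) (t : ℝ) : zAvg e r t ∈ Icc (1 / hi ^ 2) (1 / lo ^ 2) := by
  obtain ⟨h1, h2⟩ := zAvg_aux he h0 hc hr
  have h3 := fun s => mem_Icc_inv_sq h0 (hr s).1 (hr s).2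
  have he' : (0 : ℝ) < 2 * e := by linarith
  constructor
  · have := le_expTail he' h1 h2 (lo := 2 * e * (1 / hi ^ 2))
      (fun s => mul_le_mul_of_nonneg_left (h3 s).1 he'.le) t
    rwa [mul_div_cancel_left₀ _ he'.ne'] at this
  · have := expTail_le he' h1 h2 (hi := 2 * e * (1 / lo ^ 2))
      (fun s => mul_le_mul_of_nonneg_left (h3 s).2 he'.le) t
    rwa [mul_div_cancel_left₀ _ he'.ne'] at this

theorem abs_zAvg_sub_le {r' : ℝ → ℝ} {D : ℝ} (he : 0 < e) (h0 : 0 < lo) (hc : Continuous r)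
    (hr : ∀ t, r t ∈ Icc lo hi) (hc' : Continuous r') (hr' : ∀ t, r' t ∈ Icc lo hi)
    (hD : ∀ t, |1 / r t ^ 2 - 1 / r' t ^ 2| ≤ D) (t : ℝ) : |zAvg e r t - zAvg e r' t| ≤ D := by
  obtain ⟨h1, h2⟩ := zAvg_aux he h0 hc hr
  obtain ⟨h1', h2'⟩ := zAvg_aux he h0 hc' hr'
  have he' : (0 : ℝ) < 2 * e := by linarith
  have := abs_expTail_le he' (h1.sub h1') (C := 2 * e * D) (fun s => by
    simp only [Pi.sub_apply]
    rw [← mul_sub, abs_mul, abs_of_pos he']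
    exact mul_le_mul_of_nonneg_left (hD s) he'.le) t
  rw [mul_div_cancel_left₀ _ he'.ne'] at this
  rwa [zAvg, zAvg, ← expTail_sub he' h1 h2 h1' h2']

theorem continuous_zAvg (he : 0 < e) (h0 : 0 < lo) (hc : Continuous r)
    (hr : ∀ t, r t ∈ Icc lo hi) : Continuous (zAvg e r) :=
  continuous_iff_continuousAt.2 fun t => (zAvg_hasDerivAt he h0 hc hr t).continuousAt

end zAvg

/-! ### The truncated density equation by contraction -/

/-- The source `truncSource` along a candidate `m` for `ρ³` and a candidate `p` for its derivative,
with `r` and `z` computed from `m`. Only `t ≥ 0` matters; for `t < 0` the flux is frozen at its value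
at `0` to keep the source bounded. -/
noncomputable def layerSource (ρr j ρj e a δ P k : ℝ) (m p : ℝ → ℝ) (t : ℝ) : ℝ :=
  truncSource ρr e a δ P k (layerFlux j e (max t 0)) (clampRoot ρj ρr (m t))
    (zAvg e (fun s => clampRoot ρj ρr (m s)) t) (p t)

/-- A solution of the boundary-layer problem in the time `t` in which `σ₀ φ' = j e^{-e t}`: the
density is `r`, the `t`-derivative of `r³` is `p`, and `z = (e φ / φ')²`. The bounds `P` and `δ` on
the slope and on the force express that it stays close to the slow manifold. -/
structure LayerProfile (ρr j ρj e P δ : ℝ) (r p z : ℝ → ℝ) : Prop where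
  continuous_r : Continuous r
  mem_r : ∀ t, r t ∈ Icc ρj ρr
  hasDerivAt_z : ∀ t, HasDerivAt z (2 * e * (z t - 1 / r t ^ 2)) t
  mem_z : ∀ t, z t ∈ Icc (1 / ρr ^ 2) (1 / ρj ^ 2)
  hasDeriv_cube : ∀ t, 0 ≤ t → HasDerivWithinAt (fun s => r s ^ 3) (p t) (Ici 0) t
  hasDeriv_p : ∀ t, 0 ≤ t → HasDerivWithinAt p
    (-(layerDrift e (r t) (z t) * p t + layerForce ρr (layerFlux j e t) (r t) / z t)) (Ici 0) t
  p_zero : p 0 = 0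
  abs_p_le : ∀ t, 0 ≤ t → |p t| ≤ P
  abs_force_le : ∀ t, 0 ≤ t → |layerForce ρr (layerFlux j e t) (r t)| ≤ δ

section
variable {a b g ρr j ρj k P δ e : ℝ}

theorem LayerParams.Icc_inv_sq_subset (h : LayerParams a b g ρr j ρj) :
    Icc (1 / ρr ^ 2) (1 / ρj ^ 2) ⊆ Icc (1 / b ^ 2) (1 / a ^ 2) := by
  have := h.a_pos
  have := h.ρr_pos
  have := h.a_le
  have := h.le_b
  refine Icc_subset_Icc ?_ ?_ <;> gcongr

theorem continuous_truncSource_comp {W r z p : ℝ → ℝ}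
    (hW : Continuous W) (hr : Continuous r) (hz : Continuous z) (hp : Continuous p)
    (hr0 : ∀ t, 0 < r t) (hz0 : ∀ t, 0 < z t) :
    Continuous fun t => truncSource ρr e a δ P k (W t) (r t) (z t) (p t) := by
  have h1 : ∀ t, r t ≠ 0 := fun t => (hr0 t).ne'
  have h2 : ∀ t, z t ≠ 0 := fun t => (hz0 t).ne'
  have h3 : ∀ t, r t ^ 2 ≠ 0 := fun t => pow_ne_zero _ (h1 t)
  have h5 : ∀ t, r t ^ 5 ≠ 0 := fun t => pow_ne_zero _ (h1 t)
  have hs : Continuous (sat P) := continuous_sat P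
  have hs' : Continuous (sat δ) := continuous_sat δ
  have hF : Continuous fun t => layerForce ρr (W t) (r t) := by
    unfold layerForce
    fun_prop (disch := first | exact h1 _ | exact h5 _)
  unfold truncSource truncForce layerDrift
  fun_prop (disch := first | exact h2 _ | exact h3 _)

theorem zAvg_clampRoot_mem (h : LayerParams a b g ρr j ρj) (he : 0 < e) {m : ℝ → ℝ}
    (hm : Continuous m) (t : ℝ) : zAvg e (fun s => clampRoot ρj ρr (m s)) t ∈
      Icc (1 / ρr ^ 2) (1 / ρj ^ 2) :=
  zAvg_mem he h.ρj_pos (continuous_clampRoot.comp hm) (fun _ => clampRoot_mem h.ρj_pos h.le _) t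

theorem continuous_layerSource (h : LayerParams a b g ρr j ρj) (he : 0 < e) {m p : ℝ → ℝ}
    (hm : Continuous m) (hp : Continuous p) :
    Continuous (layerSource ρr j ρj e a δ P k m p) := by
  have hr : Continuous fun s => clampRoot ρj ρr (m s) := continuous_clampRoot.comp hm
  have hmem := fun s => clampRoot_mem h.ρj_pos h.le (m s)
  refine continuous_truncSource_comp
    ((continuous_layerFlux j e).comp (continuous_id.max continuous_const)) hr
    (continuous_zAvg he h.ρj_pos hr hmem) hp
    (fun t => h.ρj_pos.trans_le (hmem t).1) (fun t => ?_)
  exact (inv_mem_of_mem h.ρj_pos h.ρr_pos (zAvg_clampRoot_mem h he hm t).1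
    (zAvg_clampRoot_mem h he hm t).2).1

theorem abs_layerSource_le (h : LayerParams a b g ρr j ρj) (hc : LayerConsts a b g k P δ e)
    {m p : ℝ → ℝ} (hm : Continuous m) (t : ℝ) :
    |layerSource ρr j ρj e a δ P k m p t| ≤ k ^ 2 * b ^ 3 + 1 + b ^ 2 * forceBound a b :=
  abs_truncSource_le h hc (layerFlux_sq_le hc.e_pos.le (le_max_right _ _))
    (clampRoot_mem h.ρj_pos h.le _)
    (h.Icc_inv_sq_subset (zAvg_clampRoot_mem h hc.e_pos hm t))

theorem abs_layerSource_sub_le (h : LayerParams a b g ρr j ρj) (hc : LayerConsts a b g k P δ e)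
    {m₁ m₂ p₁ p₂ : ℝ → ℝ} {D : ℝ} (hm₁ : Continuous m₁) (hm₂ : Continuous m₂)
    (hm : ∀ t, |m₁ t - m₂ t| ≤ D) (hp : ∀ t, |p₁ t - p₂ t| ≤ 4 * k * D) (t : ℝ) :
    |layerSource ρr j ρj e a δ P k m₁ p₁ t - layerSource ρr j ρj e a δ P k m₂ p₂ t| ≤
      (k ^ 2 - a ^ 2 * slopeLo b g / 4) * D := by
  have hcl : ∀ s, |clampRoot ρj ρr (m₁ s) ^ 3 - clampRoot ρj ρr (m₂ s) ^ 3| ≤ D := fun s =>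
    (abs_clampRoot_pow_sub_le h.ρj_pos _ _).trans (hm s)
  refine abs_truncSource_sub_le h hc (layerFlux_sq_le hc.e_pos.le (le_max_right _ _))
    (clampRoot_mem h.ρj_pos h.le _) (clampRoot_mem h.ρj_pos h.le _)
    (h.Icc_inv_sq_subset (zAvg_clampRoot_mem h hc.e_pos hm₁ t))
    (h.Icc_inv_sq_subset (zAvg_clampRoot_mem h hc.e_pos hm₂ t)) (hcl t) ?_ (hp t)
  refine abs_zAvg_sub_le hc.e_pos h.ρj_pos (continuous_clampRoot.comp hm₁)
    (fun s => clampRoot_mem h.ρj_pos h.le _) (continuous_clampRoot.comp hm₂)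
    (fun s => clampRoot_mem h.ρj_pos h.le _) (fun s => ?_) t
  refine (abs_inv_sq_sub_le h.a_pos (h.a_le.trans (clampRoot_mem h.ρj_pos h.le _).1)
    (h.a_le.trans (clampRoot_mem h.ρj_pos h.le _).1)).trans ?_
  have := h.a_pos
  unfold invSqLip
  gcongr
  exact hcl s

/-- The truncated density equation, in integrated form, has a bounded solution, by contraction in
the pair formed by `ρ³` and its derivative. -/
theorem exists_truncated_solution (h : LayerParams a b g ρr j ρj)
    (hc : LayerConsts a b g k P δ e) :
    ∃ m p : ℝ → ℝ, Continuous m ∧ Continuous p ∧ (∃ B, ∀ t, |m t| ≤ B) ∧ ∀ t, 0 ≤ t →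
      m t = neumannGreen k (layerSource ρr j ρj e a δ P k m p) t ∧
      p t = neumannGreenDeriv k (layerSource ρr j ρj e a δ P k m p) t := by
  have hk := hc.k_pos
  set B := k ^ 2 * b ^ 3 + 1 + b ^ 2 * forceBound a b with hB
  -- the derivative is divided by `4 k`, so that the second component is halved by the Green function
  -- and the map contracts in the maximum norm of the product
  let S : (ℝ →ᵇ ℝ) × (ℝ →ᵇ ℝ) → ℝ → ℝ := fun x =>
    layerSource ρr j ρj e a δ P k x.1 (fun t => 4 * k * x.2 t)
  have hSc : ∀ x, Continuous (S x) := fun x =>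
    continuous_layerSource h hc.e_pos x.1.continuous (x.2.continuous.const_mul (4 * k))
  have hSB : ∀ x t, |S x t| ≤ B := fun x t => abs_layerSource_le h hc x.1.continuous t
  have hG : ∀ x, Continuous fun t => neumannGreen k (S x) (max t 0) := fun x =>
    (continuous_iff_continuousAt.2 fun t =>
      (neumannGreen_hasDerivAt hk (hSc x) (hSB x) t).continuousAt).comp
      (continuous_id.max continuous_const)
  have hG' : ∀ x, Continuous fun t => neumannGreenDeriv k (S x) (max t 0) / (4 * k) := fun x =>
    ((continuous_iff_continuousAt.2 fun t =>
      (neumannGreenDeriv_hasDerivAt hk (hSc x) (hSB x) t).continuousAt).comp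
      (continuous_id.max continuous_const)).div_const _
  let F : (ℝ →ᵇ ℝ) × (ℝ →ᵇ ℝ) → (ℝ →ᵇ ℝ) × (ℝ →ᵇ ℝ) := fun x =>
    (BoundedContinuousFunction.ofNormedAddCommGroup _ (hG x) (B / k ^ 2)
      (fun t => abs_neumannGreen_le hk (hSc x) (hSB x) (le_max_right _ _)),
     BoundedContinuousFunction.ofNormedAddCommGroup _ (hG' x) (2 * B / k / (4 * k)) (fun t => by
      rw [Real.norm_eq_abs, abs_div, abs_of_pos (by linarith : 0 < 4 * k)]
      gcongr
      exact abs_neumannGreenDeriv_le hk (hSc x) (hSB x) (le_max_right _ _)))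
  have hs0 : 0 < a ^ 2 * slopeLo b g := by
    have := h.a_pos; have := h.b_pos; have := h.g_pos
    unfold slopeLo; positivity
  set θ := 1 - a ^ 2 * slopeLo b g / 4 / k ^ 2 with hθ
  have hθk : (k ^ 2 - a ^ 2 * slopeLo b g / 4) / k ^ 2 = θ := by rw [hθ]; field_simp
  have hθ1 : θ < 1 := by
    have : 0 < a ^ 2 * slopeLo b g / 4 / k ^ 2 := by positivity
    linarith
  have hθ2 : 1 / 2 ≤ θ := by
    have : a ^ 2 * slopeLo b g / 4 / k ^ 2 ≤ 1 / 4 := by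
      rw [div_le_iff₀ (by positivity)]; linarith [hc.slopeLo_le]
    linarith
  have hlip : ∀ x y, dist (F x) (F y) ≤ θ * dist x y := by
    intro x y
    have hd1 : ∀ t, |x.1 t - y.1 t| ≤ dist x y := fun t =>
      (BoundedContinuousFunction.dist_coe_le_dist (f := x.1) (g := y.1) t).trans (le_max_left _ _)
    have hd2 : ∀ t, |x.2 t - y.2 t| ≤ dist x y := fun t =>
      (BoundedContinuousFunction.dist_coe_le_dist (f := x.2) (g := y.2) t).trans (le_max_right _ _)
    have hSS : ∀ t, |S x t - S y t| ≤ (k ^ 2 - a ^ 2 * slopeLo b g / 4) * dist x y := by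
      refine abs_layerSource_sub_le h hc x.1.continuous y.1.continuous hd1 fun t => ?_
      rw [← mul_sub, abs_mul, abs_of_pos (by linarith : 0 < 4 * k)]
      gcongr
      exact hd2 t
    have hcs := (hSc x).sub (hSc y)
    have hdd : 0 ≤ dist x y := dist_nonneg
    have hθd : 0 ≤ θ * dist x y := by nlinarith
    refine max_le ?_ ?_
    · refine (BoundedContinuousFunction.dist_le hθd).2 fun t => ?_
      have := abs_neumannGreen_le hk hcs hSS (le_max_right t 0)
      rw [mul_div_right_comm, hθk] at this
      have e1 := neumannGreen_sub hk (hSc x) (hSB x) (hSc y) (hSB y) (max t 0)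
      change |neumannGreen k (S x) (max t 0) - neumannGreen k (S y) (max t 0)| ≤ _
      rw [← e1]; exact this
    · refine (BoundedContinuousFunction.dist_le hθd).2 fun t => ?_
      have := abs_neumannGreenDeriv_le hk hcs hSS (le_max_right t 0)
      have e1 := neumannGreenDeriv_sub hk (hSc x) (hSB x) (hSc y) (hSB y) (max t 0)
      change |neumannGreenDeriv k (S x) (max t 0) / (4 * k) -
        neumannGreenDeriv k (S y) (max t 0) / (4 * k)| ≤ _
      rw [← sub_div, ← e1, abs_div, abs_of_pos (by linarith : 0 < 4 * k),
        div_le_iff₀ (by linarith)]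
      refine this.trans ?_
      rw [div_le_iff₀ hk]
      have u1 : 1 / 2 * dist x y ≤ θ * dist x y := by gcongr
      have u2 : 0 ≤ a ^ 2 * slopeLo b g * dist x y := by positivity
      have u3 := mul_le_mul_of_nonneg_left u1 (by positivity : 0 ≤ 4 * k ^ 2)
      nlinarith
  have hcontr : ContractingWith ⟨θ, by linarith⟩ F :=
    ⟨by exact_mod_cast hθ1, LipschitzWith.of_dist_le_mul hlip⟩
  have hfix := hcontr.fixedPoint_isFixedPt
  set x := ContractingWith.fixedPoint F hcontr
  refine ⟨x.1, fun t => 4 * k * x.2 t, x.1.continuous, x.2.continuous.const_mul _,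
    ⟨‖x.1‖, fun t => x.1.norm_coe_le_norm t⟩, fun t ht => ⟨?_, ?_⟩⟩
  · have : x.1 t = (F x).1 t := by rw [hfix]
    rw [this]
    change neumannGreen k (S x) (max t 0) = _
    rw [max_eq_left ht]
  · have : x.2 t = (F x).2 t := by rw [hfix]
    change 4 * k * x.2 t = _
    rw [this]
    change 4 * k * (neumannGreenDeriv k (S x) (max t 0) / (4 * k)) = _
    rw [max_eq_left ht, mul_div_cancel₀ _ (by positivity)]
end

/-! ### The truncations are inactive -/

theorem sat_nonneg {δ x : ℝ} (hδ : 0 ≤ δ) (hx : 0 ≤ x) : 0 ≤ sat δ x :=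
  le_max_of_le_right (le_min hδ hx)

theorem sat_nonpos {δ x : ℝ} (hδ : 0 ≤ δ) (hx : x ≤ 0) : sat δ x ≤ 0 :=
  max_le (by linarith) (min_le_of_right_le hx)

theorem le_truncForce {a δ H z : ℝ} (hδ : 0 ≤ δ) (hz : a ^ 2 ≤ 1 / z) (hH : 0 ≤ H) :
    a ^ 2 * H ≤ truncForce a δ H z := by
  have := mul_nonneg (sat_nonneg hδ hH) (sub_nonneg.2 hz)
  unfold truncForce; linarith

theorem truncForce_le {a δ H z : ℝ} (hδ : 0 ≤ δ) (hz : a ^ 2 ≤ 1 / z) (hH : H ≤ 0) :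
    truncForce a δ H z ≤ a ^ 2 * H := by
  have := mul_nonpos_of_nonpos_of_nonneg (sat_nonpos hδ hH) (sub_nonneg.2 hz)
  unfold truncForce; linarith

section
variable {a b g ρr j ρj k P δ e : ℝ}

/-- Differential form of the truncated density equation, for which the truncations of `m` and of
the force are shown to be inactive. -/
structure TruncatedSolution (ρr j ρj e a δ P k : ℝ) (m p z : ℝ → ℝ) : Prop where
  hasDeriv_m : ∀ t, 0 ≤ t → HasDerivWithinAt m (p t) (Ici 0) t
  hasDeriv_p : ∀ t, 0 ≤ t → HasDerivWithinAt p
    (k ^ 2 * (m t - clampRoot ρj ρr (m t) ^ 3) - layerDrift e (clampRoot ρj ρr (m t)) (z t) * p t -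
      truncForce a δ (layerForce ρr (layerFlux j e t) (clampRoot ρj ρr (m t))) (z t)) (Ici 0) t
  p_zero : p 0 = 0
  abs_p_le : ∀ t, 0 ≤ t → |p t| ≤ P
  bdd : ∃ B, ∀ t, |m t| ≤ B
  mem_z : ∀ t, z t ∈ Icc (1 / ρr ^ 2) (1 / ρj ^ 2)

theorem exists_truncatedSolution (h : LayerParams a b g ρr j ρj)
    (hc : LayerConsts a b g k P δ e) :
    ∃ m p, Continuous m ∧ TruncatedSolution ρr j ρj e a δ P k m p
      (zAvg e (fun s => clampRoot ρj ρr (m s))) := by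
  obtain ⟨m, p, hm, hp, hB, hfix⟩ := exists_truncated_solution h hc
  have hk := hc.k_pos
  have hSc := continuous_layerSource (a := a) (δ := δ) (P := P) (k := k) (j := j) h hc.e_pos hm hp
  have hSB := fun t => abs_layerSource_le h hc (p := p) hm t
  have hpP : ∀ t, 0 ≤ t → |p t| ≤ P := by
    intro t ht
    rw [(hfix t ht).2]
    exact (abs_neumannGreenDeriv_le hk hSc hSB ht).trans hc.le_P
  refine ⟨m, p, hm, ⟨fun t ht => ?_, fun t ht => ?_, ?_, hpP, hB,
    zAvg_clampRoot_mem h hc.e_pos hm⟩⟩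
  · rw [(hfix t ht).2]
    exact (neumannGreen_hasDerivAt hk hSc hSB t).hasDerivWithinAt.congr
      (fun x hx => (hfix x hx).1) (hfix t ht).1
  · refine ((neumannGreenDeriv_hasDerivAt hk hSc hSB t).hasDerivWithinAt.congr
      (fun x hx => (hfix x hx).2) (hfix t ht).2).congr_deriv ?_
    rw [← (hfix t ht).1]
    simp only [layerSource, truncSource, max_eq_left ht, sat_of_abs_le (hpP t ht)]
    ring
  · rw [(hfix 0 le_rfl).2, neumannGreenDeriv_zero hk]

namespace TruncatedSolution
variable {m p z : ℝ → ℝ}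

theorem bounds_aux (h : LayerParams a b g ρr j ρj) (hc : LayerConsts a b g k P δ e)
    (hs : TruncatedSolution ρr j ρj e a δ P k m p z) (t : ℝ) :
    a ^ 2 ≤ 1 / z t ∧ |layerDrift e (clampRoot ρj ρr (m t)) (z t)| ≤ 1 / 2 := by
  have hz := h.Icc_inv_sq_subset (hs.mem_z t)
  have hr := clampRoot_mem h.ρj_pos h.le (m t)
  exact ⟨(inv_mem_of_mem h.a_pos h.b_pos hz.1 hz.2).2.1,
    (abs_layerDrift_le h.a_pos h.b_pos hc.e_pos.le (h.a_le.trans hr.1) (hr.2.trans h.le_b)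
      hz.1 hz.2).trans hc.drift_le⟩

/-- Near an infimum of `m` below `ρj³` the truncated density is `ρj`, where the force is nonnegative,
so that the term `k² (m - ρj³)` would have to be almost nonnegative. -/
theorem le_m (h : LayerParams a b g ρr j ρj) (hc : LayerConsts a b g k P δ e)
    (hs : TruncatedSolution ρr j ρj e a δ P k m p z) {t : ℝ} (ht : 0 ≤ t) : ρj ^ 3 ≤ m t := by
  by_contra! hlt
  obtain ⟨B, hB⟩ := hs.bdd
  have hk2 : 0 < k ^ 2 := pow_pos hc.k_pos 2
  have hgap : 0 < k ^ 2 * (ρj ^ 3 - m t) := mul_pos hk2 (by linarith)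
  obtain ⟨s, hs0, h1, h2, h3⟩ := exists_almost_max (κ := fun _ => 1) (T := fun t => t) (κ₀ := 1)
    (B := B) (fun t ht => by simpa using (hs.hasDeriv_m t ht).fun_neg)
    (fun t ht => by simpa only [one_mul] using (hs.hasDeriv_p t ht).fun_neg)
    (fun t _ => hasDerivWithinAt_id t _) one_pos (fun _ _ => le_rfl) (by simp [hs.p_zero])
    (fun t _ => by linarith [(abs_le.1 (hB t)).1])
    (half_pos hgap) ht
  obtain ⟨b1, b2⟩ := bounds_aux h hc hs s
  simp only [abs_neg] at h1 h2
  have hms : m s < ρj ^ 3 := by linarith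
  have hcube : clampRoot ρj ρr (m s) ^ 3 = ρj ^ 3 := by
    rw [clampRoot_pow h.ρj_pos]
    exact max_eq_left (min_le_of_right_le hms.le)
  have hmem := clampRoot_mem h.ρj_pos h.le (m s)
  have hr : clampRoot ρj ρr (m s) = ρj := by
    refine (pow_left_inj₀ (h.ρj_pos.le.trans hmem.1) h.ρj_pos.le (by norm_num)).1 hcube
  rw [hr] at h3 b2
  have hF := le_truncForce (δ := δ) hc.δ_pos.le b1
    (h.force_ρj_nonneg (layerFlux_sq_le (j := j) hc.e_pos.le hs0))
  have hF0 := mul_nonneg (sq_nonneg a)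
    (h.force_ρj_nonneg (layerFlux_sq_le (j := j) hc.e_pos.le hs0))
  have hβ : |layerDrift e ρj (z s) * p s| ≤ 1 / 2 * (k ^ 2 * (ρj ^ 3 - m t) / 2) := by
    rw [abs_mul]; gcongr
  have := (abs_le.1 hβ).1
  have : k ^ 2 * (ρj ^ 3 - m t) ≤ k ^ 2 * (ρj ^ 3 - m s) := by gcongr; linarith
  nlinarith

theorem m_le (h : LayerParams a b g ρr j ρj) (hc : LayerConsts a b g k P δ e)
    (hs : TruncatedSolution ρr j ρj e a δ P k m p z) {t : ℝ} (ht : 0 ≤ t) : m t ≤ ρr ^ 3 := by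
  by_contra! hlt
  obtain ⟨B, hB⟩ := hs.bdd
  have hk2 : 0 < k ^ 2 := pow_pos hc.k_pos 2
  have hgap : 0 < k ^ 2 * (m t - ρr ^ 3) := mul_pos hk2 (by linarith)
  obtain ⟨s, hs0, h1, h2, h3⟩ := exists_almost_max (κ := fun _ => 1) (T := fun t => t) (κ₀ := 1)
    (B := B) (fun t ht => by simpa using (hs.hasDeriv_m t ht))
    (fun t ht => by simpa only [one_mul] using (hs.hasDeriv_p t ht))
    (fun t _ => hasDerivWithinAt_id t _) one_pos (fun _ _ => le_rfl) (by simp [hs.p_zero])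
    (fun t _ => (abs_le.1 (hB t)).2) (half_pos hgap) ht
  obtain ⟨b1, b2⟩ := bounds_aux h hc hs s
  have hms : ρr ^ 3 < m s := by linarith
  have hle : ρj ^ 3 ≤ ρr ^ 3 := by have := h.ρj_pos; have := h.le; gcongr
  have hcube : clampRoot ρj ρr (m s) ^ 3 = ρr ^ 3 := by
    rw [clampRoot_pow h.ρj_pos, min_eq_left hms.le, max_eq_right hle]
  have hmem := clampRoot_mem h.ρj_pos h.le (m s)
  have hr : clampRoot ρj ρr (m s) = ρr := by
    refine (pow_left_inj₀ (h.ρj_pos.le.trans hmem.1) h.ρr_pos.le (by norm_num)).1 hcube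
  rw [hr] at h3 b2
  have hH := h.force_ρr_nonpos (layerFlux j e s)
  have hF := truncForce_le (δ := δ) hc.δ_pos.le b1 hH
  have hF0 := mul_nonpos_of_nonneg_of_nonpos (sq_nonneg a) hH
  have hβ : |layerDrift e ρr (z s) * p s| ≤ 1 / 2 * (k ^ 2 * (m t - ρr ^ 3) / 2) := by
    rw [abs_mul]; gcongr
  have := (abs_le.1 hβ).2
  have : k ^ 2 * (m t - ρr ^ 3) ≤ k ^ 2 * (m s - ρr ^ 3) := by gcongr
  nlinarith

theorem clampRoot_cube (h : LayerParams a b g ρr j ρj) (hc : LayerConsts a b g k P δ e)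
    (hs : TruncatedSolution ρr j ρj e a δ P k m p z) {t : ℝ} (ht : 0 ≤ t) :
    clampRoot ρj ρr (m t) ^ 3 = m t := by
  rw [clampRoot_pow h.ρj_pos, min_eq_right (m_le h hc hs ht), max_eq_right (le_m h hc hs ht)]

/-- The force at a point is compared with the force at the penalised extremum `s`, where the
equation controls it; the flux changes by `O(√e)` between the two points. -/
theorem force_small_aux (h : LayerParams a b g ρr j ρj) (hc : LayerConsts a b g k P δ e)
    {t s : ℝ} (ht : 0 ≤ t) (hs0 : 0 ≤ s) (hd : e * (s - t) ^ 2 ≤ b ^ 3) {r : ℝ} (hr : a ≤ r) :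
    (2 * e + 2 * e * |s - t|) / a ^ 2 +
      |layerForce ρr (layerFlux j e t) r - layerForce ρr (layerFlux j e s) r| ≤ δ := by
  have he := hc.e_pos
  have ha := h.a_pos
  have hb := h.b_pos
  have h1 : e * |s - t| ≤ √e * √(b ^ 3) := by
    rw [← Real.sqrt_mul he.le]
    refine Real.le_sqrt_of_sq_le ?_
    rw [mul_pow, sq_abs]; nlinarith
  have h2 : e ≤ √e := by
    refine Real.le_sqrt_of_sq_le ?_
    nlinarith [hc.e_le]
  have h3 := abs_layerFlux_sq_sub_le (j := j) he.le ht hs0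
  rw [abs_sub_comm t s] at h3
  have h4 : |layerFlux j e t ^ 2 - layerFlux j e s ^ 2| ≤ 2 * b ^ 6 * (√e * √(b ^ 3)) := by
    refine h3.trans ?_
    have := h.flux_sq_le
    gcongr
  have h5 := abs_force_sub_flux_le (ρr := ρr) (W := layerFlux j e t) (W' := layerFlux j e s) ha hr
  calc _ ≤ (2 * √e + 2 * (√e * √(b ^ 3))) / a ^ 2 +
        3 * (2 * b ^ 6 * (√e * √(b ^ 3))) / a ^ 5 := by
        refine add_le_add ?_ (h5.trans ?_)
        · gcongr ?_ / _
          linarith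
        · gcongr
    _ = √e * ((2 + 2 * √(b ^ 3)) / a ^ 2 + 6 * b ^ 6 * √(b ^ 3) / a ^ 5) := by ring
    _ ≤ δ := hc.force_small

/-- Smallness of the force: at the maximum of `± m - e (s - t)²` the equation bounds the force by
`O(e + e |s - t|)`, and boundedness of `m` gives `e |s - t| = O(√e)`. -/
theorem abs_force_le (h : LayerParams a b g ρr j ρj) (hc : LayerConsts a b g k P δ e)
    (hs : TruncatedSolution ρr j ρj e a δ P k m p z) {t : ℝ} (ht : 0 ≤ t) :
    |layerForce ρr (layerFlux j e t) (clampRoot ρj ρr (m t))| ≤ δ := by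
  have he := hc.e_pos
  have ha := h.a_pos
  have hb := h.b_pos
  have hmem := fun t => clampRoot_mem h.ρj_pos h.le (m t)
  have hpos := fun t => h.ρj_pos.trans_le (hmem t).1
  have hcube := fun {t} (ht : 0 ≤ t) => clampRoot_cube h hc hs ht
  have hm0 : ∀ t, 0 ≤ t → 0 ≤ m t := fun t ht => by
    rw [← hcube ht]; exact (pow_pos (hpos t) 3).le
  have hmb : ∀ t, 0 ≤ t → m t ≤ b ^ 3 := fun t ht => by
    have := h.ρr_pos; have := h.le_b
    exact (m_le h hc hs ht).trans (by gcongr)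
  have hW := layerFlux_sq_le (j := j) he.le ht
  have hslope : 0 ≤ 2 * g / b ^ 4 := by have := h.g_pos; positivity
  obtain ⟨B, hB⟩ := hs.bdd
  rw [abs_le]
  constructor
  · obtain ⟨s, hs0, h1, h2, h3⟩ := exists_penalized_max (κ := fun _ => 1) (T := fun t => t)
      (κ₀ := 1) (B := B) (fun t ht => by simpa using (hs.hasDeriv_m t ht))
      (fun t ht => by simpa only [one_mul] using (hs.hasDeriv_p t ht))
      (fun t _ => hasDerivWithinAt_id t _) one_pos (fun _ _ => le_rfl) (by simp [hs.p_zero])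
      (fun t _ => (abs_le.1 (hB t)).2) he ht
    obtain ⟨b1, b2⟩ := bounds_aux h hc hs s
    rw [hcube hs0, sub_self, mul_zero, zero_sub, h2] at h3
    have haux := force_small_aux (j := j) h hc ht hs0 (by linarith [hmb s hs0, hm0 t ht])
      (h.a_le.trans (hmem s).1)
    have hmono : clampRoot ρj ρr (m t) ≤ clampRoot ρj ρr (m s) := by
      refine le_of_pow_le_pow_left₀ (n := 3) (by norm_num) (hpos s).le ?_
      rw [hcube ht, hcube hs0]
      nlinarith [sq_nonneg (s - t)]
    have hf := (h.force_sub_mem hW (hmem t).1 hmono (hmem s).2).1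
    have hf' : 0 ≤ 2 * g / b ^ 4 * (clampRoot ρj ρr (m s) ^ 3 - clampRoot ρj ρr (m t) ^ 3) :=
      mul_nonneg hslope (sub_nonneg.2 (by have := hpos t; gcongr))
    have hβ : |layerDrift e (clampRoot ρj ρr (m s)) (z s) * (2 * e * (s - t))| ≤
        1 / 2 * (2 * e * |s - t|) := by
      rw [abs_mul, abs_mul, abs_of_pos (by linarith : 0 < 2 * e)]; gcongr
    have hβ' := (abs_le.1 hβ).2
    have hd : 0 ≤ 2 * e * |s - t| := by positivity
    have hH : -((2 * e + 2 * e * |s - t|) / a ^ 2) ≤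
        layerForce ρr (layerFlux j e s) (clampRoot ρj ρr (m s)) := by
      rcases le_total 0 (layerForce ρr (layerFlux j e s) (clampRoot ρj ρr (m s))) with hH | hH
      · refine le_trans ?_ hH
        rw [neg_nonpos]; positivity
      · have := truncForce_le (δ := δ) hc.δ_pos.le b1 hH
        rw [← neg_div, div_le_iff₀ (by positivity)]
        linarith
    have := (abs_le.1 (le_refl |layerForce ρr (layerFlux j e t) (clampRoot ρj ρr (m s)) -
      layerForce ρr (layerFlux j e s) (clampRoot ρj ρr (m s))|)).1
    linarith
  · obtain ⟨s, hs0, h1, h2, h3⟩ := exists_penalized_max (κ := fun _ => 1) (T := fun t => t)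
      (κ₀ := 1) (B := B) (fun t ht => by simpa using (hs.hasDeriv_m t ht).fun_neg)
      (fun t ht => by simpa only [one_mul] using (hs.hasDeriv_p t ht).fun_neg)
      (fun t _ => hasDerivWithinAt_id t _) one_pos (fun _ _ => le_rfl) (by simp [hs.p_zero])
      (fun t _ => by linarith [(abs_le.1 (hB t)).1]) he ht
    obtain ⟨b1, b2⟩ := bounds_aux h hc hs s
    have h2' : p s = -(2 * e * (s - t)) := by linarith
    rw [hcube hs0, sub_self, mul_zero, zero_sub, h2'] at h3
    have haux := force_small_aux (j := j) h hc ht hs0 (by linarith [hmb t ht, hm0 s hs0])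
      (h.a_le.trans (hmem s).1)
    have hmono : clampRoot ρj ρr (m s) ≤ clampRoot ρj ρr (m t) := by
      refine le_of_pow_le_pow_left₀ (n := 3) (by norm_num) (hpos t).le ?_
      rw [hcube ht, hcube hs0]
      nlinarith [sq_nonneg (s - t)]
    have hf := (h.force_sub_mem hW (hmem s).1 hmono (hmem t).2).1
    have hf' : 0 ≤ 2 * g / b ^ 4 * (clampRoot ρj ρr (m t) ^ 3 - clampRoot ρj ρr (m s) ^ 3) :=
      mul_nonneg hslope (sub_nonneg.2 (by have := hpos s; gcongr))
    have hβ : |layerDrift e (clampRoot ρj ρr (m s)) (z s) * (2 * e * (s - t))| ≤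
        1 / 2 * (2 * e * |s - t|) := by
      rw [abs_mul, abs_mul, abs_of_pos (by linarith : 0 < 2 * e)]; gcongr
    have hβ' := (abs_le.1 hβ).2
    have hd : 0 ≤ 2 * e * |s - t| := by positivity
    have hH : layerForce ρr (layerFlux j e s) (clampRoot ρj ρr (m s)) ≤
        (2 * e + 2 * e * |s - t|) / a ^ 2 := by
      rcases le_total 0 (layerForce ρr (layerFlux j e s) (clampRoot ρj ρr (m s))) with hH | hH
      · have := le_truncForce (δ := δ) hc.δ_pos.le b1 hH
        rw [le_div_iff₀ (by positivity)]
        linarith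
      · exact hH.trans (by positivity)
    have := (abs_le.1 (le_refl |layerForce ρr (layerFlux j e t) (clampRoot ρj ρr (m s)) -
      layerForce ρr (layerFlux j e s) (clampRoot ρj ρr (m s))|)).2
    linarith

end TruncatedSolution

theorem exists_layerProfile (h : LayerParams a b g ρr j ρj) (hc : LayerConsts a b g k P δ e) :
    ∃ r p z, LayerProfile ρr j ρj e P δ r p z := by
  obtain ⟨m, p, hm, hs⟩ := exists_truncatedSolution h hc
  have hr : Continuous fun s => clampRoot ρj ρr (m s) := continuous_clampRoot.comp hm
  have hmem := fun s => clampRoot_mem h.ρj_pos h.le (m s)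
  refine ⟨fun s => clampRoot ρj ρr (m s), p, _, hr, hmem,
    zAvg_hasDerivAt hc.e_pos h.ρj_pos hr hmem, hs.mem_z, fun t ht => ?_, fun t ht => ?_,
    hs.p_zero, hs.abs_p_le, fun t ht => hs.abs_force_le h hc ht⟩
  · exact (hs.hasDeriv_m t ht).congr (fun x hx => hs.clampRoot_cube h hc hx)
      (hs.clampRoot_cube h hc ht)
  · refine (hs.hasDeriv_p t ht).congr_deriv ?_
    rw [hs.clampRoot_cube h hc ht, truncForce_of_abs_le (hs.abs_force_le h hc ht)]
    ring
end

/-! ### Exponential decay of a profile -/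

/-- Constant in the decay `r³ - ρj³ ≤ C e^{-e t}`. -/
noncomputable def decayCube (a b g : ℝ) : ℝ := 2 * (6 * b ^ 6 / a ^ 5) / slopeLo b g
/-- Constant in the decay of the force. -/
noncomputable def decayForce (a b g : ℝ) : ℝ := 6 * b ^ 6 / a ^ 5 + slopeHi a b * decayCube a b g
/-- Constant in the decay of the slope `p`. -/
noncomputable def decaySlope (a b g : ℝ) : ℝ := 2 * (decayCube a b g + b ^ 2 * decayForce a b g)

section
variable {a b g ρr j ρj k P δ e : ℝ} {r p z : ℝ → ℝ}

theorem LayerParams.decay_nonneg (h : LayerParams a b g ρr j ρj) :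
    0 ≤ decayCube a b g ∧ 0 ≤ decayForce a b g ∧ 0 ≤ decaySlope a b g := by
  have := h.a_pos; have := h.b_pos; have := h.g_pos
  unfold decaySlope decayForce decayCube slopeHi slopeLo
  refine ⟨?_, ?_, ?_⟩ <;> positivity

theorem LayerParams.slopeLo_pos (h : LayerParams a b g ρr j ρj) : 0 < slopeLo b g := by
  have := h.b_pos; have := h.g_pos
  unfold slopeLo; positivity

theorem LayerParams.force_ρj_flux_le (h : LayerParams a b g ρr j ρj) (t : ℝ) :
    layerForce ρr (layerFlux j e t) ρj ≤ 6 * b ^ 6 / a ^ 5 * Real.exp (-(e * t)) := by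
  have ha := h.a_pos
  have hb := h.b_pos
  have haj := h.a_le
  rw [h.force_ρj]
  have h1 := sq_sub_layerFlux_sq_le j e t
  have h2 := h.flux_sq_le
  calc 3 * (j ^ 2 - layerFlux j e t ^ 2) / ρj ^ 5
      ≤ 3 * (2 * b ^ 6 * Real.exp (-(e * t))) / ρj ^ 5 := by
        have := h.ρj_pos
        gcongr
        exact h1.trans (by gcongr)
    _ ≤ 3 * (2 * b ^ 6 * Real.exp (-(e * t))) / a ^ 5 := by gcongr
    _ = _ := by ring

namespace LayerProfile

theorem bounds (h : LayerParams a b g ρr j ρj) (hc : LayerConsts a b g k P δ e)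
    (hp : LayerProfile ρr j ρj e P δ r p z) (t : ℝ) :
    0 < z t ∧ a ^ 2 ≤ 1 / z t ∧ 1 / z t ≤ b ^ 2 ∧
      |layerDrift e (r t) (z t)| ≤ e * (b ^ 2 / a ^ 2) := by
  have hz := h.Icc_inv_sq_subset (hp.mem_z t)
  obtain ⟨h1, h2, h3⟩ := inv_mem_of_mem h.a_pos h.b_pos hz.1 hz.2
  exact ⟨h1, h2, h3, abs_layerDrift_le h.a_pos h.b_pos hc.e_pos.le (h.a_le.trans (hp.mem_r t).1)
      ((hp.mem_r t).2.trans h.le_b) hz.1 hz.2⟩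

theorem pos (h : LayerParams a b g ρr j ρj) (hp : LayerProfile ρr j ρj e P δ r p z) (t : ℝ) :
    0 < r t := h.ρj_pos.trans_le (hp.mem_r t).1

/-- Comparison with the barrier `ρj³ + C e^{-e t}`: it is a supersolution because the force at `ρj`
is `O(e^{-e t})` and the barrier varies slowly. -/
theorem cube_sub_le (h : LayerParams a b g ρr j ρj) (hc : LayerConsts a b g k P δ e)
    (hp : LayerProfile ρr j ρj e P δ r p z) {t : ℝ} (ht : 0 ≤ t) :
    r t ^ 3 - ρj ^ 3 ≤ decayCube a b g * Real.exp (-(e * t)) := by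
  by_contra! hlt
  have ha := h.a_pos
  have he := hc.e_pos
  have hA := h.decay_nonneg.1
  have hsl := h.slopeLo_pos
  set A := decayCube a b g with hAdef
  have hAsl : slopeLo b g * A = 2 * (6 * b ^ 6 / a ^ 5) := by
    rw [hAdef, decayCube]; field_simp
  have hE : ∀ s, HasDerivAt (fun s => Real.exp (-(e * s))) (-(e * Real.exp (-(e * s)))) s := by
    intro s
    have := (((hasDerivAt_id s).const_mul e).fun_neg).exp
    refine this.congr_deriv ?_
    simp; ring
  have hgap : 0 < a ^ 2 * slopeLo b g * (r t ^ 3 - ρj ^ 3 - A * Real.exp (-(e * t))) :=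
    mul_pos (by positivity) (by linarith)
  obtain ⟨s, hs0, h1, h2, h3⟩ := exists_almost_max (κ := fun _ => 1) (T := fun t => t) (κ₀ := 1)
    (f := fun s => r s ^ 3 - ρj ^ 3 - A * Real.exp (-(e * s)))
    (p := fun s => p s + A * (e * Real.exp (-(e * s))))
    (g := fun s => -(layerDrift e (r s) (z s) * p s +
      layerForce ρr (layerFlux j e s) (r s) / z s) - A * (e * (e * Real.exp (-(e * s)))))
    (B := ρr ^ 3)
    (fun s hs => (((hp.hasDeriv_cube s hs).sub_const _).sub
      ((hE s).hasDerivWithinAt.const_mul A)).congr_deriv (by ring))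
    (fun s hs => ((hp.hasDeriv_p s hs).add
      (((hE s).hasDerivWithinAt.const_mul e).const_mul A)).congr_deriv (by ring))
    (fun t _ => hasDerivWithinAt_id t _) one_pos (fun _ _ => le_rfl)
    (by rw [hp.p_zero]; positivity)
    (fun s _ => by
      have h1 : r s ^ 3 ≤ ρr ^ 3 := by have := pos h hp s; have := (hp.mem_r s).2; gcongr
      have h2 := pow_pos h.ρj_pos 3
      have h3 := mul_nonneg hA (Real.exp_pos (-(e * s))).le
      linarith)
    (half_pos hgap) ht
  obtain ⟨hz0, b1, b2, b3⟩ := bounds h hc hp s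
  set E := Real.exp (-(e * s)) with hEdef
  have hE0 : 0 < E := Real.exp_pos _
  set f := r s ^ 3 - ρj ^ 3 - A * E with hf
  have hW := layerFlux_sq_le (j := j) he.le hs0
  have hF := (h.force_sub_mem hW le_rfl (hp.mem_r s).1 (hp.mem_r s).2).1
  change slopeLo b g * (r s ^ 3 - ρj ^ 3) ≤ _ at hF
  have hF2 := h.force_ρj_flux_le (e := e) s
  rw [← hEdef] at hF2
  have hH : layerForce ρr (layerFlux j e s) (r s) ≤ -(slopeLo b g * A * E / 2 + slopeLo b g * f) := by
    have : r s ^ 3 - ρj ^ 3 = f + A * E := by rw [hf]; ring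
    rw [this] at hF
    nlinarith
  have hf0 : 0 < f := lt_of_lt_of_le (by linarith) h1
  have hHz : a ^ 2 * (slopeLo b g * A * E / 2 + slopeLo b g * f) ≤
      -(layerForce ρr (layerFlux j e s) (r s) / z s) := by
    have e1 : -(layerForce ρr (layerFlux j e s) (r s) / z s) =
        1 / z s * (-layerForce ρr (layerFlux j e s) (r s)) := by ring
    rw [e1]
    have : 0 ≤ slopeLo b g * A * E / 2 + slopeLo b g * f := by positivity
    gcongr
    linarith
  have hβ : |layerDrift e (r s) (z s) * (p s + A * (e * E))| ≤
      1 / 2 * (a ^ 2 * slopeLo b g * (r t ^ 3 - ρj ^ 3 - A * Real.exp (-(e * t))) / 2) := by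
    rw [abs_mul]; gcongr; exact b3.trans hc.drift_le
  have hβ2 : |layerDrift e (r s) (z s) * (A * (e * E))| ≤ e * (b ^ 2 / a ^ 2) * (A * (1 * E)) := by
    have := hc.e_le
    rw [abs_mul, abs_of_nonneg (by positivity : 0 ≤ A * (e * E))]; gcongr
  have hβ' := (abs_le.1 hβ).2
  have hβ2' := (abs_le.1 hβ2).1
  have hdec := mul_le_mul_of_nonneg_right hc.decay_small (by positivity : 0 ≤ A * E)
  have hee : A * (e * (e * E)) ≤ A * (e * (1 * E)) := by have := hc.e_le; gcongr
  have hff : a ^ 2 * slopeLo b g * (r t ^ 3 - ρj ^ 3 - A * Real.exp (-(e * t))) ≤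
      a ^ 2 * slopeLo b g * f := by gcongr
  nlinarith

theorem cube_sub_nonneg (h : LayerParams a b g ρr j ρj)
    (hp : LayerProfile ρr j ρj e P δ r p z) (t : ℝ) : 0 ≤ r t ^ 3 - ρj ^ 3 := by
  have := h.ρj_pos
  have := (hp.mem_r t).1
  exact sub_nonneg.2 (by gcongr)

theorem abs_force_decay (h : LayerParams a b g ρr j ρj) (hc : LayerConsts a b g k P δ e)
    (hp : LayerProfile ρr j ρj e P δ r p z) {t : ℝ} (ht : 0 ≤ t) :
    |layerForce ρr (layerFlux j e t) (r t)| ≤ decayForce a b g * Real.exp (-(e * t)) := by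
  have ha := h.a_pos
  have hb := h.b_pos
  have hW := layerFlux_sq_le (j := j) hc.e_pos.le ht
  obtain ⟨f1, f2⟩ := h.force_sub_mem hW le_rfl (hp.mem_r t).1 (hp.mem_r t).2
  have hd := cube_sub_nonneg h hp t
  have f3 := h.force_ρj_flux_le (e := e) t
  have f4 := h.force_ρj_nonneg hW
  have f5 := cube_sub_le h hc hp ht
  have hE := Real.exp_pos (-(e * t))
  have hs := h.slopeLo_pos
  change slopeLo b g * _ ≤ _ at f1
  change _ ≤ slopeHi a b * _ at f2
  have hs2 : 0 ≤ slopeHi a b := by unfold slopeHi; positivity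
  have f6 := mul_le_mul_of_nonneg_left f5 hs2
  have f7 := mul_nonneg hs.le hd
  have f8 : 0 ≤ 6 * b ^ 6 / a ^ 5 * Real.exp (-(e * t)) := by positivity
  have f9 := mul_nonneg hs2 (mul_nonneg h.decay_nonneg.1 hE.le)
  unfold decayForce
  rw [abs_le]; constructor <;> nlinarith

theorem abs_slope_decay (h : LayerParams a b g ρr j ρj) (hc : LayerConsts a b g k P δ e)
    (hp : LayerProfile ρr j ρj e P δ r p z) {t : ℝ} (ht : 0 ≤ t) :
    |p t| ≤ decaySlope a b g * Real.exp (-(e * t)) := by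
  have he := hc.e_pos
  have hmono : ∀ s, t ≤ s → Real.exp (-(e * s)) ≤ Real.exp (-(e * t)) := fun s hs =>
    Real.exp_le_exp.2 (by nlinarith)
  have hD0 := h.decay_nonneg
  have := abs_deriv_le_of_unit_interval (D := decayCube a b g * Real.exp (-(e * t)))
    (G := b ^ 2 * (decayForce a b g * Real.exp (-(e * t)))) ht hp.hasDeriv_cube hp.hasDeriv_p ?_ ?_
  · refine this.trans (le_of_eq ?_)
    unfold decaySlope; ring
  · have h1 := cube_sub_le h hc hp ht
    have h2 := cube_sub_le h hc hp (by linarith : 0 ≤ t + 1)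
    have h3 := cube_sub_nonneg h hp t
    have h4 := cube_sub_nonneg h hp (t + 1)
    have h5 := mul_le_mul_of_nonneg_left (hmono (t + 1) (by linarith)) hD0.1
    rw [abs_le]; constructor <;> linarith
  · intro s hs
    obtain ⟨hz0, b1, b2, b3⟩ := bounds h hc hp s
    have hF := abs_force_decay h hc hp (ht.trans hs)
    rw [abs_neg]
    refine (abs_add_le _ _).trans (add_le_add ?_ ?_)
    · rw [abs_mul]
      have := mul_le_mul_of_nonneg_right (b3.trans hc.drift_le) (abs_nonneg (p s))
      linarith
    · rw [div_eq_mul_one_div, abs_mul, mul_comm, abs_of_pos (by positivity : 0 < 1 / z s)]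
      gcongr
      refine hF.trans ?_
      have := hD0.2.1
      gcongr

theorem sq_sub_le (h : LayerParams a b g ρr j ρj) (hc : LayerConsts a b g k P δ e)
    (hp : LayerProfile ρr j ρj e P δ r p z) {t : ℝ} (ht : 0 ≤ t) :
    0 ≤ r t ^ 2 - ρj ^ 2 ∧ r t ^ 2 - ρj ^ 2 ≤ decayCube a b g / a * Real.exp (-(e * t)) := by
  have ha := h.a_pos
  have h1 := cube_sub_le h hc hp ht
  have h2 := (hp.mem_r t).1
  have h3 := h.a_le
  have hd : 0 ≤ r t - ρj := by linarith
  refine ⟨by nlinarith, ?_⟩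
  rw [div_mul_eq_mul_div, le_div_iff₀ ha]
  refine le_trans ?_ h1
  have e1 : (r t ^ 2 - ρj ^ 2) * a = (r t - ρj) * ((r t + ρj) * a) := by ring
  have e2 : r t ^ 3 - ρj ^ 3 = (r t - ρj) * (r t ^ 2 + r t * ρj + ρj ^ 2) := by ring
  rw [e1, e2]
  gcongr
  nlinarith

end LayerProfile
end

/-! ### From a profile to the original variable -/

theorem hasDerivWithinAt_of_cube {f : ℝ → ℝ} {s : Set ℝ} {d x : ℝ} (hpos : ∀ y, 0 < f y)
    (h : HasDerivWithinAt (fun y => f y ^ 3) d s x) :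
    HasDerivWithinAt f (d / (3 * f x ^ 2)) s x := by
  have h1 := h.rpow_const (p := 1 / 3) (Or.inl (pow_pos (hpos x) 3).ne')
  have h2 : ∀ y, (f y ^ 3) ^ (1 / 3 : ℝ) = f y := fun y => by
    rw [← Real.rpow_natCast, ← Real.rpow_mul (hpos y).le]; norm_num
  have h3 : (f x ^ 3) ^ ((1 : ℝ) / 3 - 1) = 1 / f x ^ 2 := by
    rw [← Real.rpow_natCast, ← Real.rpow_mul (hpos x).le,
      show ((3 : ℕ) : ℝ) * (1 / 3 - 1) = -((2 : ℕ) : ℝ) by norm_num,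
      Real.rpow_neg (hpos x).le, Real.rpow_natCast, one_div]
  simp only [h2] at h1
  refine h1.congr_deriv ?_
  rw [h3]; ring

/-- `(r, p, z)` read in the original variable through the time change `T' = r² √z`. -/
structure IsTimeChange (r z T : ℝ → ℝ) : Prop where
  zero : T 0 = 0
  hasDerivAt : ∀ τ, HasDerivAt T (r (T τ) ^ 2 * √(z (T τ))) τ

/-- The electric potential of a profile in the original variable. -/
noncomputable def profilePotential (j e : ℝ) (z T : ℝ → ℝ) (τ : ℝ) : ℝ :=
  -(e * (j * Real.exp (-(e * T τ))) * √(z (T τ)))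

/-- Constant in the decay of all the quantities of the boundary layer. -/
noncomputable def decayTotal (a b g : ℝ) : ℝ :=
  b ^ 3 / a + b ^ 3 + √(decayCube a b g / a) + decaySlope a b g / (3 * a) +
    (b ^ 3 / a ^ 2 + b ^ 3 * (decayCube a b g / a) / a ^ 4) + 1

section
variable {a b g ρr j ρj k P δ e : ℝ} {r p z T : ℝ → ℝ}

namespace LayerProfile

theorem sqrt_z_bounds (h : LayerParams a b g ρr j ρj) (hp : LayerProfile ρr j ρj e P δ r p z)
    (t : ℝ) : 1 / b ≤ √(z t) ∧ √(z t) ≤ 1 / a := by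
  have hz := h.Icc_inv_sq_subset (hp.mem_z t)
  have ha := h.a_pos
  have hb := h.b_pos
  constructor
  · refine Real.le_sqrt_of_sq_le ?_
    rw [div_pow, one_pow]; exact hz.1
  · refine (Real.sqrt_le_left (by positivity)).2 ?_
    rw [div_pow, one_pow]; exact hz.2

theorem rate_bounds (h : LayerParams a b g ρr j ρj) (hp : LayerProfile ρr j ρj e P δ r p z)
    (t : ℝ) : a ^ 2 / b ≤ r t ^ 2 * √(z t) ∧ r t ^ 2 * √(z t) ≤ b ^ 2 / a := by
  obtain ⟨h1, h2⟩ := sqrt_z_bounds h hp t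
  have ha := h.a_pos
  have hb := h.b_pos
  have h3 := h.a_le.trans (hp.mem_r t).1
  have h4 := (hp.mem_r t).2.trans h.le_b
  have h5 := pos h hp t
  constructor
  · calc a ^ 2 / b = a ^ 2 * (1 / b) := by ring
      _ ≤ _ := by gcongr
  · calc r t ^ 2 * √(z t) ≤ b ^ 2 * (1 / a) := by gcongr
      _ = _ := by ring

theorem continuous_z (hp : LayerProfile ρr j ρj e P δ r p z) : Continuous z :=
  continuous_iff_continuousAt.2 fun t => (hp.hasDerivAt_z t).continuousAt

theorem exists_isTimeChange (h : LayerParams a b g ρr j ρj)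
    (hp : LayerProfile ρr j ρj e P δ r p z) : ∃ T, IsTimeChange r z T := by
  have ha := h.a_pos
  have hb := h.b_pos
  obtain ⟨T, h1, h2⟩ := exists_timeChange (κ := fun t => r t ^ 2 * √(z t)) (κ₀ := a ^ 2 / b)
    (κ₁ := b ^ 2 / a) ((hp.continuous_r.pow 2).mul hp.continuous_z.sqrt) (by positivity)
    (fun t => (rate_bounds h hp t).1) (fun t => (rate_bounds h hp t).2)
  exact ⟨T, h1, h2⟩

theorem le_timeChange (h : LayerParams a b g ρr j ρj) (hp : LayerProfile ρr j ρj e P δ r p z)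
    (hT : IsTimeChange r z T) {τ : ℝ} (hτ : 0 ≤ τ) : a ^ 2 / b * τ ≤ T τ := by
  have := monotone_of_hasDerivAt_nonneg (f := fun τ => T τ - a ^ 2 / b * τ)
    (f' := fun τ => r (T τ) ^ 2 * √(z (T τ)) - a ^ 2 / b)
    (fun τ => ((hT.hasDerivAt τ).sub ((hasDerivAt_id τ).const_mul (a ^ 2 / b))).congr_deriv
      (by simp))
    (fun τ => sub_nonneg.2 (rate_bounds h hp _).1) hτ
  simp only [hT.zero] at this
  linarith

theorem timeChange_nonneg (h : LayerParams a b g ρr j ρj) (hp : LayerProfile ρr j ρj e P δ r p z)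
    (hT : IsTimeChange r z T) {τ : ℝ} (hτ : 0 ≤ τ) : 0 ≤ T τ := by
  refine le_trans ?_ (le_timeChange h hp hT hτ)
  have := h.a_pos; have := h.b_pos
  positivity

theorem hasDeriv_comp (h : LayerParams a b g ρr j ρj) (hp : LayerProfile ρr j ρj e P δ r p z)
    (hT : IsTimeChange r z T) {f : ℝ → ℝ} {d τ : ℝ}
    (hf : HasDerivWithinAt f d (Ici 0) (T τ)) :
    HasDerivWithinAt (fun s => f (T s)) (d * (r (T τ) ^ 2 * √(z (T τ)))) (Ici 0) τ :=
  hf.comp τ (hT.hasDerivAt τ).hasDerivWithinAt fun _ hs => timeChange_nonneg h hp hT hs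

theorem hasDeriv_sqrt_z (h : LayerParams a b g ρr j ρj) (hc : LayerConsts a b g k P δ e)
    (hp : LayerProfile ρr j ρj e P δ r p z) (t : ℝ) :
    HasDerivAt (fun t => √(z t)) (e * (z t - 1 / r t ^ 2) / √(z t)) t := by
  obtain ⟨hz, -⟩ := bounds h hc hp t
  refine ((hp.hasDerivAt_z t).sqrt hz.ne').congr_deriv ?_
  have := Real.sqrt_pos.2 hz
  field_simp

theorem hasDeriv_density (h : LayerParams a b g ρr j ρj)
    (hp : LayerProfile ρr j ρj e P δ r p z) (hT : IsTimeChange r z T) {τ : ℝ} (hτ : 0 ≤ τ) :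
    HasDerivWithinAt (fun s => r (T s)) (√(z (T τ)) * p (T τ) / 3) (Ici 0) τ := by
  have h0 := pos h hp (T τ)
  have h1 := hasDeriv_comp h hp hT
    (hasDerivWithinAt_of_cube (pos h hp) (hp.hasDeriv_cube _ (timeChange_nonneg h hp hT hτ)))
  refine h1.congr_deriv ?_
  field_simp

theorem hasDeriv_density' (h : LayerParams a b g ρr j ρj) (hc : LayerConsts a b g k P δ e)
    (hp : LayerProfile ρr j ρj e P δ r p z) (hT : IsTimeChange r z T) {τ : ℝ} (hτ : 0 ≤ τ) :
    HasDerivWithinAt (fun s => √(z (T s)) * p (T s) / 3)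
      (-((ρr ^ 2 - layerFlux j e (T τ) ^ 2 / r (T τ) ^ 4 - r (T τ) ^ 2) * r (T τ))) (Ici 0) τ := by
  have h0 := pos h hp (T τ)
  obtain ⟨hz, -⟩ := bounds h hc hp (T τ)
  have hs := Real.sqrt_pos.2 hz
  have hss := Real.sq_sqrt hz.le
  have h1 := hasDeriv_comp h hp hT
    (((hasDeriv_sqrt_z h hc hp (T τ)).hasDerivWithinAt.mul
      (hp.hasDeriv_p _ (timeChange_nonneg h hp hT hτ))).div_const 3)
  refine h1.congr_deriv ?_
  set u := √(z (T τ)) with hu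
  rw [layerForce, layerDrift, ← hss]
  field_simp
  ring

theorem hasDeriv_expT (hT : IsTimeChange r z T) (τ : ℝ) :
    HasDerivAt (fun s => j * Real.exp (-(e * T s)))
      (-(e * (j * Real.exp (-(e * T τ))) * (r (T τ) ^ 2 * √(z (T τ))))) τ := by
  have := ((((hT.hasDerivAt τ).const_mul e).fun_neg).exp).const_mul j
  refine this.congr_deriv ?_
  ring

theorem hasDeriv_potential (h : LayerParams a b g ρr j ρj) (hc : LayerConsts a b g k P δ e)
    (hp : LayerProfile ρr j ρj e P δ r p z) (hT : IsTimeChange r z T) (τ : ℝ) :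
    HasDerivWithinAt (profilePotential j e z T) (e ^ 2 * (j * Real.exp (-(e * T τ)))) (Ici 0) τ := by
  have h0 := pos h hp (T τ)
  obtain ⟨hz, -⟩ := bounds h hc hp (T τ)
  have hs := Real.sqrt_pos.2 hz
  have hss := Real.sq_sqrt hz.le
  have h1 := hasDeriv_comp h hp hT (hasDeriv_sqrt_z h hc hp (T τ)).hasDerivWithinAt
  have h2 := (((hasDeriv_expT (j := j) (e := e) hT τ).hasDerivWithinAt (s := Ici 0)).const_mul
    e).mul h1
  refine h2.fun_neg.congr_deriv ?_
  set u := √(z (T τ)) with hu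
  rw [← hss]
  field_simp
  ring

theorem hasDeriv_potential' (hT : IsTimeChange r z T) (τ : ℝ) :
    HasDerivAt (fun s => e ^ 2 * (j * Real.exp (-(e * T s))))
      (e ^ 2 * (r (T τ) ^ 2 * profilePotential j e z T τ)) τ := by
  refine ((hasDeriv_expT (j := j) (e := e) hT τ).const_mul (e ^ 2)).congr_deriv ?_
  simp only [profilePotential]; ring

end LayerProfile
end

/-! ### Profiles give admissible solutions -/

section
variable {a b g ρr j ρj k P δ e : ℝ} {r p z T : ℝ → ℝ}
namespace LayerProfile

/-- Exponential decay in the original variable, for the formulas giving the solution and its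
derivatives in terms of the profile. -/
theorem decay (h : LayerParams a b g ρr j ρj) (hc : LayerConsts a b g k P δ e)
    (hp : LayerProfile ρr j ρj e P δ r p z) (hT : IsTimeChange r z T) {τ : ℝ} (hτ : 0 ≤ τ) :
    |profilePotential j e z T τ| ≤ b ^ 3 / a * Real.exp (-(a ^ 2 / (2 * b) * e) * τ) ∧
    |e ^ 2 * (j * Real.exp (-(e * T τ)))| ≤ b ^ 3 * Real.exp (-(a ^ 2 / (2 * b) * e) * τ) ∧
    √|r (T τ) ^ 2 - ρj ^ 2| ≤
      √(decayCube a b g / a) * Real.exp (-(a ^ 2 / (2 * b) * e) * τ) ∧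
    |√(z (T τ)) * p (T τ) / 3| ≤
      decaySlope a b g / (3 * a) * Real.exp (-(a ^ 2 / (2 * b) * e) * τ) ∧
    |(j * Real.exp (-(e * T τ)) - j) / r (T τ) ^ 2 + j / ρj ^ 2| ≤
      (b ^ 3 / a ^ 2 + b ^ 3 * (decayCube a b g / a) / a ^ 4) *
        Real.exp (-(a ^ 2 / (2 * b) * e) * τ) ∧
    |r (T τ) - ρj| ≤ decayCube a b g / a / a * Real.exp (-(a ^ 2 / (2 * b) * e) * τ) := by
  have ha := h.a_pos
  have hb := h.b_pos
  have he := hc.e_pos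
  have he1 := hc.e_le
  have hj := h.abs_flux_le
  have hA := h.decay_nonneg
  have hT0 := timeChange_nonneg h hp hT hτ
  have hTτ := le_timeChange h hp hT hτ
  set E := Real.exp (-(e * T τ)) with hE
  set Γ := Real.exp (-(a ^ 2 / (2 * b) * e) * τ) with hΓ
  have hE0 : 0 < E := Real.exp_pos _
  have hΓ0 : 0 < Γ := Real.exp_pos _
  have hΓ1 : Γ ≤ 1 := Real.exp_le_one_iff.2 (by
    have : 0 ≤ a ^ 2 / (2 * b) * e * τ := by positivity
    linarith)
  have hEΓ2 : E ≤ Γ ^ 2 := by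
    rw [hE, hΓ, ← Real.exp_nat_mul]
    refine Real.exp_le_exp.2 ?_
    have e1 : ((2 : ℕ) : ℝ) * (-(a ^ 2 / (2 * b) * e) * τ) = -(e * (a ^ 2 / b * τ)) := by
      push_cast; field_simp
    rw [e1]
    have := mul_le_mul_of_nonneg_left hTτ he.le
    linarith
  have hEΓ : E ≤ Γ := hEΓ2.trans (by nlinarith)
  obtain ⟨u1, u2⟩ := sqrt_z_bounds h hp (T τ)
  have u0 : 0 ≤ √(z (T τ)) := Real.sqrt_nonneg _
  obtain ⟨q1, q2⟩ := sq_sub_le h hc hp hT0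
  rw [← hE] at q2
  have hjE : |j * E| ≤ b ^ 3 * Γ := by
    rw [abs_mul, abs_of_pos hE0]; gcongr
  have hr := h.a_le.trans (hp.mem_r (T τ)).1
  have hr0 := pos h hp (T τ)
  have hρj := h.ρj_pos
  have haj := h.a_le
  have q3 : r (T τ) ^ 2 - ρj ^ 2 ≤ decayCube a b g / a * Γ := by
    refine q2.trans ?_
    have := div_nonneg hA.1 ha.le
    gcongr
  refine ⟨?_, ?_, ?_, ?_, ?_, ?_⟩
  · rw [profilePotential, abs_neg, abs_mul, abs_mul, abs_of_pos he, abs_of_nonneg u0]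
    calc e * |j * E| * √(z (T τ)) ≤ 1 * (b ^ 3 * Γ) * (1 / a) := by gcongr
      _ = _ := by ring
  · rw [abs_mul, abs_of_nonneg (sq_nonneg e)]
    calc e ^ 2 * |j * E| ≤ 1 * (b ^ 3 * Γ) := by
          gcongr
          exact pow_le_one₀ he.le he1
      _ = _ := by ring
  · rw [abs_of_nonneg q1]
    calc √(r (T τ) ^ 2 - ρj ^ 2) ≤ √(decayCube a b g / a * Γ ^ 2) := by
          refine Real.sqrt_le_sqrt (q2.trans ?_)
          have := div_nonneg hA.1 ha.le
          gcongr
      _ = √(decayCube a b g / a) * Γ := by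
          rw [Real.sqrt_mul' _ (sq_nonneg _), Real.sqrt_sq hΓ0.le]
  · have hpd := abs_slope_decay h hc hp hT0
    rw [abs_div, abs_mul, abs_of_nonneg u0, abs_of_pos (by norm_num : (0 : ℝ) < 3)]
    calc _ ≤ 1 / a * (decaySlope a b g * Γ) / 3 := by
          gcongr
          refine hpd.trans ?_
          have := hA.2.2
          gcongr
      _ = _ := by field_simp
  · have e1 : (j * E - j) / r (T τ) ^ 2 + j / ρj ^ 2 =
        j * E / r (T τ) ^ 2 + j * (r (T τ) ^ 2 - ρj ^ 2) / (r (T τ) ^ 2 * ρj ^ 2) := by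
      field_simp; ring
    rw [e1]
    refine (abs_add_le _ _).trans ?_
    rw [abs_div, abs_div, abs_mul j (_ - _), abs_of_nonneg q1,
      abs_of_pos (by positivity : 0 < r (T τ) ^ 2),
      abs_of_pos (by positivity : 0 < r (T τ) ^ 2 * ρj ^ 2)]
    have hA1 := hA.1
    calc _ ≤ b ^ 3 * Γ / a ^ 2 + b ^ 3 * (decayCube a b g / a * Γ) / (a ^ 2 * a ^ 2) := by gcongr
      _ = _ := by ring
  · have hd : 0 ≤ r (T τ) - ρj := sub_nonneg.2 (hp.mem_r _).1
    rw [abs_of_nonneg hd, div_mul_eq_mul_div, le_div_iff₀ ha]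
    refine le_trans ?_ q3
    nlinarith

/-- A profile, read in the original variable, is an admissible solution. -/
theorem isAdmissibleSolution (h : LayerParams a b g ρr j ρj) (hc : LayerConsts a b g k P δ e)
    (hp : LayerProfile ρr j ρj e P δ r p z) (hT : IsTimeChange r z T) {σ₀ : ℝ}
    (hσ : σ₀ * e ^ 2 = 1) :
    IsAdmissibleSolution ρr j ρj σ₀ (fun τ => r (T τ)) (profilePotential j e z T) := by
  have ha := h.a_pos
  have hb := h.b_pos
  have he := hc.e_pos
  have hj := h.abs_flux_le
  have hA := h.decay_nonneg
  have d1 := fun τ (hτ : 0 ≤ τ) => hasDeriv_density h hp hT hτ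
  have d2 := fun τ (hτ : 0 ≤ τ) => hasDeriv_density' h hc hp hT hτ
  have d3 := fun τ (_ : 0 ≤ τ) => hasDeriv_potential (j := j) h hc hp hT τ
  have d4 := fun τ (_ : 0 ≤ τ) =>
    (hasDeriv_potential' (j := j) (e := e) hT τ).hasDerivWithinAt (s := Ici 0)
  have cT : Continuous T := continuous_iff_continuousAt.2 fun τ => (hT.hasDerivAt τ).continuousAt
  have cr : Continuous fun τ => r (T τ) := hp.continuous_r.comp cT
  have cz : Continuous fun τ => z (T τ) := hp.continuous_z.comp cT
  have hr0 : ∀ τ, r (T τ) ^ 4 ≠ 0 := fun τ => (pow_pos (pos h hp _) 4).ne'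
  have cW : Continuous fun τ => layerFlux j e (T τ) := (continuous_layerFlux j e).comp cT
  have cφ : Continuous (profilePotential j e z T) := by
    have cu := cz.sqrt
    have cE : Continuous fun τ => Real.exp (-(e * T τ)) := by fun_prop
    exact ((continuous_const.mul (continuous_const.mul cE)).mul cu).neg
  have c2 : Continuous fun τ =>
      -((ρr ^ 2 - layerFlux j e (T τ) ^ 2 / r (T τ) ^ 4 - r (T τ) ^ 2) * r (T τ)) :=
    (((continuous_const.sub ((cW.pow 2).div (cr.pow 4) hr0)).sub (cr.pow 2)).mul cr).neg
  have hγ : 0 < a ^ 2 / (2 * b) * e := by positivity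
  have hflux : ∀ τ, 0 ≤ τ → σ₀ * halfDeriv (profilePotential j e z T) τ - j =
      layerFlux j e (T τ) := by
    intro τ hτ
    rw [halfDeriv_eq hτ (d3 τ hτ), layerFlux]
    linear_combination (j * Real.exp (-(e * T τ))) * hσ
  refine ⟨⟨contDiffOn_two_of_hasDerivWithinAt d1 d2 c2.continuousOn,
    contDiffOn_two_of_hasDerivWithinAt d3 d4 ?_, ?_, ?_, ?_, ?_⟩, ?_, ?_, ?_⟩
  · exact (continuous_const.mul ((cr.pow 2).mul cφ)).continuousOn
  · intro τ hτ
    rw [halfDeriv_eq hτ.le (hasDerivWithinAt_halfDeriv d1 d2 hτ.le), hflux τ hτ.le]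
    ring
  · intro τ hτ
    rw [halfDeriv_eq hτ.le (hasDerivWithinAt_halfDeriv d3 d4 hτ.le)]
    linear_combination (-(r (T τ) ^ 2 * profilePotential j e z T τ)) * hσ
  · rw [halfDeriv_eq le_rfl (d1 0 le_rfl), hT.zero, hp.p_zero]; ring
  · have hσ0 : σ₀ ≠ 0 := by rintro rfl; simp at hσ
    rw [halfDeriv_eq le_rfl (d3 0 le_rfl), hT.zero, eq_div_iff hσ0]
    simp
    linear_combination j * hσ
  · exact fun τ _ => (hp.mem_r _).1
  · refine memH1HalfLine_of_exp_bound (f' := fun s => √(z (T s)) * p (T s) / 3)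
      (C := decayCube a b g / a / a + decaySlope a b g / (3 * a)) hγ
      (fun τ hτ => (d1 τ hτ).sub_const _) (fun τ hτ => (d2 τ hτ).continuousWithinAt)
      (fun τ hτ => ?_) (fun τ hτ => ?_)
    · refine (decay h hc hp hT hτ).2.2.2.2.2.trans ?_
      have := div_nonneg hA.2.2 (by positivity : 0 ≤ 3 * a)
      gcongr
      linarith
    · refine (decay h hc hp hT hτ).2.2.2.1.trans ?_
      have := div_nonneg (div_nonneg hA.1 ha.le) ha.le
      gcongr
      linarith
  · refine memH1HalfLine_of_exp_bound (f' := fun s => e ^ 2 * (j * Real.exp (-(e * T s))))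
      (C := b ^ 3 / a + b ^ 3) hγ d3 (fun τ hτ => (d4 τ hτ).continuousWithinAt)
      (fun τ hτ => ?_) (fun τ hτ => ?_)
    · refine (decay h hc hp hT hτ).1.trans ?_
      have : 0 ≤ b ^ 3 := by positivity
      gcongr
      linarith
    · refine (decay h hc hp hT hτ).2.1.trans ?_
      have : 0 ≤ b ^ 3 / a := by positivity
      gcongr
      linarith

theorem decay_total (h : LayerParams a b g ρr j ρj) (hc : LayerConsts a b g k P δ e)
    (hp : LayerProfile ρr j ρj e P δ r p z) (hT : IsTimeChange r z T) {σ₀ : ℝ}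
    (hσ : σ₀ * e ^ 2 = 1) {τ : ℝ} (hτ : 0 ≤ τ) :
    |profilePotential j e z T τ| + |halfDeriv (profilePotential j e z T) τ| +
      √|r (T τ) ^ 2 - ρj ^ 2| + |halfDeriv (fun τ => r (T τ)) τ| +
      |phaseDeriv j (-(j / ρj ^ 2)) σ₀ (fun τ => r (T τ)) (profilePotential j e z T) τ| <
    decayTotal a b g * Real.exp (-(a ^ 2 / (2 * b) * e) * τ) := by
  obtain ⟨h1, h2, h3, h4, h5, -⟩ := decay h hc hp hT hτ
  have hE := Real.exp_pos (-(a ^ 2 / (2 * b) * e) * τ)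
  have e1 : phaseDeriv j (-(j / ρj ^ 2)) σ₀ (fun τ => r (T τ)) (profilePotential j e z T) τ =
      (j * Real.exp (-(e * T τ)) - j) / r (T τ) ^ 2 + j / ρj ^ 2 := by
    rw [phaseDeriv, halfDeriv_eq hτ (hasDeriv_potential h hc hp hT τ)]
    have : σ₀ * (e ^ 2 * (j * Real.exp (-(e * T τ)))) = j * Real.exp (-(e * T τ)) := by
      linear_combination (j * Real.exp (-(e * T τ))) * hσ
    rw [this]; ring
  rw [e1, halfDeriv_eq hτ (hasDeriv_potential h hc hp hT τ),
    halfDeriv_eq hτ (hasDeriv_density h hp hT hτ), decayTotal]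
  linarith

end LayerProfile
end

/-! ### Uniqueness in the original variable -/

theorem hasDerivAt_max_zero_sq (x : ℝ) : HasDerivAt (fun y : ℝ => max y 0 ^ 2) (2 * max x 0) x := by
  rcases lt_trichotomy x 0 with hx | rfl | hx
  · have : (fun y : ℝ => max y 0 ^ 2) =ᶠ[𝓝 x] fun _ => 0 := by
      filter_upwards [Iio_mem_nhds hx] with y hy
      rw [max_eq_right (le_of_lt hy)]; simp
    refine HasDerivAt.congr_of_eventuallyEq ?_ this
    rw [max_eq_right hx.le, mul_zero]
    exact hasDerivAt_const x 0
  · rw [hasDerivAt_iff_isLittleO_nhds_zero]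
    simp only [max_self, ne_eq, OfNat.ofNat_ne_zero, not_false_eq_true, zero_pow, mul_zero,
      smul_zero, sub_zero, zero_add]
    refine Asymptotics.IsBigO.trans_isLittleO (g := fun h : ℝ => h ^ 2) ?_
      (Asymptotics.isLittleO_pow_id one_lt_two)
    refine Asymptotics.IsBigO.of_bound 1 (Eventually.of_forall fun y => ?_)
    rw [Real.norm_of_nonneg (sq_nonneg _), Real.norm_of_nonneg (sq_nonneg _), one_mul]
    rcases le_total y 0 with h | h
    · rw [max_eq_right h]; nlinarith
    · rw [max_eq_left h]
  · have : (fun y : ℝ => max y 0 ^ 2) =ᶠ[𝓝 x] fun y => y ^ 2 := by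
      filter_upwards [Ioi_mem_nhds hx] with y hy
      rw [max_eq_left (le_of_lt hy)]
    refine HasDerivAt.congr_of_eventuallyEq ?_ this
    rw [max_eq_left hx.le]
    simpa using hasDerivAt_pow 2 x

theorem HasDerivWithinAt.mono_Ici {f : ℝ → ℝ} {d τ₁ τ : ℝ} (h : HasDerivWithinAt f d (Ici 0) τ)
    (h1 : 0 ≤ τ₁) : HasDerivWithinAt f d (Ici τ₁) τ := h.mono (Ici_subset_Ici.2 h1)

/-- A bounded solution of `w' = 2 e κ (w - f)` is bounded by the bound of `f`. -/
theorem le_of_unstable_ode {w f T κ : ℝ → ℝ} {e κ₀ B F : ℝ} (he : 0 < e) (hκ₀ : 0 < κ₀)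
    (hκ : ∀ τ, 0 ≤ τ → κ₀ ≤ κ τ) (hT : ∀ τ, 0 ≤ τ → HasDerivWithinAt T (κ τ) (Ici 0) τ)
    (hw : ∀ τ, 0 ≤ τ → HasDerivWithinAt w (κ τ * (2 * e * (w τ - f τ))) (Ici 0) τ)
    (hB : ∀ τ, 0 ≤ τ → w τ ≤ B) (hf : ∀ τ, 0 ≤ τ → f τ ≤ F) {τ : ℝ} (hτ : 0 ≤ τ) : w τ ≤ F := by
  by_contra! hlt
  have hTm := monotoneOn_Ici_of_hasDerivWithinAt (f := fun τ => T τ - κ₀ * τ)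
      (f' := fun τ => κ τ - κ₀) (x₀ := 0)
      (fun x hx => ((hT x hx).sub ((hasDerivWithinAt_id x _).const_mul κ₀)).congr_deriv (by simp))
      (fun x hx => by linarith [hκ x hx])
  have hm := monotoneOn_Ici_of_hasDerivWithinAt
      (f := fun τ => (w τ - F) * Real.exp (-(2 * e * T τ)))
      (f' := fun τ => κ τ * (2 * e * (F - f τ)) * Real.exp (-(2 * e * T τ))) (x₀ := 0)
      (fun x hx => (((hw x hx).sub_const F).mul
        (((hT x hx).const_mul (2 * e)).fun_neg.exp)).congr_deriv (by ring))
      (fun x hx => by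
        have h1 := hf x hx
        have h2 := hκ₀.trans_le (hκ x hx)
        have : 0 ≤ F - f x := by linarith
        positivity)
  set R := τ + (B - F) / (w τ - F) / (2 * e * κ₀) with hR
  have hwF : 0 < w τ - F := by linarith
  have hBF : 0 ≤ (B - F) / (w τ - F) := div_nonneg (by linarith [hB τ hτ]) hwF.le
  have hτR : τ ≤ R := by
    have : 0 ≤ (B - F) / (w τ - F) / (2 * e * κ₀) := by positivity
    linarith
  have hR0 : 0 ≤ R := hτ.trans hτR
  have h1 := hTm hτ hR0 hτR
  have h2 := hm hτ hR0 hτR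
  simp only at h1 h2
  have h3 : (B - F) / (w τ - F) ≤ 2 * e * (T R - T τ) := by
    have : (B - F) / (w τ - F) = 2 * e * (κ₀ * (R - τ)) := by rw [hR]; field_simp; ring
    rw [this]
    have : κ₀ * (R - τ) ≤ T R - T τ := by linarith
    gcongr
  have h4 := Real.add_one_le_exp (2 * e * (T R - T τ))
  have h5 : (w τ - F) * Real.exp (2 * e * (T R - T τ)) ≤ w R - F := by
    have e1 : Real.exp (2 * e * (T R - T τ)) =
        Real.exp (-(2 * e * T τ)) * Real.exp (2 * e * T R) := by
      rw [← Real.exp_add]; congr 1; ring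
    have e2 : Real.exp (-(2 * e * T R)) * Real.exp (2 * e * T R) = 1 := by
      rw [← Real.exp_add]; simp
    have := mul_le_mul_of_nonneg_right h2 (Real.exp_pos (2 * e * T R)).le
    rw [e1]
    calc _ = (w τ - F) * Real.exp (-(2 * e * T τ)) * Real.exp (2 * e * T R) := by ring
      _ ≤ _ := this
      _ = w R - F := by rw [mul_assoc, e2, mul_one]
  have h6 : B - F = (w τ - F) * ((B - F) / (w τ - F)) := by field_simp
  have h7 : (w τ - F) * ((B - F) / (w τ - F) + 1) ≤ (w τ - F) * Real.exp (2 * e * (T R - T τ)) := by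
    gcongr; linarith
  have h8 := hB R hR0
  nlinarith

/-- The autonomous equation `T' = κ(T)`, `T 0 = 0`, has at most one solution for positive continuous
`κ`. -/
theorem timeChange_unique {κ T₁ T₂ : ℝ → ℝ} (hc : Continuous κ) (hpos : ∀ t, 0 < κ t)
    (h1 : ∀ τ, 0 ≤ τ → HasDerivWithinAt T₁ (κ (T₁ τ)) (Ici 0) τ)
    (h2 : ∀ τ, 0 ≤ τ → HasDerivWithinAt T₂ (κ (T₂ τ)) (Ici 0) τ) (h0 : T₁ 0 = T₂ 0)
    {τ : ℝ} (hτ : 0 ≤ τ) : T₁ τ = T₂ τ := by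
  have hic : Continuous fun t => (κ t)⁻¹ := hc.inv₀ fun t => (hpos t).ne'
  set S : ℝ → ℝ := fun t => ∫ s in (0 : ℝ)..t, (κ s)⁻¹ with hS
  have hSd : ∀ t, HasDerivAt S (κ t)⁻¹ t := fun t =>
    intervalIntegral.integral_hasDerivAt_right (hic.intervalIntegrable 0 t)
      (hic.stronglyMeasurableAtFilter _ _) hic.continuousAt
  have hmono : StrictMono S := strictMono_of_deriv_pos fun t => by
    rw [(hSd t).deriv]; exact inv_pos.2 (hpos t)
  have hcomp : ∀ {T : ℝ → ℝ}, (∀ τ, 0 ≤ τ → HasDerivWithinAt T (κ (T τ)) (Ici 0) τ) →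
      ∀ τ, 0 ≤ τ → HasDerivWithinAt (fun τ => S (T τ)) 1 (Ici 0) τ := by
    intro T hT τ hτ
    refine ((hSd (T τ)).comp_hasDerivWithinAt τ (hT τ hτ)).congr_deriv ?_
    exact inv_mul_cancel₀ (hpos _).ne'
  have ha := monotoneOn_Ici_of_hasDerivWithinAt (f' := fun _ => (0 : ℝ))
    (fun τ hτ => ((hcomp h1 τ hτ).sub (hcomp h2 τ hτ)).congr_deriv (by ring)) (fun _ _ => le_rfl)
    self_mem_Ici hτ hτ
  have hb := monotoneOn_Ici_of_hasDerivWithinAt (f' := fun _ => (0 : ℝ))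
    (fun τ hτ => ((hcomp h2 τ hτ).sub (hcomp h1 τ hτ)).congr_deriv (by ring)) (fun _ _ => le_rfl)
    self_mem_Ici hτ hτ
  simp only [Pi.sub_apply, h0, sub_self] at ha hb
  exact hmono.injective (by linarith)

/-- A solution of the boundary-layer problem read along its own time change `T`, with
`σ₀ φ' = j e^{-e T}`: the analogue of `LayerProfile` in the original variable, without smallness. -/
structure LayerTrajectory (ρr j ρj e : ℝ) (ρ p z T κ : ℝ → ℝ) : Prop where
  mem_ρ : ∀ τ, 0 ≤ τ → ρ τ ∈ Icc ρj ρr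
  mem_z : ∀ τ, 0 ≤ τ → z τ ∈ Icc (1 / ρr ^ 2) (1 / ρj ^ 2)
  rate : ∀ τ, 0 ≤ τ → κ τ = ρ τ ^ 2 * √(z τ)
  zero : T 0 = 0
  hasDeriv_T : ∀ τ, 0 ≤ τ → HasDerivWithinAt T (κ τ) (Ici 0) τ
  hasDeriv_z : ∀ τ, 0 ≤ τ → HasDerivWithinAt z (κ τ * (2 * e * (z τ - 1 / ρ τ ^ 2))) (Ici 0) τ
  hasDeriv_cube : ∀ τ, 0 ≤ τ → HasDerivWithinAt (fun s => ρ s ^ 3) (κ τ * p τ) (Ici 0) τ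
  hasDeriv_p : ∀ τ, 0 ≤ τ → HasDerivWithinAt p (κ τ *
    (-(layerDrift e (ρ τ) (z τ) * p τ + layerForce ρr (layerFlux j e (T τ)) (ρ τ) / z τ))) (Ici 0) τ
  p_zero : p 0 = 0

namespace LayerTrajectory
variable {a b g ρr j ρj k P δ e : ℝ} {r q y ρ p z T κ : ℝ → ℝ}

theorem rate_ge (h : LayerParams a b g ρr j ρj) (ht : LayerTrajectory ρr j ρj e ρ p z T κ)
    {τ : ℝ} (hτ : 0 ≤ τ) : a ^ 2 / b ≤ κ τ := by
  have ha := h.a_pos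
  have hb := h.b_pos
  have hz := h.Icc_inv_sq_subset (ht.mem_z τ hτ)
  have h1 : 1 / b ≤ √(z τ) := by
    refine Real.le_sqrt_of_sq_le ?_
    rw [div_pow, one_pow]; exact hz.1
  have h3 := h.a_le.trans (ht.mem_ρ τ hτ).1
  rw [ht.rate τ hτ]
  calc a ^ 2 / b = a ^ 2 * (1 / b) := by ring
    _ ≤ _ := by gcongr

theorem time_nonneg (h : LayerParams a b g ρr j ρj) (ht : LayerTrajectory ρr j ρj e ρ p z T κ)
    {τ : ℝ} (hτ : 0 ≤ τ) : 0 ≤ T τ := by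
  have ha := h.a_pos
  have hb := h.b_pos
  have := monotoneOn_Ici_of_hasDerivWithinAt ht.hasDeriv_T
    (fun x hx => le_trans (by positivity) (rate_ge h ht hx)) self_mem_Ici hτ hτ
  rwa [ht.zero] at this

theorem hasDeriv_comp (h : LayerParams a b g ρr j ρj) (ht : LayerTrajectory ρr j ρj e ρ p z T κ)
    {f : ℝ → ℝ} {d τ : ℝ} (hτ : 0 ≤ τ) (hf : HasDerivWithinAt f d (Ici 0) (T τ)) :
    HasDerivWithinAt (fun s => f (T s)) (κ τ * d) (Ici 0) τ :=
  (hf.comp τ (ht.hasDeriv_T τ hτ) fun _ hs => time_nonneg h ht hs).congr_deriv (mul_comm _ _)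

theorem abs_z_sub_le (h : LayerParams a b g ρr j ρj) (hc : LayerConsts a b g k P δ e)
    (ht : LayerTrajectory ρr j ρj e ρ p z T κ) (hp : LayerProfile ρr j ρj e P δ r q y) {S : ℝ}
    (hS : ∀ τ, 0 ≤ τ → |ρ τ ^ 3 - r (T τ) ^ 3| ≤ S) {τ : ℝ} (hτ : 0 ≤ τ) :
    |1 / ρ τ ^ 2 - 1 / r (T τ) ^ 2| ≤ invSqLip a * S ∧ |z τ - y (T τ)| ≤ invSqLip a * S := by
  have ha := h.a_pos
  have hb := h.b_pos
  have he := hc.e_pos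
  have hκ0 : 0 < a ^ 2 / b := by positivity
  have hL : 0 ≤ invSqLip a := by unfold invSqLip; positivity
  have hν : ∀ s, 0 ≤ s → |1 / ρ s ^ 2 - 1 / r (T s) ^ 2| ≤ invSqLip a * S := fun s hs =>
    (abs_inv_sq_sub_le ha (h.a_le.trans (ht.mem_ρ s hs).1)
      (h.a_le.trans (hp.mem_r _).1)).trans (mul_le_mul_of_nonneg_left (hS s hs) hL)
  have hw : ∀ s, 0 ≤ s → HasDerivWithinAt (fun s => z s - y (T s)) (κ s * (2 * e *
      ((z s - y (T s)) - (1 / ρ s ^ 2 - 1 / r (T s) ^ 2)))) (Ici 0) s := fun s hs =>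
    ((ht.hasDeriv_z s hs).sub (hasDeriv_comp h ht hs
      (hp.hasDerivAt_z (T s)).hasDerivWithinAt)).congr_deriv (by ring)
  have hw' : ∀ s, 0 ≤ s → HasDerivWithinAt (fun s => y (T s) - z s) (κ s * (2 * e *
      ((y (T s) - z s) - (1 / r (T s) ^ 2 - 1 / ρ s ^ 2)))) (Ici 0) s := fun s hs =>
    ((hasDeriv_comp h ht hs (hp.hasDerivAt_z (T s)).hasDerivWithinAt).sub
      (ht.hasDeriv_z s hs)).congr_deriv (by ring)
  have hz0 : 0 < 1 / ρr ^ 2 := by have := h.ρr_pos; positivity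
  refine ⟨hν τ hτ, abs_le.2 ⟨?_, ?_⟩⟩
  · have := le_of_unstable_ode (B := 1 / ρj ^ 2) (F := invSqLip a * S) he hκ0
      (fun s hs => rate_ge h ht hs) ht.hasDeriv_T hw'
      (fun s hs => by linarith [(hp.mem_z (T s)).2, (ht.mem_z s hs).1])
      (fun s hs => by linarith [(abs_le.1 (hν s hs)).1]) hτ
    linarith
  · exact le_of_unstable_ode (B := 1 / ρj ^ 2) (F := invSqLip a * S) he hκ0
      (fun s hs => rate_ge h ht hs) ht.hasDeriv_T hw
      (fun s hs => by linarith [(hp.mem_z (T s)).1, (ht.mem_z s hs).2])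
      (fun s hs => (abs_le.1 (hν s hs)).2) hτ

/-- The error terms in the equation for the difference of two solutions are a fraction of the
monotone term. -/
theorem abs_error_le (h : LayerParams a b g ρr j ρj) (hc : LayerConsts a b g k P δ e)
    (ht : LayerTrajectory ρr j ρj e ρ p z T κ) (hp : LayerProfile ρr j ρj e P δ r q y) {S : ℝ}
    (hS : ∀ τ, 0 ≤ τ → |ρ τ ^ 3 - r (T τ) ^ 3| ≤ S) {τ : ℝ} (hτ : 0 ≤ τ) :
    |(layerDrift e (ρ τ) (z τ) - layerDrift e (r (T τ)) (y (T τ))) * q (T τ) +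
      layerForce ρr (layerFlux j e (T τ)) (r (T τ)) * (1 / z τ - 1 / y (T τ))| ≤
      3 / 4 * (a ^ 2 * slopeLo b g) * S := by
  have ha := h.a_pos
  have hb := h.b_pos
  have he := hc.e_pos
  have hT := time_nonneg h ht hτ
  have hS0 : 0 ≤ S := (abs_nonneg _).trans (hS 0 le_rfl)
  have hL : 0 ≤ invSqLip a := by unfold invSqLip; positivity
  obtain ⟨hν, hz⟩ := abs_z_sub_le h hc ht hp hS hτ
  have hz1 := h.Icc_inv_sq_subset (ht.mem_z τ hτ)
  have hz2 := h.Icc_inv_sq_subset (hp.mem_z (T τ))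
  have e1 := abs_layerDrift_sub_le ha hb he.le (h.a_le.trans (hp.mem_r (T τ)).1)
    hz1.1 hz1.2 hz2.1 hz2.2 hν hz
  have e2 := abs_inv_sub_inv_le ha hb hz1.1 hz1.2 hz2.1 hz2.2 hz
  have t1 : |(layerDrift e (ρ τ) (z τ) - layerDrift e (r (T τ)) (y (T τ))) * q (T τ)| ≤
      e * ((b ^ 2 + b ^ 4 / a ^ 2) * (invSqLip a * S)) * P := by
    rw [abs_mul]; gcongr; exact hp.abs_p_le _ hT
  have t2 : |layerForce ρr (layerFlux j e (T τ)) (r (T τ)) * (1 / z τ - 1 / y (T τ))| ≤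
      δ * (b ^ 4 * (invSqLip a * S)) := by
    have := hc.δ_pos
    rw [abs_mul]; gcongr; exact hp.abs_force_le _ hT
  have c1 := mul_le_mul_of_nonneg_right hc.drift_small hS0
  have c2 := mul_le_mul_of_nonneg_right hc.δ_small hS0
  have c3 : 0 ≤ e * (4 * k * (b ^ 2 / a ^ 2)) * S := by have := hc.k_pos; positivity
  refine (abs_add_le _ _).trans ?_
  nlinarith

/-- If the cubes of the two densities differ by at most `S`, they differ by at most `3 S / 4`. -/
theorem abs_cube_sub_le (h : LayerParams a b g ρr j ρj) (hc : LayerConsts a b g k P δ e)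
    (ht : LayerTrajectory ρr j ρj e ρ p z T κ) (hp : LayerProfile ρr j ρj e P δ r q y) {S : ℝ}
    (hS : ∀ τ, 0 ≤ τ → |ρ τ ^ 3 - r (T τ) ^ 3| ≤ S) {τ : ℝ} (hτ : 0 ≤ τ) :
    |ρ τ ^ 3 - r (T τ) ^ 3| ≤ 3 / 4 * S := by
  have ha := h.a_pos
  have hb := h.b_pos
  have he := hc.e_pos
  have hκ0 : 0 < a ^ 2 / b := by positivity
  have hsl := h.slopeLo_pos
  have hS0 : 0 ≤ S := (abs_nonneg _).trans (hS 0 le_rfl)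
  have hm : 0 < a ^ 2 * slopeLo b g := by positivity
  have hd : ∀ s, 0 ≤ s → HasDerivWithinAt (fun s => ρ s ^ 3 - r (T s) ^ 3)
      (κ s * (p s - q (T s))) (Ici 0) s := fun s hs =>
    ((ht.hasDeriv_cube s hs).sub (hasDeriv_comp h ht hs
      (hp.hasDeriv_cube _ (time_nonneg h ht hs)))).congr_deriv (by ring)
  set G : ℝ → ℝ := fun s =>
    -(layerDrift e (ρ s) (z s) * p s + layerForce ρr (layerFlux j e (T s)) (ρ s) / z s) -
    -(layerDrift e (r (T s)) (y (T s)) * q (T s) +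
      layerForce ρr (layerFlux j e (T s)) (r (T s)) / y (T s)) with hG
  have hd' : ∀ s, 0 ≤ s → HasDerivWithinAt (fun s => p s - q (T s)) (κ s * G s) (Ici 0) s :=
    fun s hs => ((ht.hasDeriv_p s hs).sub (hasDeriv_comp h ht hs
      (hp.hasDeriv_p _ (time_nonneg h ht hs)))).congr_deriv (by simp only [hG]; ring)
  -- the equation for the difference, with the monotone term isolated
  have hpt : ∀ s, 0 ≤ s → ∀ ε, |p s - q (T s)| ≤ ε →
      |G s + (layerForce ρr (layerFlux j e (T s)) (ρ s) -
        layerForce ρr (layerFlux j e (T s)) (r (T s))) * (1 / z s)| ≤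
        1 / 2 * ε + 3 / 4 * (a ^ 2 * slopeLo b g) * S := by
    intro s hs ε hε
    have hz1 := h.Icc_inv_sq_subset (ht.mem_z s hs)
    have e0 := abs_error_le h hc ht hp hS hs
    have e1 : |layerDrift e (ρ s) (z s) * (p s - q (T s))| ≤ 1 / 2 * ε := by
      rw [abs_mul]; gcongr
      exact (abs_layerDrift_le ha hb he.le (h.a_le.trans (ht.mem_ρ s hs).1)
        ((ht.mem_ρ s hs).2.trans h.le_b) hz1.1 hz1.2).trans hc.drift_le
    rw [← abs_neg]
    refine le_trans (le_of_eq ?_) ((abs_add_le _ _).trans (add_le_add e1 e0))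
    congr 1
    simp only [hG]; ring
  have hW : ∀ s, 0 ≤ s → layerFlux j e (T s) ^ 2 ≤ j ^ 2 := fun s hs =>
    layerFlux_sq_le he.le (time_nonneg h ht hs)
  have h1z : ∀ s, 0 ≤ s → a ^ 2 ≤ 1 / z s := fun s hs =>
    (inv_mem_of_mem ha hb (h.Icc_inv_sq_subset (ht.mem_z s hs)).1
      (h.Icc_inv_sq_subset (ht.mem_z s hs)).2).2.1
  have hle : ∀ {x y : ℝ}, 0 < y → x ^ 3 ≤ y ^ 3 → x ≤ y := fun hy hxy =>
    le_of_pow_le_pow_left₀ (n := 3) (by norm_num) hy.le hxy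
  have hρ0 : ∀ s, 0 ≤ s → 0 < ρ s := fun s hs => h.ρj_pos.trans_le (ht.mem_ρ s hs).1
  rw [abs_le]
  constructor
  · by_contra! hlt
    have hε : 0 < a ^ 2 * slopeLo b g * (-(ρ τ ^ 3 - r (T τ) ^ 3) - 3 / 4 * S) / 2 :=
      half_pos (mul_pos hm (by linarith))
    obtain ⟨s, hs0, h1, h2, h3⟩ := exists_almost_max (B := S) (fun s hs =>
      (hd s hs).fun_neg.congr_deriv (by ring)) (p := fun s => -(p s - q (T s))) (fun s hs =>
      (hd' s hs).fun_neg.congr_deriv (by ring)) (g := fun s => -G s) ht.hasDeriv_T hκ0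
      (fun s hs => rate_ge h ht hs) (by simp [ht.p_zero, ht.zero, hp.p_zero])
      (fun s hs => by linarith [(abs_le.1 (hS s hs)).1]) hε hτ
    rw [abs_neg] at h2
    have h4 := (abs_le.1 (hpt s hs0 _ h2)).2
    have hr : ρ s ≤ r (T s) := hle (hp.pos h _) (by linarith)
    have hf := (h.force_sub_mem (hW s hs0) (ht.mem_ρ s hs0).1 hr (hp.mem_r _).2).1
    change slopeLo b g * _ ≤ _ at hf
    have h5 : a ^ 2 * (slopeLo b g * (r (T s) ^ 3 - ρ s ^ 3)) ≤
        (layerForce ρr (layerFlux j e (T s)) (ρ s) -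
        layerForce ρr (layerFlux j e (T s)) (r (T s))) * (1 / z s) := by
      rw [mul_comm]
      have : 0 ≤ slopeLo b g * (r (T s) ^ 3 - ρ s ^ 3) := mul_nonneg hsl.le (by linarith)
      exact mul_le_mul hf (h1z s hs0) (sq_nonneg a) (this.trans hf)
    have h6 : a ^ 2 * slopeLo b g * (-(ρ τ ^ 3 - r (T τ) ^ 3)) ≤
        a ^ 2 * slopeLo b g * (-(ρ s ^ 3 - r (T s) ^ 3)) := by gcongr
    nlinarith
  · by_contra! hlt
    have hε : 0 < a ^ 2 * slopeLo b g * ((ρ τ ^ 3 - r (T τ) ^ 3) - 3 / 4 * S) / 2 :=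
      half_pos (mul_pos hm (by linarith))
    obtain ⟨s, hs0, h1, h2, h3⟩ := exists_almost_max (B := S) hd hd' ht.hasDeriv_T hκ0
      (fun s hs => rate_ge h ht hs) (by simp [ht.p_zero, ht.zero, hp.p_zero])
      (fun s hs => (abs_le.1 (hS s hs)).2) hε hτ
    have h4 := (abs_le.1 (hpt s hs0 _ h2)).1
    have hr : r (T s) ≤ ρ s := hle (hρ0 s hs0) (by linarith)
    have hf := (h.force_sub_mem (hW s hs0) (hp.mem_r _).1 hr (ht.mem_ρ s hs0).2).1
    change slopeLo b g * _ ≤ _ at hf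
    have h5 : a ^ 2 * (slopeLo b g * (ρ s ^ 3 - r (T s) ^ 3)) ≤
        (layerForce ρr (layerFlux j e (T s)) (r (T s)) -
        layerForce ρr (layerFlux j e (T s)) (ρ s)) * (1 / z s) := by
      rw [mul_comm]
      have : 0 ≤ slopeLo b g * (ρ s ^ 3 - r (T s) ^ 3) := mul_nonneg hsl.le (by linarith)
      exact mul_le_mul hf (h1z s hs0) (sq_nonneg a) (this.trans hf)
    have h6 : a ^ 2 * slopeLo b g * (ρ τ ^ 3 - r (T τ) ^ 3) ≤
        a ^ 2 * slopeLo b g * (ρ s ^ 3 - r (T s) ^ 3) := by gcongr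
    nlinarith

theorem eq_profile (h : LayerParams a b g ρr j ρj) (hc : LayerConsts a b g k P δ e)
    (ht : LayerTrajectory ρr j ρj e ρ p z T κ) (hp : LayerProfile ρr j ρj e P δ r q y)
    {τ : ℝ} (hτ : 0 ≤ τ) : ρ τ = r (T τ) ∧ z τ = y (T τ) := by
  have hρ0 : ∀ s, 0 ≤ s → 0 < ρ s := fun s hs => h.ρj_pos.trans_le (ht.mem_ρ s hs).1
  have hiter : ∀ n : ℕ, ∀ s, 0 ≤ s → |ρ s ^ 3 - r (T s) ^ 3| ≤ (3 / 4) ^ n * ρr ^ 3 := by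
    intro n
    induction n with
    | zero =>
      intro s hs
      have h1 := pow_pos (hρ0 s hs) 3
      have h2 := pow_pos (hp.pos h (T s)) 3
      have h3 : ρ s ^ 3 ≤ ρr ^ 3 := by have := hρ0 s hs; have := (ht.mem_ρ s hs).2; gcongr
      have h4 : r (T s) ^ 3 ≤ ρr ^ 3 := by
        have := hp.pos h (T s); have := (hp.mem_r (T s)).2; gcongr
      rw [abs_le]; constructor <;> linarith
    | succ n ih =>
      intro s hs
      refine (abs_cube_sub_le h hc ht hp ih hs).trans (le_of_eq ?_)
      ring
  have hlim : Tendsto (fun n : ℕ => (3 / 4 : ℝ) ^ n * ρr ^ 3) atTop (𝓝 0) := by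
    simpa using (tendsto_pow_atTop_nhds_zero_of_lt_one (by norm_num : (0 : ℝ) ≤ 3 / 4)
      (by norm_num)).mul_const (ρr ^ 3)
  have hzero : ∀ s, 0 ≤ s → |ρ s ^ 3 - r (T s) ^ 3| ≤ 0 := fun s hs =>
    ge_of_tendsto' hlim fun n => hiter n s hs
  have hz := (abs_z_sub_le h hc ht hp hzero hτ).2
  rw [mul_zero] at hz
  refine ⟨?_, sub_eq_zero.1 (abs_nonpos_iff.1 hz)⟩
  exact (pow_left_inj₀ (hρ0 τ hτ).le (hp.pos h _).le (by norm_num)).1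
    (sub_eq_zero.1 (abs_nonpos_iff.1 (hzero τ hτ)))

theorem time_eq (h : LayerParams a b g ρr j ρj) (hc : LayerConsts a b g k P δ e)
    (ht : LayerTrajectory ρr j ρj e ρ p z T κ) (hp : LayerProfile ρr j ρj e P δ r q y)
    {T' : ℝ → ℝ} (hT' : IsTimeChange r y T') {τ : ℝ} (hτ : 0 ≤ τ) : T τ = T' τ := by
  have ha := h.a_pos
  have hb := h.b_pos
  refine timeChange_unique (κ := fun t => r t ^ 2 * √(y t))
    ((hp.continuous_r.pow 2).mul hp.continuous_z.sqrt)
    (fun t => lt_of_lt_of_le (by positivity) (hp.rate_bounds h t).1)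
    (fun s hs => ?_) (fun s _ => (hT'.hasDerivAt s).hasDerivWithinAt)
    (by rw [ht.zero, hT'.zero]) hτ
  obtain ⟨h1, h2⟩ := eq_profile h hc ht hp hs
  rw [← h1, ← h2, ← ht.rate s hs]
  exact ht.hasDeriv_T s hs

end LayerTrajectory

/-! ### Admissible solutions are trajectories -/

/-- The equations of an admissible solution as first-order derivatives on `[0, ∞)`, with `ρ₁ = ρ'`
and `φ₁ = φ'`. -/
structure FirstOrderSolution (ρr j ρj e : ℝ) (ρ ρ₁ φ φ₁ : ℝ → ℝ) : Prop where
  hasDeriv_ρ : ∀ τ, 0 ≤ τ → HasDerivWithinAt ρ (ρ₁ τ) (Ici 0) τ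
  hasDeriv_ρ₁ : ∀ τ, 0 ≤ τ → HasDerivWithinAt ρ₁
    (-((ρr ^ 2 - (φ₁ τ / e ^ 2 - j) ^ 2 / ρ τ ^ 4 - ρ τ ^ 2) * ρ τ)) (Ici 0) τ
  hasDeriv_φ : ∀ τ, 0 ≤ τ → HasDerivWithinAt φ (φ₁ τ) (Ici 0) τ
  hasDeriv_φ₁ : ∀ τ, 0 ≤ τ → HasDerivWithinAt φ₁ (e ^ 2 * (ρ τ ^ 2 * φ τ)) (Ici 0) τ
  ρ₁_zero : ρ₁ 0 = 0
  φ₁_zero : φ₁ 0 = e ^ 2 * j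
  le_ρ : ∀ τ, 0 ≤ τ → ρj ≤ ρ τ
  memLp_ρ : MemLp (fun τ => ρ τ - ρj) 2 (volume.restrict (Ioi 0))
  memLp_φ : MemLp φ 2 (volume.restrict (Ioi 0))

theorem IsAdmissibleSolution.firstOrder {ρr j ρj σ₀ e : ℝ} {ρ φ : ℝ → ℝ} (hρj : 0 < ρj)
    (he : 0 < e) (hσ : σ₀ * e ^ 2 = 1) (hs : IsAdmissibleSolution ρr j ρj σ₀ ρ φ) :
    FirstOrderSolution ρr j ρj e ρ (halfDeriv ρ) φ (halfDeriv φ) := by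
  obtain ⟨a1, a2, a3⟩ := hasDerivWithinAt_of_contDiffOn_two hs.sol.contDiffOn_ρ
  obtain ⟨b1, b2, b3⟩ := hasDerivWithinAt_of_contDiffOn_two hs.sol.contDiffOn_φ
  have cρ : ContinuousOn ρ (Ici 0) := fun x hx => (a1 x hx).continuousWithinAt
  have cφ : ContinuousOn φ (Ici 0) := fun x hx => (b1 x hx).continuousWithinAt
  have cφ₁ : ContinuousOn (halfDeriv φ) (Ici 0) := fun x hx => (b2 x hx).continuousWithinAt
  have hσ' : σ₀ = 1 / e ^ 2 := by field_simp; exact hσ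
  have hρ4 : ∀ x ∈ Ici (0 : ℝ), ρ x ^ 4 ≠ 0 := fun x hx =>
    (pow_pos (hρj.trans_le (hs.le_ρ x hx)) 4).ne'
  refine ⟨a1, fun τ hτ => (a2 τ hτ).congr_deriv ?_, b1, fun τ hτ => (b2 τ hτ).congr_deriv ?_,
    hs.sol.deriv_ρ_zero, ?_, hs.le_ρ, hs.memH1_ρ.1, hs.memH1_φ.1⟩
  · refine eq_on_Ici_of_eq_on_Ioi (g := fun τ =>
      -((ρr ^ 2 - (halfDeriv φ τ / e ^ 2 - j) ^ 2 / ρ τ ^ 4 - ρ τ ^ 2) * ρ τ)) a3 ?_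
      (fun t ht => ?_) hτ
    · exact (((continuousOn_const.sub ((((cφ₁.div_const _).sub continuousOn_const).pow 2).div
        (cρ.pow 4) hρ4)).sub (cρ.pow 2)).mul cρ).neg
    · have := hs.sol.eq_ρ t ht
      have e1 : σ₀ * halfDeriv φ t = halfDeriv φ t / e ^ 2 := by rw [hσ']; ring
      rw [e1] at this
      linarith
  · refine eq_on_Ici_of_eq_on_Ioi (g := fun τ => e ^ 2 * (ρ τ ^ 2 * φ τ)) b3 ?_
      (fun t ht => ?_) hτ
    · exact continuousOn_const.mul ((cρ.pow 2).mul cφ)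
    · have := hs.sol.eq_φ t ht
      linear_combination (-(halfDeriv (halfDeriv φ) t)) * hσ - e ^ 2 * this
  · rw [hs.sol.deriv_φ_zero, hσ']; field_simp

namespace FirstOrderSolution
variable {a b g ρr j ρj e : ℝ} {ρ ρ₁ φ φ₁ : ℝ → ℝ}

theorem ρ_pos (h : LayerParams a b g ρr j ρj) (hs : FirstOrderSolution ρr j ρj e ρ ρ₁ φ φ₁) {τ : ℝ}
    (hτ : 0 ≤ τ) : 0 < ρ τ := h.ρj_pos.trans_le (hs.le_ρ τ hτ)

/-- The upper bound `ρ ≤ ρr`: the excess `max (ρ - ρr) 0` is nondecreasing, by convexity and the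
Neumann condition, so it vanishes by integrability. -/
theorem ρ_le (h : LayerParams a b g ρr j ρj) (hs : FirstOrderSolution ρr j ρj e ρ ρ₁ φ φ₁) {τ : ℝ}
    (hτ : 0 ≤ τ) : ρ τ ≤ ρr := by
  by_contra! hlt
  set q : ℝ → ℝ := fun s => max (ρ s - ρr) 0 with hq
  have hq0 : ∀ s, 0 ≤ q s := fun s => le_max_right _ _
  have hqd : ∀ s, 0 ≤ s → HasDerivWithinAt (fun s => q s ^ 2) (2 * q s * ρ₁ s) (Ici 0) s :=
    fun s h0 => (hasDerivAt_max_zero_sq _).comp_hasDerivWithinAt s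
      ((hs.hasDeriv_ρ s h0).sub_const ρr)
  have hmono1 := monotoneOn_Ici_of_hasDerivWithinAt (f := fun s => q s ^ 2 * ρ₁ s)
    (fun s h0 => (hqd s h0).mul (hs.hasDeriv_ρ₁ s h0)) (fun s h0 => by
      have e1 : 2 * q s * ρ₁ s * ρ₁ s = 2 * q s * ρ₁ s ^ 2 := by ring
      have h1 : 0 ≤ 2 * q s * ρ₁ s ^ 2 := by have := hq0 s; positivity
      rw [e1]
      rcases le_total (ρ s) ρr with h2 | h2
      · have : q s = 0 := max_eq_right (by linarith)
        simp [this]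
      · have h3 := ρ_pos h hs h0
        have h4 : 0 ≤ (φ₁ s / e ^ 2 - j) ^ 2 / ρ s ^ 4 := by positivity
        have h5 : 0 ≤ ρ s ^ 2 - ρr ^ 2 := by nlinarith [h.ρr_pos]
        have h6 : 0 ≤ -((ρr ^ 2 - (φ₁ s / e ^ 2 - j) ^ 2 / ρ s ^ 4 - ρ s ^ 2) * ρ s) := by
          rw [← neg_mul]; exact mul_nonneg (by linarith) h3.le
        exact add_nonneg h1 (mul_nonneg (sq_nonneg _) h6))
  have hnn : ∀ s, 0 ≤ s → 0 ≤ q s * ρ₁ s := by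
    intro s h0
    have := hmono1 self_mem_Ici h0 h0
    simp only [hs.ρ₁_zero, mul_zero] at this
    rcases (hq0 s).eq_or_lt with h1 | h1
    · rw [← h1]; simp
    · have h2 : 0 ≤ ρ₁ s := by
        by_contra! h3
        exact absurd this (not_le.2 (mul_neg_of_pos_of_neg (by positivity) h3))
      positivity
  have hmono2 := monotoneOn_Ici_of_hasDerivWithinAt hqd (fun s h0 => by
    have := hnn s h0; linarith)
  have hpos : 0 < q τ := lt_max_of_lt_left (by linarith)
  refine not_memLp_two_of_le (pow_pos hpos 2) hτ (fun s hs' => ?_) hs.memLp_ρ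
  have h1 := hmono2 hτ (hτ.trans hs' : 0 ≤ s) hs'
  refine le_trans h1 ?_
  have h2 : q s ≤ ρ s - ρj :=
    max_le (by linarith [h.le]) (by linarith [hs.le_ρ s (hτ.trans hs')])
  exact pow_le_pow_left₀ (hq0 s) h2 2

theorem hasDeriv_prod (hs : FirstOrderSolution ρr j ρj e ρ ρ₁ φ φ₁) {τ : ℝ} (hτ : 0 ≤ τ) :
    HasDerivWithinAt (fun s => φ s * φ₁ s) (φ₁ τ ^ 2 + e ^ 2 * ρ τ ^ 2 * φ τ ^ 2) (Ici 0) τ :=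
  ((hs.hasDeriv_φ τ hτ).mul (hs.hasDeriv_φ₁ τ hτ)).congr_deriv (by ring)

theorem prod_mono (hs : FirstOrderSolution ρr j ρj e ρ ρ₁ φ φ₁) :
    MonotoneOn (fun s => φ s * φ₁ s) (Ici 0) :=
  monotoneOn_Ici_of_hasDerivWithinAt (fun _ h0 => hs.hasDeriv_prod h0) (fun _ _ => by positivity)

theorem hasDeriv_sq (hs : FirstOrderSolution ρr j ρj e ρ ρ₁ φ φ₁) {τ : ℝ} (hτ : 0 ≤ τ) :
    HasDerivWithinAt (fun s => φ s ^ 2) (2 * (φ τ * φ₁ τ)) (Ici 0) τ :=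
  ((hs.hasDeriv_φ τ hτ).pow 2).congr_deriv (by push_cast; ring)

/-- `φ²` is convex and integrable, hence nonincreasing. -/
theorem prod_nonpos (hs : FirstOrderSolution ρr j ρj e ρ ρ₁ φ φ₁) {τ : ℝ} (hτ : 0 ≤ τ) :
    φ τ * φ₁ τ ≤ 0 := by
  by_contra! hlt
  have hsub : Ici τ ⊆ Ici (0 : ℝ) := Ici_subset_Ici.2 hτ
  have hm := monotoneOn_Ici_of_hasDerivWithinAt (x₀ := τ)
    (fun s h0 => (hs.hasDeriv_sq (hτ.trans h0)).mono hsub)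
    (fun s h0 => by
      have := hs.prod_mono hτ (hτ.trans h0) h0
      simp only at this
      linarith)
  have hφ : φ τ ≠ 0 := by rintro h0; simp [h0] at hlt
  exact not_memLp_two_of_le (by positivity : 0 < φ τ ^ 2) hτ
    (fun s hs' => hm self_mem_Ici hs' hs') hs.memLp_φ

theorem eq_zero_of_prod_eq_zero (h : LayerParams a b g ρr j ρj) (he : 0 < e)
    (hs : FirstOrderSolution ρr j ρj e ρ ρ₁ φ φ₁) {τ : ℝ} (hτ : 0 ≤ τ) (h0 : φ τ * φ₁ τ = 0) :
    φ τ = 0 ∧ φ₁ τ = 0 := by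
  have hd := (hs.hasDeriv_prod hτ).mono_Ici hτ
  have h1 := hd.nonpos_of_right_max (fun s hs' => by
    rw [h0]; exact hs.prod_nonpos (hτ.trans hs'))
  have hρ := ρ_pos h hs hτ
  have h2 : 0 ≤ e ^ 2 * ρ τ ^ 2 * φ τ ^ 2 := by positivity
  have h3 : φ₁ τ ^ 2 = 0 := le_antisymm (by linarith) (sq_nonneg _)
  have h4 : e ^ 2 * ρ τ ^ 2 * φ τ ^ 2 = 0 := by linarith [sq_nonneg (φ₁ τ)]
  have h5 : e ^ 2 * ρ τ ^ 2 ≠ 0 := by positivity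
  exact ⟨pow_eq_zero_iff two_ne_zero |>.1 ((mul_eq_zero.1 h4).resolve_left h5),
    pow_eq_zero_iff two_ne_zero |>.1 h3⟩

/-- If `φ` and `φ'` vanish at one point, they vanish at `0` by a Gronwall argument for
`φ² + φ'²`; this is excluded for `j ≠ 0`. -/
theorem prod_neg (h : LayerParams a b g ρr j ρj) (he : 0 < e) (hj : j ≠ 0)
    (hs : FirstOrderSolution ρr j ρj e ρ ρ₁ φ φ₁) {τ : ℝ} (hτ : 0 ≤ τ) : φ τ * φ₁ τ < 0 := by
  refine lt_of_le_of_ne (hs.prod_nonpos hτ) fun h0 => ?_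
  obtain ⟨h1, h2⟩ := eq_zero_of_prod_eq_zero h he hs hτ h0
  set c := 1 + e ^ 2 * b ^ 2 with hc
  have hm := monotoneOn_Ici_of_hasDerivWithinAt (x₀ := 0)
    (f := fun s => (φ s ^ 2 + φ₁ s ^ 2) * Real.exp (c * s))
    (f' := fun s => (2 * (φ s * φ₁ s) + 2 * φ₁ s * (e ^ 2 * (ρ s ^ 2 * φ s)) +
      c * (φ s ^ 2 + φ₁ s ^ 2)) * Real.exp (c * s))
    (fun s h0 => (((hs.hasDeriv_sq h0).add ((hs.hasDeriv_φ₁ s h0).pow 2)).mul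
      (((hasDerivWithinAt_id s _).const_mul c).exp)).congr_deriv (by
        simp only [Pi.add_apply, Pi.pow_apply, id]; push_cast; ring))
    (fun s h0 => by
      refine mul_nonneg ?_ (Real.exp_pos _).le
      have h3 := ρ_pos h hs h0
      have h4 : ρ s ^ 2 ≤ b ^ 2 := by have := (ρ_le h hs h0).trans h.le_b; gcongr
      have h5 : 0 ≤ (φ s + φ₁ s) ^ 2 * (1 + e ^ 2 * ρ s ^ 2) := by positivity
      have h6 : e ^ 2 * ρ s ^ 2 * (φ s ^ 2 + φ₁ s ^ 2) ≤ e ^ 2 * b ^ 2 * (φ s ^ 2 + φ₁ s ^ 2) := by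
        gcongr
      rw [hc]
      nlinarith)
  have h3 := hm self_mem_Ici hτ hτ
  simp only [h1, h2, hs.φ₁_zero] at h3
  simp at h3
  have : 0 < (e ^ 2 * j) ^ 2 := by positivity
  nlinarith [sq_nonneg (φ 0)]

theorem ratio_pos (h : LayerParams a b g ρr j ρj) (he : 0 < e) (hj : j ≠ 0)
    (hs : FirstOrderSolution ρr j ρj e ρ ρ₁ φ φ₁) {τ : ℝ} (hτ : 0 ≤ τ) :
    0 < φ₁ τ / (e ^ 2 * j) := by
  by_contra! hle
  have hc : ContinuousOn (fun s => φ₁ s / (e ^ 2 * j)) (Icc 0 τ) := fun x hx =>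
    ((hs.hasDeriv_φ₁ x hx.1).continuousWithinAt.mono Icc_subset_Ici_self).div_const _
  have h1 : φ₁ 0 / (e ^ 2 * j) = 1 := by
    rw [hs.φ₁_zero]; exact div_self (by positivity)
  obtain ⟨s, hs', h2⟩ := intermediate_value_Icc' hτ hc ⟨hle, by rw [h1]; exact zero_le_one⟩
  have h3 := prod_neg h he hj hs hs'.1
  simp only [div_eq_zero_iff] at h2
  rcases h2 with h2 | h2
  · simp [h2] at h3
  · exact absurd h2 (by positivity)

theorem sq_deriv_ge (h : LayerParams a b g ρr j ρj) (he : 0 < e)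
    (hs : FirstOrderSolution ρr j ρj e ρ ρ₁ φ φ₁) {τ : ℝ} (hτ : 0 ≤ τ) :
    e ^ 2 * ρj ^ 2 * φ τ ^ 2 ≤ φ₁ τ ^ 2 := by
  by_contra! hlt
  have hρj := h.ρj_pos
  have hm := monotoneOn_Ici_of_hasDerivWithinAt (x₀ := 0)
    (f := fun s => e ^ 2 * ρj ^ 2 * φ s ^ 2 - φ₁ s ^ 2)
    (f' := fun s => 2 * e ^ 2 * (-(φ s * φ₁ s)) * (ρ s ^ 2 - ρj ^ 2))
    (fun s h0 => (((hs.hasDeriv_sq h0).const_mul (e ^ 2 * ρj ^ 2)).sub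
      ((hs.hasDeriv_φ₁ s h0).pow 2)).congr_deriv (by push_cast; ring))
    (fun s h0 => by
      have h1 := hs.prod_nonpos h0
      have h2 := hs.le_ρ s h0
      have h3 : 0 ≤ ρ s ^ 2 - ρj ^ 2 := by nlinarith
      have h4 : 0 ≤ -(φ s * φ₁ s) := by linarith
      positivity)
  refine not_memLp_two_of_le (c := (e ^ 2 * ρj ^ 2 * φ τ ^ 2 - φ₁ τ ^ 2) / (e ^ 2 * ρj ^ 2))
    (div_pos (by linarith) (by positivity)) hτ (fun s hs' => ?_) hs.memLp_φ
  have h1 := hm hτ (hτ.trans hs' : 0 ≤ s) hs'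
  simp only at h1
  rw [div_le_iff₀ (by positivity)]
  nlinarith [sq_nonneg (φ₁ s)]

theorem sq_deriv_le (h : LayerParams a b g ρr j ρj)
    (hs : FirstOrderSolution ρr j ρj e ρ ρ₁ φ φ₁) {τ : ℝ} (hτ : 0 ≤ τ) :
    φ₁ τ ^ 2 ≤ e ^ 2 * ρr ^ 2 * φ τ ^ 2 := by
  by_contra! hlt
  have hm := monotoneOn_Ici_of_hasDerivWithinAt (x₀ := 0)
    (f := fun s => φ₁ s ^ 2 - e ^ 2 * ρr ^ 2 * φ s ^ 2)
    (f' := fun s => 2 * e ^ 2 * (-(φ s * φ₁ s)) * (ρr ^ 2 - ρ s ^ 2))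
    (fun s h0 => (((hs.hasDeriv_φ₁ s h0).pow 2).sub
      ((hs.hasDeriv_sq h0).const_mul (e ^ 2 * ρr ^ 2))).congr_deriv (by push_cast; ring))
    (fun s h0 => by
      have h1 := hs.prod_nonpos h0
      have h2 := ρ_le h hs h0
      have h3 : 0 ≤ ρr ^ 2 - ρ s ^ 2 := by nlinarith [ρ_pos h hs h0]
      have h4 : 0 ≤ -(φ s * φ₁ s) := by linarith
      positivity)
  set c := φ₁ τ ^ 2 - e ^ 2 * ρr ^ 2 * φ τ ^ 2 with hc
  have hc0 : 0 < c := by linarith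
  have hsub : Ici τ ⊆ Ici (0 : ℝ) := Ici_subset_Ici.2 hτ
  -- `(φ φ')' ≥ φ'² ≥ c` makes `φ φ'` positive eventually
  have hm2 := monotoneOn_Ici_of_hasDerivWithinAt (x₀ := τ)
    (f := fun s => φ s * φ₁ s - c * s)
    (f' := fun s => φ₁ s ^ 2 + e ^ 2 * ρ s ^ 2 * φ s ^ 2 - c)
    (fun s h0 => (((hs.hasDeriv_prod (hτ.trans h0)).mono hsub).sub
      ((hasDerivWithinAt_id s _).const_mul c)).congr_deriv (by ring))
    (fun s h0 => by
      have h1 := hm hτ (hτ.trans h0 : 0 ≤ s) h0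
      simp only at h1
      have h2 : 0 ≤ e ^ 2 * ρr ^ 2 * φ s ^ 2 := by positivity
      have h3 : 0 ≤ e ^ 2 * ρ s ^ 2 * φ s ^ 2 := by positivity
      linarith)
  set R := τ + (1 - φ τ * φ₁ τ) / c with hR
  have hq : 0 ≤ (1 - φ τ * φ₁ τ) / c := div_nonneg (by linarith [hs.prod_nonpos hτ]) hc0.le
  have hτR : τ ≤ R := by linarith
  have h1 := hm2 self_mem_Ici hτR hτR
  have h2 := hs.prod_nonpos (hτ.trans hτR)
  simp only at h1
  have h3 : c * R = c * τ + (1 - φ τ * φ₁ τ) := by rw [hR]; field_simp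
  linarith

/-- The time `T` in which `σ₀ φ' = j e^{-e T}` turns an admissible solution with `j ≠ 0` into a
trajectory. -/
theorem layerTrajectory (h : LayerParams a b g ρr j ρj) (he : 0 < e) (hj : j ≠ 0)
    (hs : FirstOrderSolution ρr j ρj e ρ ρ₁ φ φ₁) :
    LayerTrajectory ρr j ρj e ρ (fun τ => -(3 / e) * (ρ₁ τ * φ₁ τ / φ τ))
      (fun τ => e ^ 2 * φ τ ^ 2 / φ₁ τ ^ 2) (fun τ => -(1 / e) * Real.log (φ₁ τ / (e ^ 2 * j)))
      (fun τ => ρ τ ^ 2 * (-(e * φ τ / φ₁ τ))) := by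
  have hφ : ∀ τ, 0 ≤ τ → φ τ ≠ 0 := fun τ hτ h0 => by
    have := prod_neg h he hj hs hτ; simp [h0] at this
  have hφ₁ : ∀ τ, 0 ≤ τ → φ₁ τ ≠ 0 := fun τ hτ h0 => by
    have := prod_neg h he hj hs hτ; simp [h0] at this
  have hflux : ∀ τ, 0 ≤ τ → layerFlux j e (-(1 / e) * Real.log (φ₁ τ / (e ^ 2 * j))) =
      φ₁ τ / e ^ 2 - j := by
    intro τ hτ
    have e1 : -(e * (-(1 / e) * Real.log (φ₁ τ / (e ^ 2 * j)))) =
        Real.log (φ₁ τ / (e ^ 2 * j)) := by field_simp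
    rw [layerFlux, e1, Real.exp_log (ratio_pos h he hj hs hτ)]
    field_simp
  refine ⟨fun τ hτ => ⟨hs.le_ρ τ hτ, ρ_le h hs hτ⟩, fun τ hτ => ?_, fun τ hτ => ?_, ?_,
    fun τ hτ => ?_, fun τ hτ => ?_, fun τ hτ => ?_, fun τ hτ => ?_, ?_⟩
  · have h1 := sq_deriv_ge h he hs hτ
    have h2 := sq_deriv_le h hs hτ
    have h3 : 0 < φ₁ τ ^ 2 := by have := hφ₁ τ hτ; positivity
    have h4 := h.ρj_pos
    have h5 := h.ρr_pos
    constructor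
    · rw [div_le_div_iff₀ (by positivity) h3]; linarith
    · rw [div_le_div_iff₀ h3 (by positivity)]; linarith
  · have h1 : e ^ 2 * φ τ ^ 2 / φ₁ τ ^ 2 = (-(e * φ τ / φ₁ τ)) ^ 2 := by ring
    have h2 : 0 ≤ -(e * φ τ / φ₁ τ) := by
      have h3 := prod_neg h he hj hs hτ
      have h4 : -(e * φ τ / φ₁ τ) = e * (-(φ τ * φ₁ τ)) / φ₁ τ ^ 2 := by
        have := hφ₁ τ hτ; field_simp
      rw [h4]
      have : 0 ≤ -(φ τ * φ₁ τ) := by linarith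
      positivity
    rw [h1, Real.sqrt_sq h2]
  · rw [hs.φ₁_zero, div_self (by positivity)]; simp
  · have h1 := hφ₁ τ hτ
    refine ((((hs.hasDeriv_φ₁ τ hτ).div_const (e ^ 2 * j)).log
      (ratio_pos h he hj hs hτ).ne').const_mul (-(1 / e))).congr_deriv ?_
    field_simp
  · have h1 := hφ₁ τ hτ
    have h2 := ρ_pos h hs hτ
    refine (((hs.hasDeriv_sq hτ).const_mul (e ^ 2)).div ((hs.hasDeriv_φ₁ τ hτ).pow 2)
      (pow_ne_zero 2 h1)).congr_deriv ?_
    simp only [Pi.pow_apply]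
    push_cast
    field_simp
    ring
  · have h1 := hφ₁ τ hτ
    have h2 := hφ τ hτ
    refine ((hs.hasDeriv_ρ τ hτ).pow 3).congr_deriv ?_
    push_cast
    field_simp
  · have h1 := hφ₁ τ hτ
    have h2 := hφ τ hτ
    have h3 := ρ_pos h hs hτ
    refine ((((hs.hasDeriv_ρ₁ τ hτ).mul (hs.hasDeriv_φ₁ τ hτ)).div (hs.hasDeriv_φ τ hτ)
      h2).const_mul (-(3 / e))).congr_deriv ?_
    rw [hflux τ hτ, layerForce, layerDrift]
    simp only [Pi.mul_apply]
    field_simp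
    ring
  · simp [hs.ρ₁_zero]

/-- For `j = 0` the only admissible solution is the constant one. -/
theorem eq_const_of_flux_zero (h : LayerParams a b g ρr j ρj) (he : 0 < e) (hj : j = 0)
    (hs : FirstOrderSolution ρr j ρj e ρ ρ₁ φ φ₁) {τ : ℝ} (hτ : 0 ≤ τ) :
    ρ τ = ρr ∧ φ τ = 0 := by
  have h1 : 0 ≤ φ τ * φ₁ τ := by
    have := hs.prod_mono self_mem_Ici hτ hτ
    simpa [hs.φ₁_zero, hj] using this
  refine ⟨le_antisymm (ρ_le h hs hτ) ?_,
    (eq_zero_of_prod_eq_zero h he hs hτ (le_antisymm (hs.prod_nonpos hτ) h1)).1⟩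
  have hf := h.flux
  have hρj := h.ρj_pos
  rw [hj, zero_pow two_ne_zero, zero_eq_mul] at hf
  have h2 : ρr ^ 2 = ρj ^ 2 := by
    rcases hf with hf | hf
    · exact absurd hf (by positivity)
    · linarith
  have h3 : ρr = ρj := (pow_left_inj₀ h.ρr_pos.le hρj.le two_ne_zero).1 h2
  rw [h3]; exact hs.le_ρ τ hτ

end FirstOrderSolution

/-- Every admissible solution coincides with the one obtained from a profile. -/
theorem IsAdmissibleSolution.eq_profile {a b g ρr j ρj k P δ e σ₀ : ℝ} {r q y T ρ φ : ℝ → ℝ}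
    (h : LayerParams a b g ρr j ρj) (hc : LayerConsts a b g k P δ e)
    (hp : LayerProfile ρr j ρj e P δ r q y) (hT : IsTimeChange r y T) (hσ : σ₀ * e ^ 2 = 1)
    (hs : IsAdmissibleSolution ρr j ρj σ₀ ρ φ) :
    EqOn ρ (fun τ => r (T τ)) (Ici 0) ∧ EqOn φ (profilePotential j e y T) (Ici 0) := by
  have he := hc.e_pos
  have h1 := hs.firstOrder h.ρj_pos he hσ
  by_cases hj : j = 0
  · have h2 := (hp.isAdmissibleSolution h hc hT hσ).firstOrder h.ρj_pos he hσ
    refine ⟨fun τ hτ => ?_, fun τ hτ => ?_⟩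
    · rw [(h1.eq_const_of_flux_zero h he hj hτ).1, ← (h2.eq_const_of_flux_zero h he hj hτ).1]
    · rw [(h1.eq_const_of_flux_zero h he hj hτ).2, (h2.eq_const_of_flux_zero h he hj hτ).2]
  · have ht := h1.layerTrajectory h he hj
    refine ⟨fun τ hτ => ?_, fun τ hτ => ?_⟩
    · have e1 := (ht.eq_profile h hc hp hτ).1
      have e2 := ht.time_eq h hc hp hT hτ
      rw [e1, e2]
    · have e1 := (ht.eq_profile h hc hp hτ).2
      have e2 := ht.time_eq h hc hp hT hτ
      have e3 := ht.rate τ hτ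
      have hρ := h1.ρ_pos h hτ
      have e4 : -(e * φ τ / halfDeriv φ τ) = √(y (T τ)) := by
        have e5 := mul_left_cancel₀ (pow_ne_zero 2 hρ.ne') e3
        rw [e5, e1, e2]
      have e6 : halfDeriv φ τ = e ^ 2 * (j * Real.exp (-(e * T τ))) := by
        have e7 : -(e * T τ) = Real.log (halfDeriv φ τ / (e ^ 2 * j)) := by
          rw [← e2]; field_simp
        rw [e7, Real.exp_log (h1.ratio_pos h he hj hτ)]; field_simp
      have e8 : halfDeriv φ τ ≠ 0 := by rw [e6]; positivity
      rw [profilePotential, ← e4]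
      rw [e6] at e8 ⊢
      field_simp

/-! ### Uniform constants and conclusion -/

theorem decayTotal_pos {a b g : ℝ} (ha : 0 < a) (hb : 0 < b) (hg : 0 < g) :
    0 < decayTotal a b g := by
  unfold decayTotal decaySlope decayForce decayCube slopeHi slopeLo
  positivity

theorem eventually_le_of_continuous {f : ℝ → ℝ} {c : ℝ} (hf : Continuous f) (h0 : f 0 < c) :
    ∀ᶠ e in 𝓝[>] (0 : ℝ), f e ≤ c := by
  have := ((hf.tendsto 0).eventually_lt_const h0).filter_mono
    (nhdsWithin_le_nhds (s := Ioi 0))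
  exact this.mono fun _ h => le_of_lt h

/-- The constants can be chosen uniformly for all small `e`. -/
theorem exists_layerConsts {a b g : ℝ} (ha : 0 < a) (hb : 0 < b) (hg : 0 < g) :
    ∃ k P δ e₀ : ℝ, 0 < e₀ ∧ ∀ e, 0 < e → e < e₀ → LayerConsts a b g k P δ e := by
  have hlo : 0 < slopeLo b g := by unfold slopeLo; positivity
  have hhi : 0 < slopeHi a b := by unfold slopeHi; positivity
  have hL : 0 < invSqLip a := by unfold invSqLip; positivity
  have hF : 0 < forceBound a b := by unfold forceBound; positivity
  set k := b ^ 2 * slopeHi a b + a ^ 2 * slopeLo b g + 1 with hk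
  have hX : 0 < b ^ 2 * slopeHi a b := by positivity
  have hY : 0 < a ^ 2 * slopeLo b g := by positivity
  have hk1 : 1 ≤ k := by linarith
  have hk0 : 0 < k := by linarith
  have hkk : k ≤ k ^ 2 := by nlinarith
  set P := 2 * (k ^ 2 * b ^ 3 + 1 + b ^ 2 * forceBound a b) / k with hP
  have hP0 : 0 < P := by positivity
  set δ := a ^ 2 * slopeLo b g / 2 / (b ^ 4 * invSqLip a) with hδ
  have hδ0 : 0 < δ := by positivity
  have hev : ∀ᶠ e in 𝓝[>] (0 : ℝ), LayerConsts a b g k P δ e := by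
    filter_upwards [self_mem_nhdsWithin,
      eventually_le_of_continuous (f := fun e => e) (c := 1) continuous_id (by norm_num),
      eventually_le_of_continuous (f := fun e => e * (4 * k * (b ^ 2 / a ^ 2) +
        P * ((b ^ 2 + b ^ 4 / a ^ 2) * invSqLip a))) (c := a ^ 2 * slopeLo b g / 4)
        (by fun_prop) (by simpa using hY),
      eventually_le_of_continuous (f := fun e => e * (b ^ 2 / a ^ 2) * P) (c := 1)
        (by fun_prop) (by simp),
      eventually_le_of_continuous (f := fun e => e * (b ^ 2 / a ^ 2)) (c := 1 / 2)
        (by fun_prop) (by simp),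
      eventually_le_of_continuous (f := fun e =>
        √e * ((2 + 2 * √(b ^ 3)) / a ^ 2 + 6 * b ^ 6 * √(b ^ 3) / a ^ 5)) (c := δ)
        (by fun_prop) (by simpa using hδ0),
      eventually_le_of_continuous (f := fun e => e * (1 + b ^ 2 / a ^ 2))
        (c := a ^ 2 * slopeLo b g / 2) (by fun_prop) (by simpa using hY)]
      with e h0 h1 h2 h3 h4 h5 h6
    exact ⟨hk0, hP0, hδ0, h0, h1, by linarith, by linarith, h2,
      by rw [hδ]; exact (div_mul_cancel₀ _ (by positivity)).le, le_rfl, h3, h4, h5, h6⟩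
  obtain ⟨e₀, he₀, hsub⟩ := mem_nhdsGT_iff_exists_Ioo_subset.1 hev
  exact ⟨k, P, δ, e₀, he₀, fun e h1 h2 => hsub ⟨h1, h2⟩⟩

/-- Beyond the double-root value `2 ρr² / 3` of the square, a root of the limit equation is the
largest one. -/
theorem isGreatest_limitDensities {ρr j ρj : ℝ} (hρj : 0 < ρj)
    (hgap : 2 * ρr ^ 2 < 3 * ρj ^ 2) (hj : j ^ 2 = ρj ^ 4 * (ρr ^ 2 - ρj ^ 2)) :
    IsGreatest (limitDensities ρr j) ρj := by
  refine ⟨⟨hρj, ?_⟩, fun r hr => ?_⟩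
  · rw [hj]; field_simp; ring
  · obtain ⟨hr0, hr⟩ := hr
    have h1 : j ^ 2 = r ^ 4 * (ρr ^ 2 - r ^ 2) := by
      field_simp at hr; linarith
    by_contra! hlt
    have h2 : ρj ^ 2 < r ^ 2 := by gcongr
    rw [hj] at h1
    have h3 : (r ^ 2 - ρj ^ 2) * (r ^ 4 + r ^ 2 * ρj ^ 2 + ρj ^ 4 - ρr ^ 2 * (r ^ 2 + ρj ^ 2)) =
        0 := by linear_combination h1
    have h4 : 0 < ρj ^ 2 := by positivity
    have h5 : 0 < r ^ 4 + r ^ 2 * ρj ^ 2 + ρj ^ 4 - ρr ^ 2 * (r ^ 2 + ρj ^ 2) := by nlinarith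
    rcases mul_eq_zero.1 h3 with h | h <;> linarith

theorem exists_limitDensity {ρr j : ℝ} (hρr : 0 < ρr) (hj : j ^ 2 < 4 / 27 * ρr ^ 6) :
    ∃ ρj, 0 < ρj ∧ ρj ≤ ρr ∧ 2 * ρr ^ 2 < 3 * ρj ^ 2 ∧ j ^ 2 = ρj ^ 4 * (ρr ^ 2 - ρj ^ 2) := by
  have hc : ContinuousOn (fun s : ℝ => s ^ 2 * (ρr ^ 2 - s)) (Icc (2 / 3 * ρr ^ 2) (ρr ^ 2)) := by
    fun_prop
  obtain ⟨s, hs, h1⟩ := intermediate_value_Icc' (by nlinarith) hc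
    (show j ^ 2 ∈ _ from ⟨by simp; positivity, by nlinarith⟩)
  simp only at h1
  have hs0 : 0 < s := lt_of_lt_of_le (by positivity) hs.1
  refine ⟨√s, Real.sqrt_pos.2 hs0, Real.sqrt_le_iff.2 ⟨hρr.le, hs.2⟩, ?_, ?_⟩
  · rw [Real.sq_sqrt hs0.le]
    have : 2 / 3 * ρr ^ 2 ≠ s := by
      rintro rfl
      nlinarith
    have := lt_of_le_of_ne hs.1 this
    linarith
  · have : √s ^ 4 = s ^ 2 := by
      rw [show √s ^ 4 = (√s ^ 2) ^ 2 by ring, Real.sq_sqrt hs0.le]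
    rw [this, Real.sq_sqrt hs0.le, h1]

/-- Over a compact set of pairs the limit densities and the gaps are controlled uniformly. -/
theorem exists_uniform_layerParams {K : Set (ℝ × ℝ)} (hK : IsCompact K)
    (h : ∀ ρr j : ℝ, (ρr, j) ∈ K → 0 < ρr ∧ j ^ 2 < 4 / 27 * ρr ^ 6) :
    ∃ a b g : ℝ, 0 < a ∧ 0 < b ∧ 0 < g ∧ ∀ ρr j : ℝ, (ρr, j) ∈ K →
      ∃ ρj, IsGreatest (limitDensities ρr j) ρj ∧ LayerParams a b g ρr j ρj := by
  obtain ⟨a₀, ha₀, ha⟩ := hK.exists_forall_le' (a := 0)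
    continuous_fst.continuousOn (fun x hx => (h x.1 x.2 hx).1)
  have hcont : Continuous fun x : ℝ × ℝ => 4 / 27 * x.1 ^ 6 - x.2 ^ 2 := by fun_prop
  obtain ⟨d, hd, hd'⟩ := hK.exists_forall_le' (a := 0) hcont.continuousOn (fun x hx => sub_pos.2 (h x.1 x.2 hx).2)
  obtain ⟨b, hb0, hB⟩ : ∃ b : ℝ, 0 < b ∧ ∀ x ∈ K, x.1 ≤ b := by
    obtain ⟨B, hB⟩ := hK.bddAbove_image continuous_fst.continuousOn
    exact ⟨max B 1, lt_max_of_lt_right one_pos,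
      fun x hx => le_max_of_le_left (hB (mem_image_of_mem _ hx))⟩
  refine ⟨a₀ / 2, b, 3 * √(3 * d / (4 * b ^ 2)), by positivity, hb0, by positivity,
    fun ρr j hx => ?_⟩
  obtain ⟨hρr, hj⟩ := h ρr j hx
  obtain ⟨ρj, h0, h1, h2, h3⟩ := exists_limitDensity hρr hj
  have h4 : a₀ ≤ ρr := ha (ρr, j) hx
  have h5 : d ≤ 4 / 27 * ρr ^ 6 - j ^ 2 := hd' (ρr, j) hx
  have h6 : ρr ≤ b := hB (ρr, j) hx
  refine ⟨ρj, isGreatest_limitDensities h0 h2 h3, by positivity, by positivity, ?_, h1, h6, ?_, h3⟩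
  · exact le_of_pow_le_pow_left₀ two_ne_zero h0.le (by nlinarith)
  · have hη : 0 ≤ ρj ^ 2 - 2 / 3 * ρr ^ 2 := by linarith
    have : √(3 * d / (4 * b ^ 2)) ≤ ρj ^ 2 - 2 / 3 * ρr ^ 2 := by
      refine (Real.sqrt_le_left hη).2 ?_
      rw [div_le_iff₀ (by positivity)]
      -- the discriminant measures the distance of `ρj²` from the double root `2 ρr² / 3`
      have e1 : 4 / 27 * ρr ^ 6 - j ^ 2 =
          (ρj ^ 2 - 2 / 3 * ρr ^ 2) ^ 2 * (ρj ^ 2 + ρr ^ 2 / 3) := by rw [h3]; ring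
      have e2 : ρj ^ 2 + ρr ^ 2 / 3 ≤ 4 / 3 * b ^ 2 := by
        have : ρj ^ 2 ≤ ρr ^ 2 := by gcongr
        have : ρr ^ 2 ≤ b ^ 2 := by gcongr
        linarith
      have e3 := mul_le_mul_of_nonneg_left e2 (sq_nonneg (ρj ^ 2 - 2 / 3 * ρr ^ 2))
      linarith
    linarith

/-- The parameters of the boundary layer at a boundary point with subcritical phase gradient. -/
theorem limitDensity_of_phase {ζs ζt ρr j ρj : ℝ} (h : ζs ^ 2 + ζt ^ 2 < 1 / 3)
    (hρr : ρr = √(1 - ζs ^ 2)) (hj : j = -((1 - (ζs ^ 2 + ζt ^ 2)) * ζt))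
    (hρj : ρj = √(1 - (ζs ^ 2 + ζt ^ 2))) :
    0 < ρr ∧ j ^ 2 < 4 / 27 * ρr ^ 6 ∧ IsGreatest (limitDensities ρr j) ρj ∧
      ζt = -(j / ρj ^ 2) := by
  have h1 : 0 < 1 - ζs ^ 2 := by nlinarith [sq_nonneg ζt]
  have h2 : 0 < 1 - (ζs ^ 2 + ζt ^ 2) := by linarith
  have hρr2 : ρr ^ 2 = 1 - ζs ^ 2 := by rw [hρr, Real.sq_sqrt h1.le]
  have hρj2 : ρj ^ 2 = 1 - (ζs ^ 2 + ζt ^ 2) := by rw [hρj, Real.sq_sqrt h2.le]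
  have hρj0 : 0 < ρj := by rw [hρj]; exact Real.sqrt_pos.2 h2
  have hjρ : j = -(ρj ^ 2 * ζt) := by rw [hj, hρj2]
  have hgap : 0 < ρj ^ 2 - 2 / 3 * ρr ^ 2 := by rw [hρr2, hρj2]; nlinarith [sq_nonneg ζt]
  have hfl : j ^ 2 = ρj ^ 4 * (ρr ^ 2 - ρj ^ 2) := by
    rw [hjρ, show ρr ^ 2 - ρj ^ 2 = ζt ^ 2 by rw [hρr2, hρj2]; ring]; ring
  refine ⟨by rw [hρr]; exact Real.sqrt_pos.2 h1, ?_,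
    isGreatest_limitDensities hρj0 (by linarith) hfl, ?_⟩
  · have e1 : 4 / 27 * ρr ^ 6 - j ^ 2 =
        (ρj ^ 2 - 2 / 3 * ρr ^ 2) ^ 2 * (ρj ^ 2 + ρr ^ 2 / 3) := by rw [hfl]; ring
    have e2 : 0 < (ρj ^ 2 - 2 / 3 * ρr ^ 2) ^ 2 * (ρj ^ 2 + ρr ^ 2 / 3) := by positivity
    linarith
  · rw [hjρ]; field_simp

/-- First part: let `ζs`, `ζt` be the tangential and inward normal derivatives of the outer phase
at a boundary point, so that `ρr = (1 - ζs²)^{1/2}` and `j = -(1 - |∇ζ|²) ζt`. If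
`|∇ζ| < 1/√3`, then `j² < (4/27) ρr⁶`, the largest root `ρj` of the limit equation is
`(1 - |∇ζ|²)^{1/2}`, and `ζt = -j / ρj²`.
Second part: existence, uniqueness and exponential decay, with constants that are uniform over
compact sets `K` of pairs `(ρr, j)` with `ρr > 0` and `j² < (4/27) ρr⁶`. -/
theorem lemma1p1 :
    (∀ ζs ζt ρr j ρj : ℝ, ζs ^ 2 + ζt ^ 2 < 1 / 3 →
      ρr = √(1 - ζs ^ 2) → j = -((1 - (ζs ^ 2 + ζt ^ 2)) * ζt) →
      ρj = √(1 - (ζs ^ 2 + ζt ^ 2)) →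
        0 < ρr ∧ j ^ 2 < 4 / 27 * ρr ^ 6 ∧ IsGreatest (limitDensities ρr j) ρj ∧
          ζt = -(j / ρj ^ 2)) ∧
    (∀ K : Set (ℝ × ℝ), IsCompact K →
      (∀ ρr j : ℝ, (ρr, j) ∈ K → 0 < ρr ∧ j ^ 2 < 4 / 27 * ρr ^ 6) →
      ∃ σstar γ C : ℝ, 0 < σstar ∧ 0 < γ ∧ 0 < C ∧
        ∀ ρr j : ℝ, (ρr, j) ∈ K →
          ∃ ρj : ℝ, IsGreatest (limitDensities ρr j) ρj ∧
            ∀ σ₀ : ℝ, σstar < σ₀ →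
              ∃ ρ φ : ℝ → ℝ, IsAdmissibleSolution ρr j ρj σ₀ ρ φ ∧
                (∀ ρ₂ φ₂ : ℝ → ℝ, IsAdmissibleSolution ρr j ρj σ₀ ρ₂ φ₂ →
                  Set.EqOn ρ₂ ρ (Set.Ici 0) ∧ Set.EqOn φ₂ φ (Set.Ici 0)) ∧
                (∀ τ : ℝ, 0 ≤ τ →
                  |φ τ| + |halfDeriv φ τ| + √|ρ τ ^ 2 - ρj ^ 2| + |halfDeriv ρ τ|
                      + |phaseDeriv j (-(j / ρj ^ 2)) σ₀ ρ φ τ|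
                    < C * Real.exp (-(γ * τ / √σ₀)))) := by
  refine ⟨fun ζs ζt ρr j ρj h h1 h2 h3 => limitDensity_of_phase h h1 h2 h3, fun K hK h => ?_⟩
  obtain ⟨a, b, g, ha, hb, hg, hpar⟩ := exists_uniform_layerParams hK h
  obtain ⟨k, P, δ, e₀, he₀, hconst⟩ := exists_layerConsts ha hb hg
  refine ⟨1 / e₀ ^ 2, a ^ 2 / (2 * b), decayTotal a b g, by positivity, by positivity,
    decayTotal_pos ha hb hg, fun ρr j hx => ?_⟩
  obtain ⟨ρj, hgr, hp⟩ := hpar ρr j hx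
  refine ⟨ρj, hgr, fun σ₀ hσ => ?_⟩
  have hσ0 : 0 < σ₀ := lt_trans (by positivity) hσ
  have hs : 0 < √σ₀ := Real.sqrt_pos.2 hσ0
  have he : 1 / √σ₀ < e₀ := by
    rw [div_lt_iff₀ hs, mul_comm, ← div_lt_iff₀ he₀]
    refine Real.lt_sqrt_of_sq_lt ?_
    rw [div_pow, one_pow]; exact hσ
  have hc := hconst (1 / √σ₀) (by positivity) he
  have hσe : σ₀ * (1 / √σ₀) ^ 2 = 1 := by
    rw [div_pow, Real.sq_sqrt hσ0.le]; field_simp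
  obtain ⟨r, p, z, hprof⟩ := exists_layerProfile hp hc
  obtain ⟨T, hT⟩ := hprof.exists_isTimeChange hp
  refine ⟨fun τ => r (T τ), profilePotential j (1 / √σ₀) z T,
    hprof.isAdmissibleSolution hp hc hT hσe, fun ρ₂ φ₂ h₂ => h₂.eq_profile hp hc hprof hT hσe,
    fun τ hτ => ?_⟩
  have := hprof.decay_total hp hc hT hσe hτ
  have e1 : -(a ^ 2 / (2 * b) * (1 / √σ₀)) * τ = -(a ^ 2 / (2 * b) * τ / √σ₀) := by ring
  rwa [e1] at this
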